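/- Let $G$ be an étale groupoid (a topological groupoid, not necessarily Hausdorff, whose unit space $G^0$ is locally compact Hausdorff and whose range map $r:G\to G^0$ is a local homeomorphism), and let $\mathscr C_c(G)$ be its convolution $*$-algebra: the linear span of the functions on $G$ that are continuous with compact support on some open bisection and zero elsewhere, with $(f_1*f_2)(g)=\sum_{s(h)=s(g)}f_1(gh^{-1})f_2(h)$ and $f^*(g)=\overline{f(g^{-1})}$. Let $X\subseteq G^0$ be closed and locally invariant: every $g\in G$ with $r(g),s(g)\in X$ has an open neighbourhood $U$ such that $s(\tilde g)\in X\iff r(\tilde g)\in X$ for all $\tilde g\in U$. Put $G|_X=r^{-1}(X)\cap s^{-1}(X)$ (again an étale groupoid) and let $r_X:\mathscr C_c(G)\to\mathscr C_c(G|_X)$ be restriction of functions. A local groupoid about $G|_X$ is an open subgroupoid $H\subseteq G$ with $H|_X=G|_X$ for which $X$ is $H$-invariant; $\mathscr C_c(H)$ is viewed inside $\mathscr C_c(G)$ by extending functions by zero. For a C*-seminorm $\rho$ (a submultiplicative seminorm with $\rho(a^*a)=\rho(a)^2$), $C^*_\rho$ denotes the C*-algebra obtained as Hausdorff completion; $\rho$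 is a pre-C*-norm if moreover $\rho(a)=0$ only for $a=0$. A linear map $\eta:\mathcal A\to\mathcal B$, where $\mathcal A$ is a pre-C*-algebra and $\mathcal B$ is a $*$-algebra, is compressible to a $*$-subalgebra $\mathcal C\subseteq\mathcal A$ if $\eta|_{\mathcal C}$ is a $*$-homomorphism and for all $a\in\mathcal A$, $\varepsilon>0$ there are $\phi\in\widetilde{\mathcal C}\subseteq\widetilde{\mathcal A}$ (unitizations) and $c\in\mathcal C$ with $\|\phi\|\le1$, $\eta(\phi)=1$, $\eta(a)=\eta(c)$ and $\|\phi^*a\phi-c\|\le\varepsilon$. Approximate units are nets of positive elements of norm at most $1$; $C_c(G^0\setminus X)$ carries the supremum norm. Let $\rho$ be any pre-C*-norm on $\mathscr C_c(G)$. Then: 1. There is a local groupoid $H$ about $G|_X$ with $H^0=G^0$, and for every local groupoid $H$ about $G|_X$ the map $r_X:\mathscr C_c(H)\to\mathscr C_c(G|_X)$ is surjective. 2. For every local groupoid $H$ about $G|_X$ with $H^0=G^0$, the map $r_X:\mathscr C_c(G)\to\mathscr C_c(G|_X)$ is compressible (for $\rho$) to the $*$-homomorphism $r_X:\mathscr C_c(H)\to\mathscr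 C_c(G|_X)$, and every approximate unit of $C_c(G^0\setminus X)$ is an approximate unit for $\ker(r_X|_{\mathscr C_c(H)})$. 3. For every local groupoid $H$ about $G|_X$ put $\rho(X)(b)=\inf\{\rho(a):a\in\mathscr C_c(H),\ r_X(a)=b\}$ for $b\in\mathscr C_c(G|_X)$. Then $\rho(X)$ does not depend on $H$; it is also equal to $\inf\{\rho(a):a\in\mathscr C_c(G),\ r_X(a)=b\}$, and it is a C*-seminorm on $\mathscr C_c(G|_X)$. If for every $g\in G|_X$ the evaluation $f\mapsto f(g)$ is $\rho$-bounded on $\mathscr C_c(G)$ (in particular, if $\rho$ dominates the reduced norm $\|f\|_r=\sup_{x\in G^0}\|\psi\mapsto f*\psi\|_{B(\ell^2(s^{-1}(x)))}$, since $|f(g)|\le\|f\|_r$), then $\rho(X)$ is a pre-C*-norm. 4. The map $r_X$ extends to a contraction $\eta_X:C^*_\rho(G)\to C^*_{\rho(X)}(G|_X)$. For every local groupoid $H$ about $G|_X$ with $H^0=G^0$, $\eta_X$ is compressible to the $*$-homomorphism $\eta_X:C^*_\rho(H)\to C^*_{\rho(X)}(G|_X)$, where $C^*_\rho(H)$ is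 the closure of $\mathscr C_c(H)$ in $C^*_\rho(G)$, and every approximate unit of $C_c(G^0\setminus X)$ is an approximate unit for $\ker(\eta_X|_{C^*_\rho(H)})$. -/

import Mathlib

open Filter Topology

/-! ### C*-seminorms on *-algebras, the C*-algebras they induce, compressible maps -/

noncomputable section CStarSeminormSection

/-- A C*-seminorm on a complex *-algebra: a submultiplicative seminorm with the C*-identity. -/
structure CStarSeminorm (A : Type*) [NonUnitalRing A] [StarRing A] [Module ℂ A] extends
    Seminorm ℂ A where
  mul_le_mul' : ∀ a b : A, toFun (a * b) ≤ toFun a * toFun b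
  star_mul_self' : ∀ a : A, toFun (star a * a) = toFun a ^ 2

namespace CStarSeminorm

variable {A : Type*} [NonUnitalRing A] [StarRing A] [Module ℂ A]

instance : CoeFun (CStarSeminorm A) (fun _ => A → ℝ) := ⟨fun ρ => ρ.toFun⟩

/-- A C*-seminorm is a (pre-)C*-norm if only the zero element has norm zero. -/
class IsNorm (ρ : CStarSeminorm A) : Prop where
  eq_zero : ∀ a : A, ρ a = 0 → a = 0

/-- The *-algebra `A`, equipped with the seminorm `ρ`. -/
def Alg (_ρ : CStarSeminorm A) : Type _ := A

variable (ρ : CStarSeminorm A)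

instance : NonUnitalRing ρ.Alg := inferInstanceAs (NonUnitalRing A)
instance : StarRing ρ.Alg := inferInstanceAs (StarRing A)
instance : Module ℂ ρ.Alg := inferInstanceAs (Module ℂ A)
instance [StarModule ℂ A] : StarModule ℂ ρ.Alg := inferInstanceAs (StarModule ℂ A)
instance [IsScalarTower ℂ A A] : IsScalarTower ℂ ρ.Alg ρ.Alg :=
  inferInstanceAs (IsScalarTower ℂ A A)
instance [SMulCommClass ℂ A A] : SMulCommClass ℂ ρ.Alg ρ.Alg :=
  inferInstanceAs (SMulCommClass ℂ A A)

/-- The identity map from `A` to `A` equipped with `ρ`. -/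
def toAlg : A →⋆ₙₐ[ℂ] ρ.Alg where
  toFun a := a
  map_smul' _ _ := rfl
  map_zero' := rfl
  map_add' _ _ := rfl
  map_mul' _ _ := rfl
  map_star' _ := rfl

/-- The identity map from `A` equipped with `ρ` to `A`. -/
def ofAlg : ρ.Alg →ₗ[ℂ] A where
  toFun a := a
  map_smul' _ _ := rfl
  map_add' _ _ := rfl

instance : NonUnitalSeminormedRing ρ.Alg where
  __ := (inferInstance : NonUnitalRing ρ.Alg)
  __ := AddGroupSeminorm.toSeminormedAddCommGroup (E := ρ.Alg) ρ.toSeminorm.toAddGroupSeminorm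
  norm_mul_le := ρ.mul_le_mul'

instance [ρ.IsNorm] : NonUnitalNormedRing ρ.Alg where
  __ := (inferInstance : NonUnitalSeminormedRing ρ.Alg)
  eq_of_dist_eq_zero := by
    intro x y h
    rw [dist_eq_norm] at h
    exact sub_eq_zero.1 (IsNorm.eq_zero (ρ := ρ) _ h)

instance : NormedSpace ℂ ρ.Alg where
  norm_smul_le z a := (ρ.smul' z a).le

theorem norm_toAlg (a : A) : ‖ρ.toAlg a‖ = ρ a := rfl

theorem star_mul_self_norm (a : ρ.Alg) : ‖star a * a‖ = ‖a‖ ^ 2 := ρ.star_mul_self' a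

theorem norm_star_le (a : ρ.Alg) : ‖star a‖ ≤ ‖a‖ := by
  by_contra h
  push Not at h
  have h1 := ρ.star_mul_self_norm (star a)
  rw [star_star] at h1
  have h2 := norm_mul_le a (star a)
  have h3 := norm_nonneg a
  nlinarith

instance : NormedStarGroup ρ.Alg := ⟨ρ.norm_star_le⟩

instance [ρ.IsNorm] : CStarRing ρ.Alg where
  norm_mul_self_le a := by
    have := ρ.star_mul_self_norm a
    rw [this, sq]

/-- The C*-algebra `C*_ρ` induced by the C*-seminorm `ρ`: the (Hausdorff) completion of `A`
with respect to `ρ`. -/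
def Completed : Type _ := UniformSpace.Completion ρ.Alg

open UniformSpace in
instance : NormedAddCommGroup ρ.Completed :=
  inferInstanceAs (NormedAddCommGroup (Completion ρ.Alg))

instance : CompleteSpace ρ.Completed :=
  inferInstanceAs (CompleteSpace (UniformSpace.Completion ρ.Alg))

instance : NormedSpace ℂ ρ.Completed :=
  inferInstanceAs (NormedSpace ℂ (UniformSpace.Completion ρ.Alg))

/-- The canonical linear isometry with dense range. -/
def coeL : ρ.Alg →ₗᵢ[ℂ] ρ.Completed := UniformSpace.Completion.toComplₗᵢ

theorem denseRange_coeL : DenseRange ρ.coeL := UniformSpace.Completion.denseRange_coe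

theorem isDenseInducing_coeL : IsDenseInducing ρ.coeL :=
  UniformSpace.Completion.isDenseInducing_coe

/-- The product of the completion is the continuous extension of the product. -/
instance : Mul ρ.Completed :=
  ⟨fun a b => (ρ.isDenseInducing_coeL.prodMap ρ.isDenseInducing_coeL).extend
    (fun p : ρ.Alg × ρ.Alg => ρ.coeL (p.1 * p.2)) (a, b)⟩

theorem coeL_mul (a b : ρ.Alg) : ρ.coeL (a * b) = ρ.coeL a * ρ.coeL b :=
  ((ρ.isDenseInducing_coeL.prodMap ρ.isDenseInducing_coeL).extend_eq
    (f := fun p : ρ.Alg × ρ.Alg => ρ.coeL (p.1 * p.2))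
    (ρ.coeL.continuous.comp continuous_mul) (a, b)).symm

instance : ContinuousMul ρ.Completed where
  continuous_mul := by
    let m := (AddMonoidHom.mul : ρ.Alg →+ ρ.Alg →+ ρ.Alg).compr₂
      (ρ.coeL.toLinearMap.toAddMonoidHom)
    have hm : Continuous fun p : ρ.Alg × ρ.Alg => m p.1 p.2 :=
      ρ.coeL.continuous.comp continuous_mul
    have di : IsDenseInducing (ρ.coeL.toLinearMap.toAddMonoidHom : ρ.Alg → ρ.Completed) :=
      ρ.isDenseInducing_coeL
    exact (di.extend_Z_bilin di hm :)

/-- The involution of the completion is the continuous extension of the involution. -/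
instance : Star ρ.Completed := ⟨ρ.isDenseInducing_coeL.extend (fun a => ρ.coeL (star a))⟩

theorem coeL_star (a : ρ.Alg) : ρ.coeL (star a) = star (ρ.coeL a) :=
  (ρ.isDenseInducing_coeL.extend_eq (f := fun a => ρ.coeL (star a))
    (ρ.coeL.continuous.comp continuous_star) a).symm

theorem continuous_star_completed : Continuous (star : ρ.Completed → ρ.Completed) := by
  have h : UniformContinuous (fun a : ρ.Alg => ρ.coeL (star a)) :=
    ρ.coeL.isometry.uniformContinuous.comp star_isometry.uniformContinuous
  exact (uniformContinuous_uniformly_extend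
    (UniformSpace.Completion.isUniformInducing_coe ρ.Alg) ρ.denseRange_coeL h).continuous

instance : ContinuousStar ρ.Completed := ⟨ρ.continuous_star_completed⟩

theorem ind₁ {p : ρ.Completed → Prop} (hp : IsClosed {a | p a}) (h : ∀ a, p (ρ.coeL a)) (a) :
    p a := ρ.denseRange_coeL.induction_on a hp h

theorem ind₂ {p : ρ.Completed → ρ.Completed → Prop}
    (hp : IsClosed {q : ρ.Completed × ρ.Completed | p q.1 q.2})
    (h : ∀ a b, p (ρ.coeL a) (ρ.coeL b)) (a b) : p a b :=
  ρ.denseRange_coeL.induction_on₂ hp h a b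

theorem ind₃ {p : ρ.Completed → ρ.Completed → ρ.Completed → Prop}
    (hp : IsClosed {q : ρ.Completed × ρ.Completed × ρ.Completed | p q.1 q.2.1 q.2.2})
    (h : ∀ a b c, p (ρ.coeL a) (ρ.coeL b) (ρ.coeL c)) (a b c) : p a b c :=
  ρ.denseRange_coeL.induction_on₃ hp h a b c

theorem completed_mul_assoc (a b c : ρ.Completed) : a * b * c = a * (b * c) :=
  ρ.ind₃ (p := fun a b c => a * b * c = a * (b * c)) (isClosed_eq (by fun_prop) (by fun_prop))
    (fun a b c => by simp only [← coeL_mul, mul_assoc]) a b c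

theorem completed_mul_add (a b c : ρ.Completed) : a * (b + c) = a * b + a * c :=
  ρ.ind₃ (p := fun a b c => a * (b + c) = a * b + a * c)
    (isClosed_eq (by fun_prop) (by fun_prop))
    (fun a b c => by simp only [← coeL_mul, ← map_add, mul_add]) a b c

theorem completed_add_mul (a b c : ρ.Completed) : (a + b) * c = a * c + b * c :=
  ρ.ind₃ (p := fun a b c => (a + b) * c = a * c + b * c)
    (isClosed_eq (by fun_prop) (by fun_prop))
    (fun a b c => by simp only [← coeL_mul, ← map_add, add_mul]) a b c

theorem completed_norm_mul_le (a b : ρ.Completed) : ‖a * b‖ ≤ ‖a‖ * ‖b‖ :=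
  ρ.ind₂ (p := fun a b => ‖a * b‖ ≤ ‖a‖ * ‖b‖) (isClosed_le (by fun_prop) (by fun_prop))
    (fun a b => by simpa only [← coeL_mul, LinearIsometry.norm_map] using norm_mul_le a b) a b

theorem completed_star_star (a : ρ.Completed) : star (star a) = a :=
  ρ.ind₁ (p := fun a => star (star a) = a) (isClosed_eq (by fun_prop) (by fun_prop))
    (fun a => by simp only [← coeL_star, star_star]) a

theorem completed_star_mul (a b : ρ.Completed) : star (a * b) = star b * star a :=
  ρ.ind₂ (p := fun a b => star (a * b) = star b * star a)
    (isClosed_eq (by fun_prop) (by fun_prop))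
    (fun a b => by simp only [← coeL_star, ← coeL_mul, star_mul]) a b

theorem completed_star_add (a b : ρ.Completed) : star (a + b) = star a + star b :=
  ρ.ind₂ (p := fun a b => star (a + b) = star a + star b)
    (isClosed_eq (by fun_prop) (by fun_prop))
    (fun a b => by simp only [← coeL_star, ← map_add, star_add]) a b

theorem completed_norm_star_mul_self (a : ρ.Completed) : ‖a‖ * ‖a‖ ≤ ‖star a * a‖ :=
  ρ.ind₁ (p := fun a => ‖a‖ * ‖a‖ ≤ ‖star a * a‖) (isClosed_le (by fun_prop) (by fun_prop))
    (fun a => by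
      simp only [← coeL_star, ← coeL_mul, LinearIsometry.norm_map, star_mul_self_norm]
      rw [sq]) a

theorem coeL_smul (z : ℂ) (a : ρ.Alg) : ρ.coeL (z • a) = z • ρ.coeL a := ρ.coeL.map_smul z a

theorem completed_smul_mul [IsScalarTower ℂ A A] (z : ℂ) (a b : ρ.Completed) :
    (z • a) * b = z • (a * b) :=
  ρ.ind₂ (p := fun a b => (z • a) * b = z • (a * b))
    (isClosed_eq ((continuous_fst.const_smul z).mul continuous_snd)
      ((continuous_fst.mul continuous_snd).const_smul z))
    (fun a b => by
      have h : (z • a) * b = z • (a * b) := smul_mul_assoc (β := A) z a b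
      rw [← coeL_smul, ← coeL_mul, h, coeL_smul, coeL_mul]) a b

theorem completed_mul_smul [SMulCommClass ℂ A A] (z : ℂ) (a b : ρ.Completed) :
    a * (z • b) = z • (a * b) :=
  ρ.ind₂ (p := fun a b => a * (z • b) = z • (a * b))
    (isClosed_eq (continuous_fst.mul (continuous_snd.const_smul z))
      ((continuous_fst.mul continuous_snd).const_smul z))
    (fun a b => by
      have h : a * (z • b) = z • (a * b) := mul_smul_comm (β := A) z a b
      rw [← coeL_smul, ← coeL_mul, h, coeL_smul, coeL_mul]) a b

theorem completed_star_smul [StarModule ℂ A] (z : ℂ) (a : ρ.Completed) :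
    star (z • a) = star z • star a :=
  ρ.ind₁ (p := fun a => star (z • a) = star z • star a)
    (isClosed_eq (ρ.continuous_star_completed.comp (continuous_const_smul z))
      (ρ.continuous_star_completed.const_smul (star z)))
    (fun a => by
      have h : star (z • a) = star z • star a := star_smul (A := A) z a
      rw [← coeL_smul, ← coeL_star, h, coeL_smul, coeL_star]) a

instance : NonUnitalNormedRing ρ.Completed where
  __ := (inferInstance : NormedAddCommGroup ρ.Completed)
  __ := (inferInstance : Mul ρ.Completed)
  left_distrib := ρ.completed_mul_add
  right_distrib := ρ.completed_add_mul
  mul_assoc := ρ.completed_mul_assoc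
  norm_mul_le := ρ.completed_norm_mul_le
  zero_mul a := by
    have h := ρ.completed_add_mul 0 0 a
    rw [add_zero] at h
    simpa using h
  mul_zero a := by
    have h := ρ.completed_mul_add a 0 0
    rw [add_zero] at h
    simpa using h

instance : StarRing ρ.Completed where
  star_involutive := ρ.completed_star_star
  star_mul := ρ.completed_star_mul
  star_add := ρ.completed_star_add

instance [IsScalarTower ℂ A A] [SMulCommClass ℂ A A] [StarModule ℂ A] :
    NonUnitalCStarAlgebra ρ.Completed where
  __ := (inferInstance : NonUnitalNormedRing ρ.Completed)
  __ := (inferInstance : StarRing ρ.Completed)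
  __ := (inferInstance : CompleteSpace ρ.Completed)
  __ := (inferInstance : NormedSpace ℂ ρ.Completed)
  norm_mul_self_le := ρ.completed_norm_star_mul_self
  smul_assoc := ρ.completed_smul_mul
  smul_comm z a b := (ρ.completed_mul_smul z a b).symm
  star_smul := ρ.completed_star_smul

/-- The canonical *-homomorphism from `A` to the C*-algebra induced by `ρ`. -/
def toCompleted : A →⋆ₙₐ[ℂ] ρ.Completed where
  toFun a := ρ.coeL (ρ.toAlg a)
  map_smul' z a := ρ.coeL_smul z (ρ.toAlg a)
  map_zero' := ρ.coeL.map_zero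
  map_add' a b := ρ.coeL.map_add (ρ.toAlg a) (ρ.toAlg b)
  map_mul' a b := ρ.coeL_mul (ρ.toAlg a) (ρ.toAlg b)
  map_star' a := ρ.coeL_star (ρ.toAlg a)

theorem norm_toCompleted (a : A) : ‖ρ.toCompleted a‖ = ρ a := ρ.coeL.norm_map _

theorem denseRange_toCompleted : DenseRange ρ.toCompleted := ρ.denseRange_coeL

end CStarSeminorm

/-- A linear map `η : A → B` on a pre-C*-algebra `A` is compressible to the *-subalgebra `C`:
`η` is a *-homomorphism on `C` and, for all `a` in `A` and `ε > 0`, there are `φ` in the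
unitization of `C` (inside the unitization of `A`, with its C*-norm) and `c` in `C` with
`‖φ‖ ≤ 1`, `η φ = 1` (for the unital extension of `η` to the unitizations), `η a = η c` and
`‖φ⋆ a φ - c‖ ≤ ε`. -/
def IsCompressibleTo {A B : Type*} [NonUnitalNormedRing A] [StarRing A] [CStarRing A]
    [NormedSpace ℂ A] [IsScalarTower ℂ A A] [SMulCommClass ℂ A A] [StarModule ℂ A]
    [NonUnitalRing B] [StarRing B] [Module ℂ B]
    (η : A →ₗ[ℂ] B) (C : NonUnitalStarSubalgebra ℂ A) : Prop :=
  (∀ c ∈ C, ∀ d ∈ C, η (c * d) = η c * η d) ∧ (∀ c ∈ C, η (star c) = star (η c)) ∧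
  ∀ a : A, ∀ ε : ℝ, 0 < ε → ∃ φ : Unitization ℂ A, φ.snd ∈ C ∧ ∃ c ∈ C, ‖φ‖ ≤ 1 ∧
    (Unitization.inl φ.fst + Unitization.inr (η φ.snd) : Unitization ℂ B) = 1 ∧
    η a = η c ∧ ‖star φ * (a : Unitization ℂ A) * φ - (c : Unitization ℂ A)‖ ≤ ε

/-- A net `u` in a normed *-algebra is an approximate unit for the subset `J` (in practice a
*-subalgebra): it consists of positive elements of `J` of norm at most `1`, and
`u i * a → a` and `a * u i → a` for all `a` in `J`. -/
structure IsApproxUnitFor {A : Type*} [NonUnitalNormedRing A] [StarRing A] (J : Set A)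
    {I : Type*} [Preorder I] (u : I → A) : Prop where
  mem : ∀ i, u i ∈ J
  pos : ∀ i, ∃ v ∈ J, u i = star v * v
  norm_le : ∀ i, ‖u i‖ ≤ 1
  mul_left : ∀ a ∈ J, Tendsto (fun i => u i * a) atTop (𝓝 a)
  mul_right : ∀ a ∈ J, Tendsto (fun i => a * u i) atTop (𝓝 a)

end CStarSeminormSection

/-! ### Étale groupoids and their convolution *-algebras -/

noncomputable section EtaleGroupoidSection

/-- An étale groupoid, given by its set of arrows `G`: source and range take values in the unit
arrows, and only products `g * h` with `src g = rng h` are meaningful. The unit space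
`{x // rng x = x}` is locally compact Hausdorff and the range map to it is a local homeomorphism;
`G` itself need not be Hausdorff. -/
class EtaleGroupoid (G : Type*) [TopologicalSpace G] extends Mul G, Inv G where
  src : G → G
  rng : G → G
  rng_rng : ∀ g, rng (rng g) = rng g
  src_rng : ∀ g, src (rng g) = rng g
  rng_src : ∀ g, rng (src g) = src g
  src_src : ∀ g, src (src g) = src g
  src_mul : ∀ g h : G, src g = rng h → src (g * h) = src h
  rng_mul : ∀ g h : G, src g = rng h → rng (g * h) = rng g
  mul_assoc' : ∀ g h k : G, src g = rng h → src h = rng k → g * h * k = g * (h * k)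
  rng_mul_self : ∀ g : G, rng g * g = g
  mul_src_self : ∀ g : G, g * src g = g
  src_inv : ∀ g : G, src g⁻¹ = rng g
  rng_inv : ∀ g : G, rng g⁻¹ = src g
  inv_mul_self : ∀ g : G, g⁻¹ * g = src g
  mul_inv_self : ∀ g : G, g * g⁻¹ = rng g
  continuous_inv' : Continuous fun g : G => g⁻¹
  continuousOn_mul : ContinuousOn (fun p : G × G => p.1 * p.2) {p | src p.1 = rng p.2}
  t2_units : T2Space {x : G // rng x = x}
  locallyCompact_units : LocallyCompactSpace {x : G // rng x = x}
  isLocalHomeomorph_rng :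
    IsLocalHomeomorph fun g : G => (⟨rng g, rng_rng g⟩ : {x : G // rng x = x})

namespace EtaleGroupoid

section Basic

variable {G : Type*} [TopologicalSpace G] [EtaleGroupoid G]

variable (G) in
/-- The unit space, with the relative topology. -/
abbrev UnitSpace : Type _ := {x : G // rng x = x}

variable (G) in
/-- The unit space, as a set of arrows. -/
def units : Set G := {x | rng x = x}

/-- The range map, as a map to the unit space. -/
def rngU (g : G) : UnitSpace G := ⟨rng g, rng_rng g⟩

/-- The source map, as a map to the unit space. -/
def srcU (g : G) : UnitSpace G := ⟨src g, rng_src g⟩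

/-- Open bisections: open sets on which range and source are injective. -/
structure IsOpenBisection (U : Set G) : Prop where
  isOpen : IsOpen U
  injOn_rng : Set.InjOn rng U
  injOn_src : Set.InjOn src U

/-- `f` belongs to `C_c(U)`, extended by zero to `G`: it is continuous on `U` and vanishes off a
compact subset of `U`. -/
def MemCc (U : Set G) (f : G → ℂ) : Prop :=
  ContinuousOn f U ∧ ∃ K : Set G, IsCompact K ∧ K ⊆ U ∧ ∀ g, g ∉ K → f g = 0

/-- The linear span of the spaces `C_c(U)`, for `U` an open bisection contained in `H`. -/
def ccSpan (H : Set G) : Submodule ℂ (G → ℂ) :=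
  Submodule.span ℂ {f | ∃ U : Set G, IsOpenBisection U ∧ U ⊆ H ∧ MemCc U f}

/-- The convolution product
`(f * k) g = ∑_{h : s(h) = s(g)} f (g h⁻¹) k (h)`. -/
def conv (f k : G → ℂ) (g : G) : ℂ := ∑ᶠ h : {h : G // src h = src g}, f (g * (h : G)⁻¹) * k h

/-- The involution `f⋆ g = conj (f g⁻¹)`. -/
def involution (f : G → ℂ) (g : G) : ℂ := star (f g⁻¹)

/-- An open subgroupoid of `G`. -/
structure IsOpenSubgroupoid (H : Set G) : Prop where
  isOpen : IsOpen H
  mul_mem : ∀ g ∈ H, ∀ h ∈ H, src g = rng h → g * h ∈ H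
  inv_mem : ∀ g ∈ H, g⁻¹ ∈ H

/-! Basic facts -/

theorem src_eq_of_unit {x : G} (h : rng x = x) : src x = x := by
  rw [← h, src_rng]

theorem rng_eq_of_src_unit {x : G} (h : src x = x) : rng x = x := by
  rw [← h, rng_src]

theorem continuous_rng : Continuous (rng : G → G) :=
  continuous_subtype_val.comp (isLocalHomeomorph_rng (G := G)).continuous

theorem inv_inv' (g : G) : g⁻¹⁻¹ = g := by
  have h1 : g⁻¹⁻¹ * g⁻¹ * g = g⁻¹⁻¹ * (g⁻¹ * g) :=
    mul_assoc' _ _ _ (by rw [src_inv]) (by rw [src_inv])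
  rw [inv_mul_self, inv_mul_self, src_inv, rng_mul_self] at h1
  have h2 := mul_src_self g⁻¹⁻¹
  rw [src_inv, rng_inv, ← h1] at h2
  exact h2.symm

theorem src_eq_rng_inv : (src : G → G) = fun g => rng g⁻¹ := by
  funext g
  rw [rng_inv]

theorem continuous_src : Continuous (src : G → G) := by
  rw [src_eq_rng_inv]
  exact continuous_rng.comp continuous_inv'

theorem inv_mul_mul {g h : G} (e : src g = rng h) : g⁻¹ * (g * h) = h := by
  rw [← mul_assoc' _ _ _ (src_inv g) e, inv_mul_self, e, rng_mul_self]

theorem mul_inv_mul {g h : G} (e : rng g = rng h) : g * (g⁻¹ * h) = h := by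
  have := inv_mul_mul (g := g⁻¹) (h := h) (by rw [src_inv, e])
  rwa [inv_inv'] at this

theorem mul_mul_inv {g h : G} (e : src g = rng h) : g * h * h⁻¹ = g := by
  rw [mul_assoc' _ _ _ e (by rw [rng_inv]), mul_inv_self, ← e, mul_src_self]

theorem mul_inv_mul' {g h : G} (e : src g = src h) : g * h⁻¹ * h = g := by
  have := mul_mul_inv (g := g) (h := h⁻¹) (by rw [rng_inv, e])
  rwa [inv_inv'] at this

theorem eq_inv_of_mul_unit {g h : G} (e : src g = rng h) (hm : g * h = rng g) : h = g⁻¹ := by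
  rw [← inv_mul_mul e, hm, ← src_inv, mul_src_self]

theorem mul_inv_rev' {g h : G} (e : src g = rng h) : (g * h)⁻¹ = h⁻¹ * g⁻¹ := by
  symm
  have e2 : src h⁻¹ = rng g⁻¹ := by rw [src_inv, rng_inv, e]
  apply eq_inv_of_mul_unit
  · rw [src_mul _ _ e, rng_mul _ _ e2, rng_inv]
  · rw [← mul_assoc' _ _ _ (by rw [src_mul _ _ e, rng_inv]) e2, mul_mul_inv e, mul_inv_self,
      rng_mul _ _ e]

instance : T2Space (UnitSpace G) := t2_units

instance : LocallyCompactSpace (UnitSpace G) := locallyCompact_units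

theorem isLocalHomeomorph_rngU : IsLocalHomeomorph (rngU : G → UnitSpace G) :=
  isLocalHomeomorph_rng

theorem continuous_rngU : Continuous (rngU : G → UnitSpace G) :=
  isLocalHomeomorph_rngU.continuous

theorem continuous_srcU : Continuous (srcU : G → UnitSpace G) :=
  continuous_src.subtype_mk _

theorem isClosed_composable : IsClosed {p : G × G | src p.1 = rng p.2} := by
  have h : IsClosed {p : G × G | srcU p.1 = rngU p.2} :=
    isClosed_eq (continuous_srcU.comp continuous_fst) (continuous_rngU.comp continuous_snd)
  convert h using 3
  simp [srcU, rngU]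

theorem IsOpenBisection.inv {U : Set G} (hU : IsOpenBisection U) :
    IsOpenBisection ((fun g : G => g⁻¹) ⁻¹' U) where
  isOpen := hU.isOpen.preimage continuous_inv'
  injOn_rng g hg h hh e := by
    have : g⁻¹ = h⁻¹ := hU.injOn_src hg hh (by rw [src_inv, src_inv, e])
    rw [← inv_inv' g, this, inv_inv']
  injOn_src g hg h hh e := by
    have : g⁻¹ = h⁻¹ := hU.injOn_rng hg hh (by rw [rng_inv, rng_inv, e])
    rw [← inv_inv' g, this, inv_inv']

theorem MemCc.eq_zero {U : Set G} {f : G → ℂ} (hf : MemCc U f) {g : G} (hg : g ∉ U) :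
    f g = 0 := by
  obtain ⟨-, K, -, hKU, hK⟩ := hf
  exact hK g fun h => hg (hKU h)

theorem MemCc.involution {U : Set G} {f : G → ℂ} (hf : MemCc U f) :
    MemCc ((fun g : G => g⁻¹) ⁻¹' U) (involution f) := by
  obtain ⟨hc, K, hK, hKU, hz⟩ := hf
  refine ⟨(hc.comp continuous_inv'.continuousOn fun g hg => hg).star,
    (fun g : G => g⁻¹) '' K, hK.image continuous_inv', ?_, ?_⟩
  · rintro _ ⟨g, hg, rfl⟩
    simpa [inv_inv'] using hKU hg
  · intro g hg
    have : g⁻¹ ∉ K := fun h => hg ⟨g⁻¹, h, inv_inv' g⟩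
    simp [EtaleGroupoid.involution, hz _ this]

/-! The product of two bisections -/

open Classical in
/-- The element of `U` with the same range as `g` (`g` itself if there is none). -/
def lift (U : Set G) (g : G) : G := if h : ∃ u ∈ U, rng u = rng g then h.choose else g

/-- The domain of `lift`. -/
def liftDom (U : Set G) : Set G := {g | ∃ u ∈ U, rng u = rng g}

theorem lift_mem {U : Set G} {g : G} (h : g ∈ liftDom U) : lift U g ∈ U := by
  have h' : ∃ u ∈ U, rng u = rng g := h
  rw [lift, dif_pos h']
  exact h'.choose_spec.1

theorem rng_lift {U : Set G} {g : G} (h : g ∈ liftDom U) : rng (lift U g) = rng g := by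
  have h' : ∃ u ∈ U, rng u = rng g := h
  rw [lift, dif_pos h']
  exact h'.choose_spec.2

theorem lift_eq {U : Set G} (hU : IsOpenBisection U) {u g : G} (hu : u ∈ U)
    (h : rng u = rng g) : lift U g = u :=
  hU.injOn_rng (lift_mem ⟨u, hu, h⟩) hu (by rw [rng_lift ⟨u, hu, h⟩, h])

theorem isOpen_liftDom {U : Set G} (hU : IsOpen U) : IsOpen (liftDom U) := by
  have h : liftDom U = rngU ⁻¹' (rngU '' U) := by
    ext g
    simp [liftDom, rngU]
  rw [h]
  exact (isLocalHomeomorph_rngU.isOpenMap _ hU).preimage continuous_rngU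

theorem continuousOn_lift {U : Set G} (hU : IsOpenBisection U) :
    ContinuousOn (lift U) (liftDom U) := by
  intro g hg
  refine ContinuousAt.continuousWithinAt ?_
  rw [ContinuousAt, tendsto_nhds]
  intro O hO hgO
  have ho : IsOpen (liftDom (U ∩ O)) := isOpen_liftDom (hU.isOpen.inter hO)
  have hmem : g ∈ liftDom (U ∩ O) := ⟨lift U g, ⟨lift_mem hg, hgO⟩, rng_lift hg⟩
  filter_upwards [ho.mem_nhds hmem] with k hk
  obtain ⟨u, hu, he⟩ := hk
  show lift U k ∈ O
  rw [lift_eq hU hu.1 he]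
  exact hu.2

theorem conv_eq_of_dom {U : Set G} (hU : IsOpenBisection U) {f k : G → ℂ}
    (hf : ∀ g, g ∉ U → f g = 0) {g : G} (hg : g ∈ liftDom U) :
    conv f k g = f (lift U g) * k ((lift U g)⁻¹ * g) := by
  have hr : src (lift U g)⁻¹ = rng g := by rw [src_inv, rng_lift hg]
  have hs : src ((lift U g)⁻¹ * g) = src g := src_mul _ _ hr
  rw [conv, finsum_eq_single _ (⟨(lift U g)⁻¹ * g, hs⟩ : {h : G // src h = src g})]
  · congr 2
    have h1 : src g = rng (g⁻¹ * lift U g) := by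
      rw [rng_mul _ _ (by rw [src_inv, rng_lift hg]), rng_inv]
    show g * ((lift U g)⁻¹ * g)⁻¹ = _
    rw [mul_inv_rev' hr, inv_inv', mul_inv_mul (rng_lift hg).symm]
  · rintro ⟨h, hh⟩ hne
    have h0 : f (g * h⁻¹) = 0 := by
      apply hf
      intro hm
      apply hne
      have e : src g = rng h⁻¹ := by rw [rng_inv, hh]
      have hl := lift_eq hU hm (g := g) (rng_mul _ _ e)
      apply Subtype.ext
      show h = (lift U g)⁻¹ * g
      rw [hl, mul_inv_rev' e, inv_inv', mul_inv_mul' hh]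
    show f (g * h⁻¹) * k h = 0
    rw [h0, zero_mul]

theorem conv_eq_zero_of_not_dom {U : Set G} {f k : G → ℂ}
    (hf : ∀ g, g ∉ U → f g = 0) {g : G} (hg : g ∉ liftDom U) : conv f k g = 0 := by
  rw [conv]
  refine finsum_eq_zero_of_forall_eq_zero ?_
  rintro ⟨h, hh⟩
  have h0 : f (g * h⁻¹) = 0 := by
    apply hf
    intro hm
    exact hg ⟨_, hm, rng_mul _ _ (by rw [rng_inv, hh])⟩
  show f (g * h⁻¹) * k h = 0
  rw [h0, zero_mul]

/-- The product of two sets of arrows. -/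
def setMul (U V : Set G) : Set G := {g | ∃ u ∈ U, ∃ v ∈ V, src u = rng v ∧ u * v = g}

theorem setMul_subset_liftDom {U V : Set G} : setMul U V ⊆ liftDom U := by
  rintro _ ⟨u, hu, v, hv, e, rfl⟩
  exact ⟨u, hu, (rng_mul _ _ e).symm⟩

theorem lift_mul {U : Set G} (hU : IsOpenBisection U) {u v : G} (hu : u ∈ U)
    (e : src u = rng v) : lift U (u * v) = u := lift_eq hU hu (rng_mul _ _ e).symm

theorem continuousOn_lift_inv_mul {U : Set G} (hU : IsOpenBisection U) :
    ContinuousOn (fun g => (lift U g)⁻¹ * g) (liftDom U) := by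
  refine continuousOn_mul.comp (f := fun g => ((lift U g)⁻¹, g))
    ((continuous_inv'.comp_continuousOn (continuousOn_lift hU)).prodMk continuousOn_id) ?_
  intro g hg
  show src (lift U g)⁻¹ = rng g
  rw [src_inv, rng_lift hg]

theorem setMul_eq {U V : Set G} (hU : IsOpenBisection U) :
    setMul U V = liftDom U ∩ (fun g => (lift U g)⁻¹ * g) ⁻¹' V := by
  ext g
  constructor
  · rintro ⟨u, hu, v, hv, e, rfl⟩
    refine ⟨setMul_subset_liftDom ⟨u, hu, v, hv, e, rfl⟩, ?_⟩
    show (lift U (u * v))⁻¹ * (u * v) ∈ V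
    rwa [lift_mul hU hu e, inv_mul_mul e]
  · rintro ⟨h1, h2⟩
    have e : src (lift U g)⁻¹ = rng g := by rw [src_inv, rng_lift h1]
    exact ⟨lift U g, lift_mem h1, _, h2, by rw [rng_mul _ _ e, rng_inv],
      mul_inv_mul (rng_lift h1)⟩

theorem IsOpenBisection.setMul {U V : Set G} (hU : IsOpenBisection U) (hV : IsOpenBisection V) :
    IsOpenBisection (setMul U V) where
  isOpen := by
    rw [setMul_eq hU]
    exact (continuousOn_lift_inv_mul hU).isOpen_inter_preimage (isOpen_liftDom hU.isOpen) hV.isOpen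
  injOn_rng := by
    rintro _ ⟨u, hu, v, hv, e, rfl⟩ _ ⟨u', hu', v', hv', e', rfl⟩ h
    rw [rng_mul _ _ e, rng_mul _ _ e'] at h
    obtain rfl := hU.injOn_rng hu hu' h
    obtain rfl := hV.injOn_rng hv hv' (e.symm.trans e')
    rfl
  injOn_src := by
    rintro _ ⟨u, hu, v, hv, e, rfl⟩ _ ⟨u', hu', v', hv', e', rfl⟩ h
    rw [src_mul _ _ e, src_mul _ _ e'] at h
    obtain rfl := hV.injOn_src hv hv' h
    obtain rfl := hU.injOn_src hu hu' (e.trans e'.symm)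
    rfl

theorem MemCc.conv {U V : Set G} (hU : IsOpenBisection U)
    {f k : G → ℂ} (hf : MemCc U f) (hk : MemCc V k) : MemCc (setMul U V) (conv f k) := by
  have hf0 : ∀ g, g ∉ U → f g = 0 := fun g hg => hf.eq_zero hg
  obtain ⟨hfc, K, hK, hKU, hfK⟩ := hf
  obtain ⟨hkc, L, hL, hLV, hkL⟩ := hk
  have hsub : EtaleGroupoid.setMul U V ⊆ liftDom U := setMul_subset_liftDom
  constructor
  · have h1 : ContinuousOn (fun g => f (lift U g) * k ((lift U g)⁻¹ * g))
        (EtaleGroupoid.setMul U V) := by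
      refine (hfc.comp ((continuousOn_lift hU).mono hsub) fun g hg => lift_mem (hsub hg)).mul
        (hkc.comp ((continuousOn_lift_inv_mul hU).mono hsub) fun g hg => ?_)
      rw [setMul_eq hU] at hg
      exact hg.2
    exact h1.congr fun g hg => conv_eq_of_dom hU hf0 (hsub hg)
  · refine ⟨(fun p : G × G => p.1 * p.2) '' ((K ×ˢ L) ∩ {p | src p.1 = rng p.2}),
      ((hK.prod hL).inter_right isClosed_composable).image_of_continuousOn
        (continuousOn_mul.mono Set.inter_subset_right), ?_, ?_⟩
    · rintro _ ⟨⟨a, b⟩, ⟨⟨ha, hb⟩, e⟩, rfl⟩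
      exact ⟨a, hKU ha, b, hLV hb, e, rfl⟩
    · intro g hg
      by_cases hd : g ∈ liftDom U
      · rw [conv_eq_of_dom hU hf0 hd]
        by_contra hne
        have e : src (lift U g)⁻¹ = rng g := by rw [src_inv, rng_lift hd]
        have ha : lift U g ∈ K := by
          by_contra h
          exact hne (by rw [hfK _ h, zero_mul])
        have hb : (lift U g)⁻¹ * g ∈ L := by
          by_contra h
          exact hne (by rw [hkL _ h, mul_zero])
        exact hg ⟨(lift U g, (lift U g)⁻¹ * g),
          ⟨⟨ha, hb⟩, by show src _ = rng _; rw [rng_mul _ _ e, rng_inv]⟩,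
          mul_inv_mul (rng_lift hd)⟩
      · exact conv_eq_zero_of_not_dom hf0 hd

/-! Algebraic rules for the convolution -/

/-- Finite support on every source fibre. -/
def FinFib (k : G → ℂ) : Prop := ∀ x : G, {h : G | src h = x ∧ k h ≠ 0}.Finite

theorem MemCc.finFib {U : Set G} (hU : IsOpenBisection U) {f : G → ℂ} (hf : MemCc U f) :
    FinFib f := by
  intro x
  refine Set.Subsingleton.finite ?_
  rintro g ⟨hg, hg0⟩ h ⟨hh, hh0⟩
  have hgU : g ∈ U := by
    by_contra hc
    exact hg0 (hf.eq_zero hc)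
  have hhU : h ∈ U := by
    by_contra hc
    exact hh0 (hf.eq_zero hc)
  exact hU.injOn_src hgU hhU (hg.trans hh.symm)

theorem finFib_of_mem {H : Set G} {f : G → ℂ} (hf : f ∈ ccSpan H) : FinFib f := by
  induction hf using Submodule.span_induction with
  | mem f hf =>
    obtain ⟨U, hU, -, hfU⟩ := hf
    exact hfU.finFib hU
  | zero => intro x; simp
  | add f k _ _ hf hk =>
    intro x
    refine ((hf x).union (hk x)).subset ?_
    rintro h ⟨hx, h0⟩
    by_cases hz : f h = 0
    · right
      exact ⟨hx, fun hk0 => h0 (by simp [hz, hk0])⟩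
    · left
      exact ⟨hx, hz⟩
  | smul c f _ hf =>
    intro x
    refine (hf x).subset ?_
    rintro h ⟨hx, h0⟩
    exact ⟨hx, fun hf0 => h0 (by simp [hf0])⟩

theorem FinFib.support_finite {k : G → ℂ} (hk : FinFib k) (f : G → ℂ) (g : G) :
    (Function.support fun h : {h : G // src h = src g} => f (g * (h : G)⁻¹) * k h).Finite := by
  refine Set.Finite.of_finite_image (f := Subtype.val) ?_ Subtype.val_injective.injOn
  refine (hk (src g)).subset ?_
  rintro _ ⟨h, hh, rfl⟩
  exact ⟨h.2, fun h0 => hh (by simp [h0])⟩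

theorem conv_add_left (f f' : G → ℂ) {k : G → ℂ} (hk : FinFib k) :
    conv (f + f') k = conv f k + conv f' k := by
  funext g
  simp only [conv, Pi.add_apply, add_mul]
  exact finsum_add_distrib (hk.support_finite f g) (hk.support_finite f' g)

theorem conv_add_right (f : G → ℂ) {k k' : G → ℂ} (hk : FinFib k) (hk' : FinFib k') :
    conv f (k + k') = conv f k + conv f k' := by
  funext g
  simp only [conv, Pi.add_apply, mul_add]
  exact finsum_add_distrib (hk.support_finite f g) (hk'.support_finite f g)

theorem conv_smul_left (c : ℂ) (f k : G → ℂ) : conv (c • f) k = c • conv f k := by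
  funext g
  simp only [conv, Pi.smul_apply, smul_eq_mul, mul_assoc, mul_finsum]

theorem conv_smul_right (c : ℂ) (f k : G → ℂ) : conv f (c • k) = c • conv f k := by
  funext g
  simp only [conv, Pi.smul_apply, smul_eq_mul, mul_left_comm _ c, mul_finsum]

theorem conv_zero_left (k : G → ℂ) : conv 0 k = 0 := by
  funext g
  simp [conv]

theorem conv_zero_right (f : G → ℂ) : conv f 0 = 0 := by
  funext g
  simp [conv]

theorem conv_mem {H : Set G} (hH : ∀ g ∈ H, ∀ h ∈ H, src g = rng h → g * h ∈ H) {f k : G → ℂ}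
    (hf : f ∈ ccSpan H) (hk : k ∈ ccSpan H) : conv f k ∈ ccSpan H := by
  have hkF := finFib_of_mem hk
  induction hf using Submodule.span_induction with
  | mem f hf =>
    obtain ⟨U, hU, hUH, hfU⟩ := hf
    induction hk using Submodule.span_induction with
    | mem k hk =>
      obtain ⟨V, hV, hVH, hkV⟩ := hk
      refine Submodule.subset_span ⟨setMul U V, hU.setMul hV, ?_, hfU.conv hU hkV⟩
      rintro _ ⟨u, hu, v, hv, e, rfl⟩
      exact hH u (hUH hu) v (hVH hv) e
    | zero => rw [conv_zero_right]; exact Submodule.zero_mem _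
    | add k k' hk hk' ih ih' =>
      rw [conv_add_right f (finFib_of_mem hk) (finFib_of_mem hk')]
      exact Submodule.add_mem _ (ih (finFib_of_mem hk)) (ih' (finFib_of_mem hk'))
    | smul c k hk ih =>
      rw [conv_smul_right]
      exact Submodule.smul_mem _ _ (ih (finFib_of_mem hk))
  | zero => rw [conv_zero_left]; exact Submodule.zero_mem _
  | add f f' _ _ ih ih' =>
    rw [conv_add_left _ _ hkF]
    exact Submodule.add_mem _ ih ih'
  | smul c f _ ih =>
    rw [conv_smul_left]
    exact Submodule.smul_mem _ _ ih

theorem involution_mem {H : Set G} (hH : ∀ g ∈ H, g⁻¹ ∈ H) {f : G → ℂ}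
    (hf : f ∈ ccSpan H) : involution f ∈ ccSpan H := by
  induction hf using Submodule.span_induction with
  | mem f hf =>
    obtain ⟨U, hU, hUH, hfU⟩ := hf
    refine Submodule.subset_span ⟨_, hU.inv, ?_, hfU.involution⟩
    intro g hg
    have := hH _ (hUH hg)
    rwa [inv_inv'] at this
  | zero =>
    have : involution (0 : G → ℂ) = 0 := by funext g; simp [involution]
    rw [this]; exact Submodule.zero_mem _
  | add f f' _ _ ih ih' =>
    have : involution (f + f') = involution f + involution f' := by
      funext g; simp [involution]
    rw [this]; exact Submodule.add_mem _ ih ih'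
  | smul c f _ ih =>
    have : involution (c • f) = star c • involution f := by
      funext g; simp [involution]
    rw [this]; exact Submodule.smul_mem _ _ ih

theorem involution_conv (f k : G → ℂ) :
    involution (conv f k) = conv (involution k) (involution f) := by
  funext g
  simp only [involution, conv]
  have e : ∀ h : {h : G // src h = src g⁻¹}, src (h : G) = rng g := fun h => by
    rw [h.2, src_inv]
  let E : {h : G // src h = src g⁻¹} ≃ {h : G // src h = src g} :=
    { toFun := fun h => ⟨h * g, src_mul _ _ (e h)⟩
      invFun := fun m => ⟨m * g⁻¹, by rw [src_mul _ _ (by rw [rng_inv, m.2])]⟩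
      left_inv := fun h => Subtype.ext (mul_mul_inv (e h))
      right_inv := fun m => Subtype.ext (mul_inv_mul' m.2) }
  rw [← finsum_comp_equiv E]
  have hst : star (∑ᶠ h : {h : G // src h = src g⁻¹}, f (g⁻¹ * (h : G)⁻¹) * k h) =
      ∑ᶠ h : {h : G // src h = src g⁻¹}, star (f (g⁻¹ * (h : G)⁻¹) * k h) := by
    exact (starAddEquiv (R := ℂ)).toAddMonoidHom.map_finsum_of_injective
      (starAddEquiv (R := ℂ)).injective _
  rw [hst]
  refine finsum_congr fun h => ?_
  have h1 : (g * (h * g)⁻¹)⁻¹ = (h : G) := by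
    rw [mul_inv_rev' (e h), mul_inv_mul (by rw [rng_inv, e h]), inv_inv']
  have h2 : ((h : G) * g)⁻¹ = g⁻¹ * (h : G)⁻¹ := mul_inv_rev' (e h)
  show star (f (g⁻¹ * (h : G)⁻¹) * k h) = star (k (g * (h * g)⁻¹)⁻¹) * star (f (h * g)⁻¹)
  rw [h1, h2, star_mul]

theorem conv_assoc (f : G → ℂ) {k l : G → ℂ} (hk : FinFib k) (hl : FinFib l) :
    conv (conv f k) l = conv f (conv k l) := by
  funext g
  let S := {h : G // src h = src g}
  -- the common double sum
  let F : S × S → ℂ := fun p => f (g * (p.1 : G)⁻¹) * (k (p.1 * (p.2 : G)⁻¹) * l p.2)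
  have hF : F.HasFiniteSupport := by
    have hfin : (⋃ h ∈ {h : G | src h = src g ∧ l h ≠ 0},
        (fun m : G => (m * h, h)) '' {m : G | src m = rng h ∧ k m ≠ 0}).Finite :=
      (hl (src g)).biUnion fun h _ => (hk (rng h)).image _
    refine Set.Finite.of_finite_image (f := fun p : S × S => ((p.1 : G), (p.2 : G)))
      (hfin.subset ?_) ?_
    · rintro _ ⟨⟨m, h⟩, hp, rfl⟩
      have hp' : f (g * (m : G)⁻¹) * (k (m * (h : G)⁻¹) * l h) ≠ 0 := hp
      have e : src (m : G) = src (h : G) := m.2.trans h.2.symm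
      have e' : src (m : G) = rng (h : G)⁻¹ := by rw [rng_inv, e]
      simp only [Set.mem_iUnion]
      refine ⟨h, ⟨h.2, fun h0 => hp' (by simp [h0])⟩, m * (h : G)⁻¹, ⟨?_, ?_⟩, ?_⟩
      · rw [src_mul _ _ e', src_inv]
      · exact fun h0 => hp' (by simp [h0])
      · exact Prod.ext (mul_inv_mul' e) rfl
    · rintro ⟨a, b⟩ - ⟨c, d⟩ - h
      simp only [Prod.mk.injEq] at h
      exact Prod.ext (Subtype.ext h.1) (Subtype.ext h.2)
  have hF' : (F ∘ Prod.swap).HasFiniteSupport := by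
    have : Function.support (F ∘ Prod.swap) = Prod.swap ⁻¹' Function.support F := rfl
    show (Function.support (F ∘ Prod.swap)).Finite
    rw [this]
    exact Set.Finite.preimage Prod.swap_injective.injOn hF
  have hL : conv (conv f k) l g = ∑ᶠ h : S, ∑ᶠ m : S, F (m, h) := by
    show (∑ᶠ h : S, conv f k (g * (h : G)⁻¹) * l h) = _
    refine finsum_congr fun h => ?_
    have e : src g = rng (h : G)⁻¹ := by rw [rng_inv, h.2]
    have e2 : src (g * (h : G)⁻¹) = rng (h : G) := by rw [src_mul _ _ e, src_inv]
    let E : {m : G // src m = src (g * (h : G)⁻¹)} ≃ S :=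
      { toFun := fun m => ⟨m * h, by rw [src_mul _ _ (m.2.trans e2), h.2]⟩
        invFun := fun m => ⟨m * (h : G)⁻¹, by
          rw [src_mul _ _ (by rw [rng_inv, m.2, h.2]), src_inv, e2]⟩
        left_inv := fun m => Subtype.ext (mul_mul_inv (m.2.trans e2))
        right_inv := fun m => Subtype.ext (mul_inv_mul' (m.2.trans h.2.symm)) }
    rw [← finsum_comp_equiv E, conv, finsum_mul]
    refine finsum_congr fun m => ?_
    have em : src (m : G) = rng (h : G) := m.2.trans e2
    show f (g * (h : G)⁻¹ * (m : G)⁻¹) * k m * l h =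
      f (g * (m * h : G)⁻¹) * (k (m * h * (h : G)⁻¹) * l h)
    rw [mul_mul_inv em, mul_inv_rev' em,
      mul_assoc' _ _ _ e (by rw [src_inv, rng_inv, em]), mul_assoc]
  have hR : conv f (conv k l) g = ∑ᶠ m : S, ∑ᶠ h : S, F (m, h) := by
    show (∑ᶠ m : S, f (g * (m : G)⁻¹) * conv k l m) = _
    refine finsum_congr fun m => ?_
    let E : {h : G // src h = src (m : G)} ≃ S := Equiv.subtypeEquivRight fun h => by rw [m.2]
    rw [← finsum_comp_equiv E, conv, mul_finsum]
    rfl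
  rw [hL, hR, ← finsum_curry F hF]
  rw [← finsum_comp_equiv (Equiv.prodComm S S) (f := F)]
  exact (finsum_curry (F ∘ Prod.swap) hF').symm

end Basic

end EtaleGroupoid

end EtaleGroupoidSection

noncomputable section ConvolutionAlgebraSection

namespace EtaleGroupoid

section Algebra

variable (G : Type*) [TopologicalSpace G] [EtaleGroupoid G]

/-- The space `𝒞_c(G)`: the span of all `C_c(U)`, `U` an open bisection of `G`, made into a
*-algebra with the convolution product and the involution. -/
abbrev Cc : Type _ := ↥(ccSpan (Set.univ : Set G))

instance : Mul (Cc G) := ⟨fun f k => ⟨conv f.1 k.1, conv_mem (by simp) f.2 k.2⟩⟩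

instance : Star (Cc G) := ⟨fun f => ⟨involution f.1, involution_mem (by simp) f.2⟩⟩

instance : NonUnitalRing (Cc G) where
  left_distrib _ k l := Subtype.ext (conv_add_right _ (finFib_of_mem k.2) (finFib_of_mem l.2))
  right_distrib _ _ l := Subtype.ext (conv_add_left _ _ (finFib_of_mem l.2))
  zero_mul _ := Subtype.ext (conv_zero_left _)
  mul_zero _ := Subtype.ext (conv_zero_right _)
  mul_assoc _ k l := Subtype.ext (conv_assoc _ (finFib_of_mem k.2) (finFib_of_mem l.2))

instance : StarRing (Cc G) where
  star_involutive f := by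
    refine Subtype.ext (funext fun g => ?_)
    show star (star (f.1 g⁻¹⁻¹)) = f.1 g
    rw [inv_inv', star_star]
  star_mul f k := Subtype.ext (involution_conv _ _)
  star_add f k := Subtype.ext (funext fun g => star_add (f.1 g⁻¹) (k.1 g⁻¹))

instance : IsScalarTower ℂ (Cc G) (Cc G) :=
  ⟨fun c f k => Subtype.ext (conv_smul_left c f.1 k.1)⟩

instance : SMulCommClass ℂ (Cc G) (Cc G) :=
  ⟨fun c f k => Subtype.ext (conv_smul_right c f.1 k.1).symm⟩

instance : StarModule ℂ (Cc G) :=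
  ⟨fun c f => Subtype.ext (funext fun g => star_smul c (f.1 g⁻¹))⟩

variable {G}

/-- For an open subgroupoid `H`, the algebra `𝒞_c(H)` inside `𝒞_c(G)` (functions on `H` being
extended by zero): the span of the `C_c(U)` for the open bisections `U` of `H`. -/
def ccSub (H : Set G) (hH : IsOpenSubgroupoid H) : NonUnitalStarSubalgebra ℂ (Cc G) where
  carrier := {f | f.1 ∈ ccSpan H}
  add_mem' := fun {f k} hf hk => (ccSpan H).add_mem (x := f.1) (y := k.1) hf hk
  zero_mem' := (ccSpan H).zero_mem
  mul_mem' := fun {f k} hf hk => conv_mem (f := f.1) (k := k.1) hH.mul_mem hf hk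
  smul_mem' := fun c f hf => (ccSpan H).smul_mem (x := f.1) c hf
  star_mem' := fun {f} hf => involution_mem (f := f.1) hH.inv_mem hf

end Algebra

section LocallyInvariant

variable {G : Type*} [TopologicalSpace G] [EtaleGroupoid G]

/-- `X` is locally invariant: every arrow with range and source in `X` has an open neighbourhood
all of whose elements have source in `X` if and only if they have range in `X`. -/
def IsLocallyInvariant (X : Set (UnitSpace G)) : Prop :=
  ∀ g : G, rngU g ∈ X → srcU g ∈ X →
    ∃ U : Set G, IsOpen U ∧ g ∈ U ∧ ∀ g' ∈ U, srcU g' ∈ X ↔ rngU g' ∈ X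

variable (G) in
/-- The closed locally invariant subsets of the unit space. -/
structure ClosedLocInv where
  carrier : Set (UnitSpace G)
  isClosed : IsClosed carrier
  locInv : IsLocallyInvariant carrier

/-- The reduction `G|_X`, as a set of arrows of `G`. -/
def reductionSet (X : Set (UnitSpace G)) : Set G := {g | rngU g ∈ X ∧ srcU g ∈ X}

/-- The reduction `G|_X`, as a groupoid in its own right. -/
def Reduction (X : ClosedLocInv G) : Type _ := ↥(reductionSet X.carrier)

variable (X : ClosedLocInv G)

instance : TopologicalSpace (Reduction X) :=
  inferInstanceAs (TopologicalSpace ↥(reductionSet X.carrier))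

namespace Reduction

variable {X}

/-- The inclusion of `G|_X` in `G`. -/
def val (g : Reduction X) : G := Subtype.val g

theorem ext' {g h : Reduction X} (e : g.val = h.val) : g = h := Subtype.ext e

theorem isEmbedding_val : IsEmbedding (val : Reduction X → G) := IsEmbedding.subtypeVal

theorem isClosed_reductionSet : IsClosed (reductionSet X.carrier) :=
  (X.isClosed.preimage continuous_rngU).inter (X.isClosed.preimage continuous_srcU)

theorem isClosedEmbedding_val : IsClosedEmbedding (val : Reduction X → G) :=
  isClosed_reductionSet.isClosedEmbedding_subtypeVal

theorem rngU_mem (g : Reduction X) : rngU g.val ∈ X.carrier := g.2.1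

theorem srcU_mem (g : Reduction X) : srcU g.val ∈ X.carrier := g.2.2

/-- Constructor. -/
def mk (g : G) (h1 : rngU g ∈ X.carrier) (h2 : srcU g ∈ X.carrier) : Reduction X := ⟨g, h1, h2⟩

theorem val_mk (g : G) (h1 : rngU g ∈ X.carrier) (h2 : srcU g ∈ X.carrier) :
    (mk g h1 h2 : Reduction X).val = g := rfl

theorem rngU_rng (g : G) : rngU (rng g) = rngU g := Subtype.ext (rng_rng g)
theorem srcU_rng (g : G) : srcU (rng g) = rngU g := Subtype.ext (src_rng g)
theorem rngU_src (g : G) : rngU (src g) = srcU g := Subtype.ext (rng_src g)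
theorem srcU_src (g : G) : srcU (src g) = srcU g := Subtype.ext (src_src g)
theorem rngU_inv (g : G) : rngU g⁻¹ = srcU g := Subtype.ext (rng_inv g)
theorem srcU_inv (g : G) : srcU g⁻¹ = rngU g := Subtype.ext (src_inv g)

/-- Source in `G|_X`. -/
def src' (g : Reduction X) : Reduction X :=
  mk (src g.val) (by rw [rngU_src]; exact g.srcU_mem) (by rw [srcU_src]; exact g.srcU_mem)

/-- Range in `G|_X`. -/
def rng' (g : Reduction X) : Reduction X :=
  mk (rng g.val) (by rw [rngU_rng]; exact g.rngU_mem) (by rw [srcU_rng]; exact g.rngU_mem)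

/-- Inverse in `G|_X`. -/
def inv' (g : Reduction X) : Reduction X :=
  mk g.val⁻¹ (by rw [rngU_inv]; exact g.srcU_mem) (by rw [srcU_inv]; exact g.rngU_mem)

open Classical in
/-- Product in `G|_X` (with an arbitrary value on pairs that are not composable). -/
def mul' (g h : Reduction X) : Reduction X :=
  if e : src g.val = rng h.val then
    mk (g.val * h.val)
      (by rw [show rngU (g.val * h.val) = rngU g.val from Subtype.ext (rng_mul _ _ e)]
          exact g.rngU_mem)
      (by rw [show srcU (g.val * h.val) = srcU h.val from Subtype.ext (src_mul _ _ e)]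
          exact h.srcU_mem)
  else g

theorem val_mul' {g h : Reduction X} (e : src g.val = rng h.val) :
    (mul' g h).val = g.val * h.val := by
  rw [mul', dif_pos e]
  rfl

theorem val_src' (g : Reduction X) : (src' g).val = src g.val := rfl
theorem val_rng' (g : Reduction X) : (rng' g).val = rng g.val := rfl
theorem val_inv' (g : Reduction X) : (inv' g).val = g.val⁻¹ := rfl

theorem rng'_rng' (g : Reduction X) : rng' (rng' g) = rng' g := ext' (rng_rng g.val)

theorem val_eq_of_eq {g h : Reduction X} (e : g = h) : g.val = h.val := congrArg _ e

/-- The inclusion of the unit space of `G|_X` in the unit space of `G`. -/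
def unitIncl (x : {x : Reduction X // rng' x = x}) : UnitSpace G :=
  ⟨x.1.val, val_eq_of_eq x.2⟩

theorem unitIncl_mem (x : {x : Reduction X // rng' x = x}) : unitIncl x ∈ X.carrier := by
  have h := x.1.rngU_mem
  have h2 : rngU x.1.val = unitIncl x := Subtype.ext (val_eq_of_eq x.2)
  rwa [h2] at h

theorem isClosedEmbedding_unitIncl :
    IsClosedEmbedding (unitIncl : {x : Reduction X // rng' x = x} → UnitSpace G) := by
  have hemb : IsEmbedding (unitIncl : {x : Reduction X // rng' x = x} → UnitSpace G) := by
    have h : IsEmbedding ((Subtype.val : UnitSpace G → G) ∘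
        (unitIncl : {x : Reduction X // rng' x = x} → UnitSpace G)) :=
      (isEmbedding_val (X := X)).comp IsEmbedding.subtypeVal
    refine IsEmbedding.of_comp ?_ continuous_subtype_val h
    exact (isEmbedding_val.continuous.comp continuous_subtype_val).subtype_mk _
  refine ⟨hemb, ?_⟩
  have hr : Set.range (unitIncl : {x : Reduction X // rng' x = x} → UnitSpace G) = X.carrier := by
    ext y
    constructor
    · rintro ⟨x, rfl⟩
      exact unitIncl_mem x
    · intro hy
      have h1 : rngU y.1 = y := Subtype.ext y.2
      have h2 : srcU y.1 = y := Subtype.ext (src_eq_of_unit y.2)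
      exact ⟨⟨mk y.1 (by rwa [h1]) (by rwa [h2]), ext' y.2⟩, rfl⟩
  rw [hr]
  exact X.isClosed

theorem continuous_rng'U :
    Continuous fun g : Reduction X => (⟨rng' g, rng'_rng' g⟩ : {x : Reduction X // rng' x = x}) := by
  refine Continuous.subtype_mk ?_ _
  exact Continuous.subtype_mk (continuous_rng.comp isEmbedding_val.continuous) _

theorem isOpenMap_rng'U :
    IsOpenMap fun g : Reduction X => (⟨rng' g, rng'_rng' g⟩ : {x : Reduction X // rng' x = x}) := by
  intro W hW
  obtain ⟨O, hO, rfl⟩ := isEmbedding_val.isInducing.isOpen_iff.1 hW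
  rw [isOpen_iff_mem_nhds]
  rintro _ ⟨g, hg, rfl⟩
  obtain ⟨U, hU, hgU, hinv⟩ := X.locInv g.val g.rngU_mem g.srcU_mem
  have hop : IsOpen (unitIncl (X := X) ⁻¹' (rngU '' (O ∩ U))) :=
    (isLocalHomeomorph_rngU.isOpenMap _ (hO.inter hU)).preimage
      isClosedEmbedding_unitIncl.continuous
  refine Filter.mem_of_superset (hop.mem_nhds ⟨g.val, ⟨hg, hgU⟩, rfl⟩) ?_
  rintro z ⟨k, ⟨hkO, hkU⟩, hk⟩
  have hkX : rngU k ∈ X.carrier := by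
    rw [hk]
    exact unitIncl_mem z
  refine ⟨mk k hkX ((hinv k hkU).2 hkX), hkO, ?_⟩
  have hk' : rng k = z.1.val := congrArg Subtype.val hk
  exact Subtype.ext (ext' hk')

theorem isLocalHomeomorph_rng'U : IsLocalHomeomorph
    fun g : Reduction X => (⟨rng' g, rng'_rng' g⟩ : {x : Reduction X // rng' x = x}) := by
  rw [isLocalHomeomorph_iff_isOpenEmbedding_restrict]
  intro g
  obtain ⟨V, hV, hinj⟩ : ∃ V : Set G, V ∈ 𝓝 g.val ∧ Set.InjOn (rngU : G → UnitSpace G) V := by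
    obtain ⟨V, hV, hemb⟩ := isLocalHomeomorph_iff_isOpenEmbedding_restrict.1
      (isLocalHomeomorph_rngU (G := G)) g.val
    exact ⟨V, hV, Set.injOn_iff_injective.2 hemb.injective⟩
  obtain ⟨V', hV'V, hV'o, hgV'⟩ := mem_nhds_iff.1 hV
  have ho : IsOpen ((val : Reduction X → G) ⁻¹' V') := hV'o.preimage isEmbedding_val.continuous
  refine ⟨_, ho.mem_nhds hgV', ?_⟩
  refine IsOpenEmbedding.of_continuous_injective_isOpenMap
    (continuous_rng'U.comp continuous_subtype_val) ?_ (isOpenMap_rng'U.domRestrict ho)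
  rintro ⟨a, ha⟩ ⟨b, hb⟩ hab
  have h1 : rng' a = rng' b := congrArg Subtype.val hab
  refine Subtype.ext (ext' (hinj (hV'V ha) (hV'V hb) ?_))
  exact Subtype.ext (val_eq_of_eq h1)

end Reduction

open Reduction in
/-- The reduction of an étale groupoid to a closed locally invariant set is an étale groupoid. -/
instance : EtaleGroupoid (Reduction X) where
  mul := mul'
  inv := inv'
  src := src'
  rng := rng'
  rng_rng := rng'_rng'
  src_rng g := ext' (src_rng g.val)
  rng_src g := ext' (rng_src g.val)
  src_src g := ext' (src_src g.val)
  src_mul g h e := by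
    have e' : src g.val = rng h.val := val_eq_of_eq e
    refine ext' ?_
    show src (mul' g h).val = src h.val
    rw [val_mul' e', src_mul _ _ e']
  rng_mul g h e := by
    have e' : src g.val = rng h.val := val_eq_of_eq e
    refine ext' ?_
    show rng (mul' g h).val = rng g.val
    rw [val_mul' e', rng_mul _ _ e']
  mul_assoc' g h k e1 e2 := by
    have e1' : src g.val = rng h.val := val_eq_of_eq e1
    have e2' : src h.val = rng k.val := val_eq_of_eq e2
    have a1 : src (mul' g h).val = rng k.val := by rw [val_mul' e1', src_mul _ _ e1', e2']
    have a2 : src g.val = rng (mul' h k).val := by rw [val_mul' e2', rng_mul _ _ e2', e1']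
    refine ext' ?_
    show (mul' (mul' g h) k).val = (mul' g (mul' h k)).val
    rw [val_mul' a1, val_mul' a2, val_mul' e1', val_mul' e2', mul_assoc' _ _ _ e1' e2']
  rng_mul_self g := by
    refine ext' ?_
    show (mul' (rng' g) g).val = g.val
    rw [val_mul' (src_rng g.val)]
    exact rng_mul_self g.val
  mul_src_self g := by
    refine ext' ?_
    show (mul' g (src' g)).val = g.val
    rw [val_mul' (rng_src g.val).symm]
    exact mul_src_self g.val
  src_inv g := ext' (src_inv g.val)
  rng_inv g := ext' (rng_inv g.val)
  inv_mul_self g := by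
    refine ext' ?_
    show (mul' (inv' g) g).val = src g.val
    rw [val_mul' (src_inv g.val)]
    exact inv_mul_self g.val
  mul_inv_self g := by
    refine ext' ?_
    show (mul' g (inv' g)).val = rng g.val
    rw [val_mul' (rng_inv g.val).symm]
    exact mul_inv_self g.val
  continuous_inv' := Continuous.subtype_mk (continuous_inv'.comp isEmbedding_val.continuous) _
  continuousOn_mul := by
    rw [isEmbedding_val.continuousOn_iff]
    have h : ContinuousOn (fun p : Reduction X × Reduction X => p.1.val * p.2.val)
        {p | src p.1.val = rng p.2.val} :=
      continuousOn_mul.comp (f := fun p : Reduction X × Reduction X => (p.1.val, p.2.val))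
        ((isEmbedding_val.continuous.comp continuous_fst).prodMk
          (isEmbedding_val.continuous.comp continuous_snd)).continuousOn fun p hp => hp
    refine (h.congr fun p hp => val_mul' hp).mono ?_
    intro p hp
    exact val_eq_of_eq hp
  t2_units := T2Space.of_injective_continuous isClosedEmbedding_unitIncl.injective
    isClosedEmbedding_unitIncl.continuous
  locallyCompact_units := isClosedEmbedding_unitIncl.locallyCompactSpace
  isLocalHomeomorph_rng := isLocalHomeomorph_rng'U

namespace Reduction

theorem memCc_comp_val {U : Set G} {f : G → ℂ} (hf : MemCc U f) :
    MemCc ((val : Reduction X → G) ⁻¹' U) (f ∘ val) := by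
  obtain ⟨hc, K, hK, hKU, hz⟩ := hf
  exact ⟨hc.comp isEmbedding_val.continuous.continuousOn fun g hg => hg,
    _, isClosedEmbedding_val.isCompact_preimage hK, fun g hg => hKU hg, fun g hg => hz _ hg⟩

theorem isOpenBisection_preimage {U : Set G} (hU : IsOpenBisection U) :
    IsOpenBisection ((val : Reduction X → G) ⁻¹' U) where
  isOpen := hU.isOpen.preimage isEmbedding_val.continuous
  injOn_rng _ hg _ hh e := ext' (hU.injOn_rng hg hh (val_eq_of_eq e))
  injOn_src _ hg _ hh e := ext' (hU.injOn_src hg hh (val_eq_of_eq e))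

theorem comp_val_mem {f : G → ℂ} (hf : f ∈ ccSpan (Set.univ : Set G)) :
    (f ∘ val : Reduction X → ℂ) ∈ ccSpan (Set.univ : Set (Reduction X)) := by
  induction hf using Submodule.span_induction with
  | mem f hf =>
    obtain ⟨U, hU, -, hfU⟩ := hf
    exact Submodule.subset_span
      ⟨_, isOpenBisection_preimage X hU, Set.subset_univ _, memCc_comp_val X hfU⟩
  | zero => exact Submodule.zero_mem _
  | add f k _ _ hf hk => exact Submodule.add_mem _ hf hk
  | smul c f _ hf => exact Submodule.smul_mem _ c hf

end Reduction

/-- The restriction map `r_X : 𝒞_c(G) → 𝒞_c(G|_X)`. -/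
def restrict : Cc G →ₗ[ℂ] Cc (Reduction X) where
  toFun f := ⟨f.1 ∘ Reduction.val, Reduction.comp_val_mem X f.2⟩
  map_add' _ _ := rfl
  map_smul' _ _ := rfl

/-- `H` is a local groupoid about `G|_X`: an open subgroupoid of `G` with `H|_X = G|_X` for which
`X` is invariant (the last two conditions being `reduction_subset` and `invariant`). -/
structure IsLocalGroupoid (H : Set G) : Prop extends IsOpenSubgroupoid H where
  reduction_subset : reductionSet X.carrier ⊆ H
  invariant : ∀ h ∈ H, srcU h ∈ X.carrier ↔ rngU h ∈ X.carrier

/-- The elements of `C_c(G⁰ ∖ X)`, as elements of `𝒞_c(G)`. -/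
def ccOff : Set (Cc G) := {f | MemCc {x : G | x ∈ units G ∧ rngU x ∉ X.carrier} f.1}

/-- A net `u` is an approximate unit for the *-algebra `C_c(G⁰ ∖ X)` of functions with the
supremum norm: `u i` belongs to `C_c(G⁰ ∖ X)`, `0 ≤ u i ≤ 1`, and `u i * f → f` uniformly for
every `f` in `C_c(G⁰ ∖ X)`. -/
structure IsApproxUnitOff {I : Type*} [Preorder I] (u : I → Cc G) : Prop where
  mem : ∀ i, u i ∈ ccOff X
  nonneg_le_one : ∀ i, ∀ x : UnitSpace G, ∃ t : ℝ, 0 ≤ t ∧ t ≤ 1 ∧ (u i).1 x = t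
  tendsto : ∀ f ∈ ccOff X, ∀ ε : ℝ, 0 < ε →
    ∀ᶠ i in atTop, ∀ x : UnitSpace G, ‖(u i).1 x * f.1 x - f.1 x‖ ≤ ε

end LocallyInvariant

end EtaleGroupoid

end ConvolutionAlgebraSection

open EtaleGroupoid

/-! Let `w` be a function in `C_c(G⁰ ∖ X)` with values in `[0, 1]`, and regard `1 - w` as a
multiplier of `𝒞_c(G)`. As `w` vanishes on `X`, multiplying `a` by `1 - w` on either side does not
change `r_X(a)`. It does not increase `ρ(a)` either, because `a⋆a - ((1-w)a)⋆((1-w)a) = a⋆(2w -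
w²)a` and `2w - w²` has a square root in `C_c(G⁰)`. The proof lets `w` grow to `1` off `X`.

Compression. Let `H` be a local groupoid. The part of a compact support lying outside `H` is compact
and misses `G|_X`, so each of its arrows has its range or its source off `X`. If `w` is `1` on a
large enough compact set off `X`, then `(1-w)a(1-w)` lies in `𝒞_c(H)`
(`exists_compact_cut_mem_ccSpan`). With `φ = 1 - w` this is compressibility. It also shows that each
`a` can be replaced by an element of `𝒞_c(H)` with the same restriction and no larger norm, so the
quotient norm is the same for all `H` and for `G`. On `𝒞_c(H)` restriction is multiplicative, since
`X` is `H`-invariant, and it is onto by Tietze extension and a partition of unity on the unit space.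

Kernel. The delicate point is that the `w` act asymptotically as units on the kernel of `r_X` on
`𝒞_c(H)`. As `G` need not be Hausdorff, `f = ∑ f_i` may vanish on `G|_X` by cancellation between
bisections, without any `f_i` vanishing there. `exists_mem_ccSpan_diff_seminorm_le` removes the
bisections one at a time: where the last summand is large on `G|_X`, another bisection must be
present to cancel it, so its large part can be moved into the other bisections or off `G|_X`. What
remains is uniformly small, hence small for `ρ`, as every C*-seminorm is at most the supremum norm
on a bisection (`seminorm_le_of_onBis`). So `f` is a limit of elements of `𝒞_c(H ∖ G|_X)`; by
invariance these have ranges and sources in a compact set off `X`, and some `w` is an exact unit for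
each of them.

The C*-identity for the quotient norm (`restrictNorm_sq_le`) and the approximate units follow. For
the completions, `r_X` extends by continuity. A lifting with norm control
(`IsLocalGroupoid.exists_mem_ccClosure_norm_le`) corrects the error made when an element of the
completion is approximated by one of `𝒞_c(G)`, and the infimum defining the quotient norm makes the
algebraic kernel dense in the kernel of the extension. -/

/-! ### Compactly supported functions on a locally compact Hausdorff space -/

section CompactSupport

variable {E : Type*} [TopologicalSpace E]

/-- Continuous functions vanishing off a compact subset of `O`. -/
def CcOn (O : Set E) (φ : E → ℂ) : Prop :=
  Continuous φ ∧ ∃ K : Set E, IsCompact K ∧ K ⊆ O ∧ ∀ x, x ∉ K → φ x = 0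

namespace CcOn

variable {O O' : Set E} {φ ψ : E → ℂ}

theorem mono (h : CcOn O φ) (hO : O ⊆ O') : CcOn O' φ := by
  obtain ⟨hc, K, hK, hKO, hz⟩ := h
  exact ⟨hc, K, hK, hKO.trans hO, hz⟩

theorem eq_zero (h : CcOn O φ) {x : E} (hx : x ∉ O) : φ x = 0 := by
  obtain ⟨-, K, -, hKO, hz⟩ := h
  exact hz x fun hK => hx (hKO hK)

theorem add (h : CcOn O φ) (h' : CcOn O ψ) : CcOn O (φ + ψ) := by
  obtain ⟨hc, K, hK, hKO, hz⟩ := h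
  obtain ⟨hc', K', hK', hKO', hz'⟩ := h'
  refine ⟨hc.add hc', K ∪ K', hK.union hK', Set.union_subset hKO hKO', fun x hx => ?_⟩
  rw [Set.mem_union, not_or] at hx
  simp [hz x hx.1, hz' x hx.2]

/-- A continuous function vanishing where `φ` does inherits compact support from `φ`. -/
theorem of_zero (h : CcOn O φ) (hψ : Continuous ψ) (h0 : ∀ x, φ x = 0 → ψ x = 0) :
    CcOn O ψ := by
  obtain ⟨-, K, hK, hKO, hz⟩ := h
  exact ⟨hψ, K, hK, hKO, fun x hx => h0 x (hz x hx)⟩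

theorem mul_inter (h : CcOn O φ) (h' : CcOn O' ψ) [T2Space E] :
    CcOn (O ∩ O') (fun x => φ x * ψ x) := by
  obtain ⟨hc, K, hK, hKO, hz⟩ := h
  obtain ⟨hc', K', hK', hKO', hz'⟩ := h'
  refine ⟨hc.mul hc', K ∩ K', hK.inter hK', Set.inter_subset_inter hKO hKO', fun x hx => ?_⟩
  by_cases h : x ∈ K
  · simp [hz' x fun h' => hx ⟨h, h'⟩]
  · simp [hz x h]

theorem of_hasCompactSupport {f : E → ℝ} (hf : Continuous f) (hs : HasCompactSupport f)
    (hO : tsupport f ⊆ O) : CcOn O (fun x => (f x : ℂ)) :=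
  ⟨Complex.continuous_ofReal.comp hf, tsupport f, hs, hO, fun x hx => by
    simp [image_eq_zero_of_notMem_tsupport hx]⟩

end CcOn

variable [T2Space E] [LocallyCompactSpace E]

theorem exists_ccOn_one {K O : Set E} (hK : IsCompact K) (hO : IsOpen O) (hKO : K ⊆ O) :
    ∃ w : E → ℝ, (∀ x, 0 ≤ w x ∧ w x ≤ 1) ∧ CcOn O (fun x => (w x : ℂ)) ∧ ∀ x ∈ K, w x = 1 := by
  obtain ⟨f, hf1, hf2, hf3, hf4⟩ := exists_continuousMap_one_of_isCompact_subset_isOpen hK hO hKO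
  exact ⟨f, fun x => hf4 x, .of_hasCompactSupport f.continuous hf2 hf3, fun x hx => hf1 hx⟩

/-- Partition of unity over an arbitrary finite index type; it is later used for a finite subcover
and for `Option (Fin n)`. -/
theorem exists_ccOn_sum_one {ι : Type*} [Fintype ι] {K : Set E} {O : ι → Set E}
    (hK : IsCompact K) (hO : ∀ i, IsOpen (O i)) (hKO : K ⊆ ⋃ i, O i) :
    ∃ χ : ι → E → ℂ, (∀ i, CcOn (O i) (χ i)) ∧ ∀ x ∈ K, ∑ i, χ i x = 1 := by
  let e := Fintype.equivFin ι
  obtain ⟨f, hf1, hf2, -, hf4⟩ := exists_continuous_sum_one_of_isOpen_isCompact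
    (s := fun j => O (e.symm j)) (fun j => hO _) hK (by rwa [e.symm.surjective.iUnion_comp])
  refine ⟨fun i x => (f (e i) x : ℂ), fun i => .of_hasCompactSupport (f _).continuous (hf4 _)
    (by simpa using hf1 (e i)), fun x hx => ?_⟩
  have := hf2 hx
  simp only [Finset.sum_apply, Pi.one_apply] at this
  change ∑ i, (f (e i) x : ℂ) = 1
  rw [e.sum_comp (fun j => (f j x : ℂ))]
  exact_mod_cast this

/-- A compactly supported continuous function on a closed set extends to a compactly supported
continuous function. -/
theorem exists_ccOn_extension {X : Set E} (hX : IsClosed X) {φ : X → ℂ} (hφ : Continuous φ)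
    {K : Set E} (hK : IsCompact K) (hz : ∀ x : X, (x : E) ∉ K → φ x = 0) :
    ∃ Φ : E → ℂ, CcOn Set.univ Φ ∧ ∀ x : X, Φ x = φ x := by
  -- The space itself need not be normal, so Tietze is applied inside a compact neighbourhood `M` of
  -- `K`. The extension is then multiplied by a cutoff that is `1` on `K` and supported in the
  -- interior of `M`, so that extending it by zero is continuous.
  obtain ⟨M, hM, hKM⟩ := exists_compact_superset hK
  have : CompactSpace M := isCompact_iff_compactSpace.1 hM
  have hXM : IsClosed ((Subtype.val : M → E) ⁻¹' X) := hX.preimage continuous_subtype_val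
  obtain ⟨F, hF⟩ := ContinuousMap.exists_restrict_eq (Y := ℂ) hXM
    ⟨fun y => φ ⟨y.1.1, y.2⟩, hφ.comp (by fun_prop)⟩
  obtain ⟨w, -, ⟨hwc, L, hL, hLM, hLz⟩, hw1⟩ := exists_ccOn_one hK isOpen_interior hKM
  classical
  refine ⟨fun x => if h : x ∈ M then F ⟨x, h⟩ * w x else 0, ⟨?_, L, hL, L.subset_univ, ?_⟩, ?_⟩
  · rw [continuous_iff_continuousAt]
    intro x
    by_cases hx : x ∈ interior M
    · have hxM : M ∈ 𝓝 x := mem_interior_iff_mem_nhds.1 hx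
      refine (ContinuousOn.continuousAt (s := M) ?_ hxM)
      rw [continuousOn_iff_continuous_domRestrict]
      have : (M.domRestrict fun x => if h : x ∈ M then F ⟨x, h⟩ * (w x : ℂ) else 0) =
          fun y : M => F y * (w y : ℂ) := by
        funext y
        simp
      rw [this]
      exact F.continuous.mul (hwc.comp continuous_subtype_val)
    · have hxL : Lᶜ ∈ 𝓝 x := hL.isClosed.isOpen_compl.mem_nhds fun h => hx (hLM h)
      refine (continuousAt_const (y := (0 : ℂ))).congr ?_
      filter_upwards [hxL] with y hy
      simp [hLz y hy]
  · intro x hx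
    simp [hLz x hx]
  · intro x
    by_cases hx : (x : E) ∈ K
    · have hxM : (x : E) ∈ M := interior_subset (hKM hx)
      have := DFunLike.congr_fun hF ⟨⟨x, hxM⟩, x.2⟩
      simp only [hxM, dif_pos, hw1 _ hx, Complex.ofReal_one, mul_one]
      exact this
    · rw [hz x hx]
      by_cases hxM : (x : E) ∈ M
      · have := DFunLike.congr_fun hF ⟨⟨x, hxM⟩, x.2⟩
        have h2 : F ⟨x, hxM⟩ = φ x := this
        simp [hxM, h2, hz x hx]
      · simp [hxM]

theorem exists_ccOn_extension_of_isClosedEmbedding {F : Type*} [TopologicalSpace F] {e : F → E}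
    (he : IsClosedEmbedding e) {φ : F → ℂ} (hφ : CcOn Set.univ φ) :
    ∃ Φ : E → ℂ, CcOn Set.univ Φ ∧ ∀ x, Φ (e x) = φ x := by
  obtain ⟨hc, K, hK, -, hz⟩ := hφ
  let h := he.isEmbedding.toHomeomorph
  obtain ⟨Φ, hΦ, hΦφ⟩ := exists_ccOn_extension he.isClosed_range (φ := φ ∘ h.symm)
    (hc.comp h.symm.continuous) (hK.image he.continuous) fun x hx => hz _ fun hx' => hx
      ⟨_, hx', congrArg Subtype.val (h.apply_symm_apply x)⟩
  refine ⟨Φ, hΦ, fun x => ?_⟩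
  have := hΦφ (h x)
  rwa [Function.comp_apply, h.symm_apply_apply] at this

end CompactSupport

/-! ### Soft thresholding of complex numbers -/

section Threshold

/-- Shrinks `z` towards `0` by `min δ ‖z‖`. -/
noncomputable def softThreshold (δ : ℝ) (z : ℂ) : ℂ := z - ((δ / max δ ‖z‖ : ℝ) : ℂ) * z

theorem continuous_softThreshold {δ : ℝ} (hδ : 0 < δ) : Continuous (softThreshold δ) := by
  have : ∀ z : ℂ, max δ ‖z‖ ≠ 0 := fun z => (lt_max_of_lt_left hδ).ne'
  unfold softThreshold
  exact continuous_id.sub ((Complex.continuous_ofReal.comp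
    (continuous_const.div (by fun_prop) this)).mul continuous_id)

theorem softThreshold_eq_zero {δ : ℝ} (hδ : 0 < δ) {z : ℂ} (hz : ‖z‖ ≤ δ) :
    softThreshold δ z = 0 := by
  simp [softThreshold, max_eq_left hz, hδ.ne']

theorem norm_sub_softThreshold_le {δ : ℝ} (hδ : 0 < δ) (z : ℂ) :
    ‖z - softThreshold δ z‖ ≤ δ := by
  have h0 : 0 < max δ ‖z‖ := lt_max_of_lt_left hδ
  have : z - softThreshold δ z = ((δ / max δ ‖z‖ : ℝ) : ℂ) * z := by simp [softThreshold]
  rw [this, norm_mul, Complex.norm_real, Real.norm_of_nonneg (by positivity), div_mul_eq_mul_div,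
    div_le_iff₀ h0]
  exact mul_le_mul_of_nonneg_left (le_max_right _ _) hδ.le

end Threshold

noncomputable section BisectionFunctions

namespace EtaleGroupoid

variable {G : Type*} [TopologicalSpace G] [EtaleGroupoid G]

/-! ### Open bisections -/

theorem IsOpenBisection.mono {U V : Set G} (hU : IsOpenBisection U) (hV : IsOpen V)
    (hVU : V ⊆ U) : IsOpenBisection V :=
  ⟨hV, hU.injOn_rng.mono hVU, hU.injOn_src.mono hVU⟩

theorem exists_isOpen_injOn_rng (g : G) : ∃ U : Set G, IsOpen U ∧ g ∈ U ∧ Set.InjOn rng U := by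
  obtain ⟨V, hV, hemb⟩ := isLocalHomeomorph_iff_isOpenEmbedding_restrict.1
    (isLocalHomeomorph_rngU (G := G)) g
  obtain ⟨U, hUV, hU, hg⟩ := mem_nhds_iff.1 hV
  have hinj : Set.InjOn (rngU : G → UnitSpace G) V := Set.injOn_iff_injective.2 hemb.injective
  exact ⟨U, hU, hg, fun a ha b hb e => hinj (hUV ha) (hUV hb) (Subtype.ext e)⟩

/-- The source of an arrow is the range of its inverse, so local injectivity of the range at `g` and
at `g⁻¹` suffices. -/
theorem exists_isOpenBisection {g : G} {O : Set G} (hO : IsOpen O) (hg : g ∈ O) :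
    ∃ U : Set G, IsOpenBisection U ∧ g ∈ U ∧ U ⊆ O := by
  obtain ⟨U, hU, hgU, hiU⟩ := exists_isOpen_injOn_rng g
  obtain ⟨V, hV, hgV, hiV⟩ := exists_isOpen_injOn_rng g⁻¹
  refine ⟨U ∩ (fun g => g⁻¹) ⁻¹' V ∩ O, ⟨(hU.inter (hV.preimage continuous_inv')).inter hO,
    hiU.mono fun x hx => hx.1.1, fun a ha b hb e => ?_⟩, ⟨⟨hgU, hgV⟩, hg⟩, fun x hx => hx.2⟩
  have : a⁻¹ = b⁻¹ := hiV ha.1.2 hb.1.2 (by rw [rng_inv, rng_inv, e])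
  rw [← inv_inv' a, this, inv_inv']

/-- Near a unit, both `g` and `rng g` lie in one set on which the range is injective, and they have
the same range; so they coincide. -/
theorem isOpen_units : IsOpen (units G) := by
  rw [isOpen_iff_mem_nhds]
  intro x hx
  have hx' : rng x = x := hx
  obtain ⟨U, hU, hxU, hi⟩ := exists_isOpen_injOn_rng x
  have h2 : rng ⁻¹' U ∈ 𝓝 x := (hU.preimage continuous_rng).mem_nhds (by rwa [Set.mem_preimage, hx'])
  filter_upwards [hU.mem_nhds hxU, h2] with g hg hg2
  exact hi hg2 hg (rng_rng g)

theorem isOpenBisection_units : IsOpenBisection (units G) where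
  isOpen := isOpen_units
  injOn_rng a ha b hb e := by
    rw [← show rng a = a from ha, e]
    exact hb
  injOn_src a ha b hb e := by
    rw [← src_eq_of_unit (show rng a = a from ha), e]
    exact src_eq_of_unit hb

theorem isOpen_image_rngU {U : Set G} (hU : IsOpen U) : IsOpen (rngU '' U) :=
  isLocalHomeomorph_rngU.isOpenMap _ hU

theorem mem_image_rngU {U : Set G} {x : UnitSpace G} : x ∈ rngU '' U ↔ (x : G) ∈ liftDom U := by
  constructor
  · rintro ⟨u, hu, rfl⟩
    exact ⟨u, hu, (rng_rng u).symm⟩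
  · rintro ⟨u, hu, e⟩
    exact ⟨u, hu, Subtype.ext (e.trans x.2)⟩

theorem rngU_lift {U : Set G} {x : UnitSpace G} (hx : x ∈ rngU '' U) : rngU (lift U x) = x :=
  Subtype.ext ((rng_lift (mem_image_rngU.1 hx)).trans x.2)

theorem lift_rngU {U : Set G} (hU : IsOpenBisection U) {g : G} (hg : g ∈ U) :
    lift U (rngU g) = g :=
  lift_eq hU hg (rng_rng g).symm

theorem continuousOn_lift_unit {U : Set G} (hU : IsOpenBisection U) :
    ContinuousOn (fun x : UnitSpace G => lift U x) (rngU '' U) :=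
  (continuousOn_lift hU).comp continuous_subtype_val.continuousOn fun _ hx => mem_image_rngU.1 hx

/-! ### Functions on a bisection as functions on the unit space -/

/-- The function on the bisection `U` given by the function `φ` of the range, extended by `0`. -/
def onBis (U : Set G) (φ : UnitSpace G → ℂ) : G → ℂ := U.indicator (φ ∘ rngU)

theorem onBis_of_mem {U : Set G} {φ : UnitSpace G → ℂ} {g : G} (hg : g ∈ U) :
    onBis U φ g = φ (rngU g) := Set.indicator_of_mem hg _

theorem onBis_of_notMem {U : Set G} {φ : UnitSpace G → ℂ} {g : G} (hg : g ∉ U) :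
    onBis U φ g = 0 := Set.indicator_of_notMem hg _

theorem onBis_add (U : Set G) (φ ψ : UnitSpace G → ℂ) :
    onBis U (φ + ψ) = onBis U φ + onBis U ψ := Set.indicator_add _ _ _

theorem memCc_onBis {U : Set G} (hU : IsOpenBisection U) {φ : UnitSpace G → ℂ}
    (hφ : CcOn (rngU '' U) φ) : MemCc U (onBis U φ) := by
  obtain ⟨hc, K, hK, hKU, hz⟩ := hφ
  refine ⟨((hc.comp continuous_rngU).continuousOn).congr fun g hg => onBis_of_mem hg,
    (fun x : UnitSpace G => lift U x) '' K,
    hK.image_of_continuousOn ((continuousOn_lift_unit hU).mono hKU), ?_, ?_⟩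
  · rintro _ ⟨x, hx, rfl⟩
    exact lift_mem (mem_image_rngU.1 (hKU hx))
  · intro g hg
    by_cases hgU : g ∈ U
    · rw [onBis_of_mem hgU]
      exact hz _ fun h => hg ⟨_, h, lift_rngU hU hgU⟩
    · exact onBis_of_notMem hgU

open Classical in
/-- A function on the bisection `U` as a function of the range. -/
def rngFun (U : Set G) (f : G → ℂ) (x : UnitSpace G) : ℂ :=
  if x ∈ rngU '' U then f (lift U x) else 0

theorem rngFun_of_notMem {U : Set G} {f : G → ℂ} {x : UnitSpace G} (hx : x ∉ rngU '' U) :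
    rngFun U f x = 0 := if_neg hx

theorem rngFun_rngU {U : Set G} (hU : IsOpenBisection U) (f : G → ℂ) {g : G} (hg : g ∈ U) :
    rngFun U f (rngU g) = f g := by
  rw [rngFun, if_pos ⟨g, hg, rfl⟩, lift_rngU hU hg]

theorem MemCc.onBis_rngFun {U : Set G} (hU : IsOpenBisection U) {f : G → ℂ} (hf : MemCc U f) :
    onBis U (rngFun U f) = f := by
  funext g
  by_cases hg : g ∈ U
  · rw [onBis_of_mem hg, rngFun_rngU hU f hg]
  · rw [onBis_of_notMem hg, hf.eq_zero hg]

/-- Extension by zero is continuous on the unit space even when it is not on `G`: the image of the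
compact support is compact in a Hausdorff space, hence closed. For this reason functions on
bisections are handled as functions of the range. -/
theorem MemCc.ccOn_rngFun {U : Set G} (hU : IsOpenBisection U) {f : G → ℂ} (hf : MemCc U f) :
    CcOn (rngU '' U) (rngFun U f) := by
  obtain ⟨hc, K, hK, hKU, hz⟩ := hf
  have hz' : ∀ x, x ∉ rngU '' K → rngFun U f x = 0 := by
    intro x hx
    by_cases hxU : x ∈ rngU '' U
    · rw [rngFun, if_pos hxU]
      exact hz _ fun h => hx ⟨_, h, rngU_lift hxU⟩
    · exact rngFun_of_notMem hxU
  have hK' : IsCompact (rngU '' K) := hK.image continuous_rngU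
  refine ⟨?_, rngU '' K, hK', Set.image_mono hKU, hz'⟩
  rw [continuous_iff_continuousAt]
  intro x
  by_cases hx : x ∈ rngU '' U
  · refine ContinuousOn.continuousAt (s := rngU '' U) ?_ ((isOpen_image_rngU hU.isOpen).mem_nhds hx)
    refine (hc.comp (continuousOn_lift_unit hU) fun y hy => lift_mem (mem_image_rngU.1 hy)).congr ?_
    intro y hy
    rw [rngFun, if_pos hy]
    rfl
  · refine (continuousAt_const (y := (0 : ℂ))).congr ?_
    filter_upwards [hK'.isClosed.isOpen_compl.mem_nhds fun h => hx (Set.image_mono hKU h)]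
      with y hy
    exact (hz' y hy).symm

/-- Every element of `C_c(U)` is given by a compactly supported function of the range. -/
theorem MemCc.exists_onBis {U : Set G} (hU : IsOpenBisection U) {f : G → ℂ} (hf : MemCc U f) :
    ∃ φ, CcOn (rngU '' U) φ ∧ f = onBis U φ :=
  ⟨_, hf.ccOn_rngFun hU, (hf.onBis_rngFun hU).symm⟩

theorem onBis_mem_ccSpan {U H : Set G} (hU : IsOpenBisection U) (hUH : U ⊆ H)
    {φ : UnitSpace G → ℂ} (hφ : CcOn (rngU '' U) φ) : onBis U φ ∈ ccSpan H :=
  Submodule.subset_span ⟨U, hU, hUH, memCc_onBis hU hφ⟩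

theorem ccSpan_mono {H H' : Set G} (h : H ⊆ H') : ccSpan H ≤ ccSpan H' :=
  Submodule.span_mono fun _ ⟨U, hU, hUH, hf⟩ => ⟨U, hU, hUH.trans h, hf⟩

theorem eq_zero_of_mem_ccSpan {H : Set G} {f : G → ℂ} (hf : f ∈ ccSpan H) {g : G}
    (hg : g ∉ H) : f g = 0 := by
  induction hf using Submodule.span_induction with
  | mem f hf =>
    obtain ⟨U, -, hUH, hfU⟩ := hf
    exact hfU.eq_zero fun h => hg (hUH h)
  | zero => rfl
  | add f k _ _ hf hk => simp [hf, hk]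
  | smul c f _ hf => simp [hf]

/-- Shrinking the support of a function on `U` from `U` to the open subset `V`. -/
theorem onBis_eq_of_subset {U V : Set G} (hU : IsOpenBisection U) (hVU : V ⊆ U)
    {φ : UnitSpace G → ℂ} (hφ : CcOn (rngU '' V) φ) : onBis U φ = onBis V φ := by
  funext g
  by_cases hV : g ∈ V
  · rw [onBis_of_mem hV, onBis_of_mem (hVU hV)]
  · rw [onBis_of_notMem hV]
    by_cases hg : g ∈ U
    · rw [onBis_of_mem hg]
      refine hφ.eq_zero ?_
      rintro ⟨v, hv, e⟩
      have : v = g := hU.injOn_rng (hVU hv) hg (congrArg Subtype.val e)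
      exact hV (this ▸ hv)
    · exact onBis_of_notMem hg

/-! ### Functions on the unit space acting by convolution -/

theorem rngU_unit (x : UnitSpace G) : rngU (x : G) = x := Subtype.ext x.2

theorem image_rngU_units : rngU '' units G = Set.univ :=
  Set.eq_univ_of_forall fun x => ⟨x, x.2, rngU_unit x⟩

theorem lift_units (g : G) : lift (units G) g = rng g :=
  lift_eq isOpenBisection_units (rng_rng g) (rng_rng g)

theorem inv_unit {x : G} (hx : rng x = x) : x⁻¹ = x := by
  have hs := src_eq_of_unit hx
  have h := mul_inv_self x
  have h2 : x * x⁻¹ = x⁻¹ := by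
    have := rng_mul_self x⁻¹
    rwa [rng_inv, hs] at this
  rw [← h2, h, hx]

theorem conv_onBis_units (φ : UnitSpace G → ℂ) (f : G → ℂ) (g : G) :
    conv (onBis (units G) φ) f g = φ (rngU g) * f g := by
  have hg : g ∈ liftDom (units G) := ⟨rng g, rng_rng g, rng_rng g⟩
  rw [conv_eq_of_dom isOpenBisection_units (fun g hg => onBis_of_notMem hg) hg, lift_units,
    inv_unit (rng_rng g), rng_mul_self, onBis_of_mem (U := units G) (rng_rng g)]
  congr 2
  exact Subtype.ext (rng_rng g)

/-- The element of `𝒞_c(G)` given by a function in `C_c(G⁰)`. -/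
def ccUnit (φ : UnitSpace G → ℂ) (hφ : CcOn Set.univ φ) : Cc G :=
  ⟨onBis (units G) φ, onBis_mem_ccSpan isOpenBisection_units (Set.subset_univ _)
    (by rwa [image_rngU_units])⟩

theorem coe_ccUnit {φ : UnitSpace G → ℂ} (hφ : CcOn Set.univ φ) :
    (ccUnit φ hφ).1 = onBis (units G) φ := rfl

theorem ccUnit_apply_unit {φ : UnitSpace G → ℂ} (hφ : CcOn Set.univ φ) (x : UnitSpace G) :
    (ccUnit φ hφ).1 x = φ x := by
  rw [coe_ccUnit, onBis_of_mem (U := units G) x.2, rngU_unit]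

theorem ccUnit_mul_apply {φ : UnitSpace G → ℂ} (hφ : CcOn Set.univ φ) (f : Cc G) (g : G) :
    (ccUnit φ hφ * f).1 g = φ (rngU g) * f.1 g := conv_onBis_units φ f.1 g

theorem star_apply (f : Cc G) (g : G) : (star f).1 g = star (f.1 g⁻¹) := rfl

theorem star_ccUnit_apply {φ : UnitSpace G → ℂ} (hφ : CcOn Set.univ φ) (g : G) :
    (star (ccUnit φ hφ)).1 g = onBis (units G) (star φ) g := by
  rw [star_apply]
  by_cases hg : g ∈ units G
  · rw [inv_unit hg, onBis_of_mem hg, coe_ccUnit, onBis_of_mem hg]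
    rfl
  · have : g⁻¹ ∉ units G := fun h => hg (by
      have := inv_unit h
      rw [inv_inv'] at this
      rwa [← this] at h)
    rw [onBis_of_notMem hg, coe_ccUnit, onBis_of_notMem this, star_zero]

theorem mul_ccUnit_apply {φ : UnitSpace G → ℂ} (hφ : CcOn Set.univ φ) (f : Cc G) (g : G) :
    (f * ccUnit φ hφ).1 g = f.1 g * φ (srcU g) := by
  rw [← star_star (f * ccUnit φ hφ), star_mul, star_apply]
  have h : (star (ccUnit φ hφ) * star f).1 g⁻¹ = star (φ (rngU g⁻¹)) * (star f).1 g⁻¹ := by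
    have : (star (ccUnit φ hφ)).1 = onBis (units G) (star φ) := funext (star_ccUnit_apply hφ)
    change conv (star (ccUnit φ hφ)).1 (star f).1 g⁻¹ = _
    rw [this, conv_onBis_units]
    rfl
  rw [h, star_mul, star_star, star_apply, inv_inv', star_star, Reduction.rngU_inv]

theorem ccUnit_mul_ccUnit {φ ψ χ : UnitSpace G → ℂ} (hφ : CcOn Set.univ φ)
    (hψ : CcOn Set.univ ψ) (hχ : CcOn Set.univ χ) (h : ∀ x, φ x * ψ x = χ x) :
    ccUnit φ hφ * ccUnit ψ hψ = ccUnit χ hχ := by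
  refine Subtype.ext (funext fun g => ?_)
  rw [ccUnit_mul_apply]
  by_cases hg : g ∈ units G
  · simp only [ccUnit, onBis_of_mem hg, h]
  · simp only [ccUnit, onBis_of_notMem hg, mul_zero]

theorem star_ccUnit {w : UnitSpace G → ℝ} (hw : CcOn Set.univ (fun x => (w x : ℂ))) :
    star (ccUnit _ hw) = ccUnit _ hw := by
  refine Subtype.ext (funext fun g => ?_)
  rw [star_ccUnit_apply]
  have : (star fun x => (w x : ℂ)) = fun x => (w x : ℂ) := funext fun x => Complex.conj_ofReal _
  rw [this]
  rfl

/-- For `f` in `C_c(U)`, `f * f⋆` is the function `|f|²` of the range. -/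
theorem onBis_mul_star {U : Set G} (hU : IsOpenBisection U) {φ : UnitSpace G → ℂ}
    (hφ : CcOn (rngU '' U) φ) (f : Cc G) (hf : f.1 = onBis U φ)
    (h2 : CcOn Set.univ fun x => ((‖φ x‖ ^ 2 : ℝ) : ℂ)) :
    f * star f = ccUnit _ h2 := by
  refine Subtype.ext (funext fun g => ?_)
  have hf0 : ∀ g, g ∉ U → f.1 g = 0 := fun g hg => by rw [hf, onBis_of_notMem hg]
  change conv f.1 (involution f.1) g = onBis (units G) _ g
  by_cases hd : g ∈ liftDom U
  · rw [conv_eq_of_dom hU hf0 hd]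
    set u := lift U g with hu
    have huU : u ∈ U := lift_mem hd
    have hr : rng u = rng g := rng_lift hd
    have e1 : src u⁻¹ = rng g := by rw [src_inv, hr]
    have e2 : src g⁻¹ = rng u := by rw [src_inv, hr]
    have e3 : (u⁻¹ * g)⁻¹ = g⁻¹ * u := by rw [mul_inv_rev' e1, inv_inv']
    change f.1 u * star (f.1 (u⁻¹ * g)⁻¹) = _
    rw [e3]
    by_cases hg : g ∈ units G
    · have hg' : rng g = g := hg
      have : g⁻¹ * u = u := by rw [inv_unit hg', ← hg', ← hr, rng_mul_self]
      rw [this, onBis_of_mem hg, hf, onBis_of_mem huU, Subtype.ext hr (a1 := rngU u) (a2 := rngU g)]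
      rw [show star (φ (rngU g)) = (starRingEnd ℂ) (φ (rngU g)) from rfl, Complex.mul_conj']
      push_cast
      rfl
    · rw [onBis_of_notMem hg, hf0 (g⁻¹ * u), star_zero, mul_zero]
      -- If `g⁻¹ * u` were in `U`, it would have the same source as `u` and so equal `u`, which
      -- forces `g` to be a unit.
      intro hm
      have h3 : g⁻¹ * u = u := hU.injOn_src hm huU (src_mul _ _ e2)
      have h4 := mul_mul_inv e2
      rw [h3, mul_inv_self, hr] at h4
      have h5 : g⁻¹ ∈ units G := by rw [← h4]; exact rng_rng g
      have h6 := inv_unit h5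
      rw [inv_inv'] at h6
      exact hg (h6 ▸ h5)
  · rw [conv_eq_zero_of_not_dom hf0 hd]
    by_cases hg : g ∈ units G
    · rw [onBis_of_mem hg, hφ.eq_zero]
      · simp
      · rintro ⟨u, hu, e⟩
        exact hd ⟨u, hu, congrArg Subtype.val e⟩
    · rw [onBis_of_notMem hg]

end EtaleGroupoid

end BisectionFunctions

noncomputable section LocalGroupoids

namespace EtaleGroupoid

variable {G : Type*} [TopologicalSpace G] [EtaleGroupoid G]

/-! ### Local groupoids -/

/-- The largest local groupoid about `G|_X`. -/
def localGroupoid (X : ClosedLocInv G) : Set G :=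
  interior {g | srcU g ∈ X.carrier ↔ rngU g ∈ X.carrier}

/-- Products of open bisections are open, so a product of interior points is interior; that `G|_X`
is contained in the interior is precisely local invariance. -/
theorem isLocalGroupoid_localGroupoid (X : ClosedLocInv G) :
    IsLocalGroupoid X (localGroupoid X) where
  isOpen := isOpen_interior
  mul_mem g hg h hh e := by
    obtain ⟨U, hU, hgU, hUH⟩ := exists_isOpenBisection isOpen_interior hg
    obtain ⟨V, hV, hhV, hVH⟩ := exists_isOpenBisection isOpen_interior hh
    refine mem_interior.2 ⟨setMul U V, ?_, (hU.setMul hV).isOpen, g, hgU, h, hhV, e, rfl⟩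
    rintro _ ⟨u, hu, v, hv, e', rfl⟩
    have h1 : srcU (u * v) = srcU v := Subtype.ext (src_mul _ _ e')
    have h2 : rngU (u * v) = rngU u := Subtype.ext (rng_mul _ _ e')
    have h3 : srcU u = rngU v := Subtype.ext e'
    have hu' := interior_subset (hUH hu)
    have hv' := interior_subset (hVH hv)
    simp only [Set.mem_ofPred_eq] at hu' hv' ⊢
    rw [h1, h2, hv', ← hu', h3]
  inv_mem g hg := by
    refine mem_interior.2 ⟨(fun g : G => g⁻¹) ⁻¹' localGroupoid X, fun k hk => ?_,
      isOpen_interior.preimage continuous_inv', by rwa [Set.mem_preimage, inv_inv']⟩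
    have hk' := interior_subset hk
    simp only [Set.mem_ofPred_eq, Reduction.srcU_inv, Reduction.rngU_inv] at hk' ⊢
    exact hk'.symm
  reduction_subset g hg := by
    obtain ⟨U, hU, hgU, hi⟩ := X.locInv g hg.1 hg.2
    exact mem_interior.2 ⟨U, hi, hU, hgU⟩
  invariant h hh := interior_subset (s := {g | srcU g ∈ X.carrier ↔ rngU g ∈ X.carrier}) hh

theorem units_subset_localGroupoid (X : ClosedLocInv G) : units G ⊆ localGroupoid X := by
  intro x hx
  refine mem_interior.2 ⟨units G, fun y hy => ?_, isOpen_units, hx⟩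
  have : srcU y = rngU y := Subtype.ext ((src_eq_of_unit hy).trans (Eq.symm hy))
  rw [Set.mem_ofPred_eq, this]

variable {X : ClosedLocInv G} {H : Set G}

theorem IsLocalGroupoid.mem_reductionSet_of_rng (hH : IsLocalGroupoid X H) {g : G} (hg : g ∈ H)
    (h : rngU g ∈ X.carrier) : g ∈ reductionSet X.carrier :=
  ⟨h, (hH.invariant g hg).2 h⟩

theorem IsLocalGroupoid.mem_reductionSet_of_src (hH : IsLocalGroupoid X H) {g : G} (hg : g ∈ H)
    (h : srcU g ∈ X.carrier) : g ∈ reductionSet X.carrier :=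
  ⟨(hH.invariant g hg).1 h, h⟩

/-! ### The restriction map -/

theorem restrict_eq_zero_iff {f : Cc G} :
    restrict X f = 0 ↔ ∀ g ∈ reductionSet X.carrier, f.1 g = 0 := by
  constructor
  · intro h g hg
    have := congrArg (fun b : Cc (Reduction X) => b.1 (Reduction.mk g hg.1 hg.2)) h
    exact this
  · intro h
    exact Subtype.ext (funext fun g => h g.val ⟨g.rngU_mem, g.srcU_mem⟩)

theorem restrict_star (f : Cc G) : restrict X (star f) = star (restrict X f) := rfl

/-- The restriction map is multiplicative if the right factor is supported in a local groupoid. -/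
theorem IsLocalGroupoid.restrict_mul (hH : IsLocalGroupoid X H) (f : Cc G) {k : Cc G}
    (hk : k.1 ∈ ccSpan H) : restrict X (f * k) = restrict X f * restrict X k := by
  refine Subtype.ext (funext fun g => ?_)
  change (∑ᶠ h : {h : G // src h = src g.val}, f.1 (g.val * (h : G)⁻¹) * k.1 h) =
    ∑ᶠ h : {h : Reduction X // src h = src g},
      f.1 (g * (h : Reduction X)⁻¹).val * k.1 (h : Reduction X).val
  let ι : {h : Reduction X // src h = src g} → {h : G // src h = src g.val} :=
    fun h => ⟨h.1.val, Reduction.val_eq_of_eq h.2⟩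
  have hι : Function.Injective ι := fun a b e =>
    Subtype.ext (Reduction.ext' (congrArg (fun z : {h : G // src h = src g.val} => z.1) e))
  -- A nonzero term has `h` in `H` with source `s(g)` in `X`; by invariance its range is in `X` too,
  -- so the sum over the fibre in `G` reduces to the fibre in `G|_X`.
  have hsupp : (Function.support fun h : {h : G // src h = src g.val} =>
      f.1 (g.val * (h : G)⁻¹) * k.1 h) ⊆ Set.range ι := by
    rintro ⟨h, hs⟩ hne
    have hhH : h ∈ H := by
      by_contra hc
      exact hne (by simp [eq_zero_of_mem_ccSpan hk hc])
    have hsX : srcU h ∈ X.carrier := by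
      rw [show srcU h = srcU g.val from Subtype.ext hs]
      exact g.srcU_mem
    have hred := hH.mem_reductionSet_of_src hhH hsX
    exact ⟨⟨Reduction.mk h hred.1 hred.2, Reduction.ext' hs⟩, rfl⟩
  rw [← Set.indicator_eq_self.2 hsupp, ← finsum_mem_def, finsum_mem_range hι]
  refine finsum_congr fun h => ?_
  have e : src g.val = rng (h : Reduction X)⁻¹.val := by
    change src g.val = rng (h : Reduction X).val⁻¹
    rw [rng_inv]
    exact (Reduction.val_eq_of_eq h.2).symm
  have h2 : (g * (h : Reduction X)⁻¹).val = g.val * (h : Reduction X).val⁻¹ :=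
    Reduction.val_mul' e
  rw [h2]

/-- As a function of the range, `b` extends from the closed set `X` to the unit space. An open
bisection of `G|_X` need not come from one open bisection of `G`, so a partition of unity
distributes the extension `Φ` over finitely many open bisections inside `O ∩ H`, where `O` cuts out
`V`. -/
theorem IsLocalGroupoid.exists_restrict_eq_of_memCc (hH : IsLocalGroupoid X H)
    {V : Set (Reduction X)} (hV : IsOpenBisection V) {b : Reduction X → ℂ} (hb : MemCc V b) :
    ∃ a ∈ ccSpan H, a ∘ Reduction.val = b := by
  have hφ := hb.ccOn_rngFun hV
  set φ := rngFun V b with hφdef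
  obtain ⟨Φ, hΦ, hΦφ⟩ := exists_ccOn_extension_of_isClosedEmbedding
    (Reduction.isClosedEmbedding_unitIncl (X := X)) (hφ.mono (Set.subset_univ _))
  obtain ⟨-, K, hK, hKV, hz⟩ := hφ
  obtain ⟨O, hO, rfl⟩ := Reduction.isEmbedding_val.isInducing.isOpen_iff.1 hV.isOpen
  choose! U hU hgU hUO using fun (g : G) (hg : g ∈ O ∩ H) =>
    exists_isOpenBisection (hO.inter hH.isOpen) hg
  have hincl : ∀ y : Reduction X, Reduction.unitIncl (rngU y) = rngU y.val := fun y => rfl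
  have hC : IsCompact (Reduction.unitIncl '' K) :=
    hK.image Reduction.isClosedEmbedding_unitIncl.continuous
  obtain ⟨t, ht⟩ := hC.elim_finite_subcover (fun g : ↥(O ∩ H) => rngU '' U g)
    (fun g => isOpen_image_rngU (hU g g.2).isOpen) (by
      rintro _ ⟨x, hx, rfl⟩
      obtain ⟨y, hy, rfl⟩ := hKV hx
      exact Set.mem_iUnion.2 ⟨⟨y.val, hy, hH.reduction_subset y.2⟩, y.val,
        hgU _ ⟨hy, hH.reduction_subset y.2⟩, (hincl y).symm⟩)
  obtain ⟨χ, hχ, hχ1⟩ := exists_ccOn_sum_one (ι := t) (O := fun g => rngU '' U g.1) hC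
    (fun g => isOpen_image_rngU (hU g.1 g.1.2).isOpen) (by
      intro x hx
      obtain ⟨g, hgt, hx'⟩ := Set.mem_iUnion₂.1 (ht hx)
      exact Set.mem_iUnion.2 ⟨⟨g, hgt⟩, hx'⟩)
  refine ⟨∑ i, onBis (U i.1) fun x => Φ x * χ i x, Submodule.sum_mem _ fun i _ =>
    onBis_mem_ccSpan (hU _ i.1.2) ((hUO _ i.1.2).trans Set.inter_subset_right)
      ((hΦ.mul_inter (hχ i)).mono Set.inter_subset_right), ?_⟩
  funext y
  rw [Function.comp_apply, Finset.sum_apply]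
  by_cases hy : y ∈ Reduction.val ⁻¹' O
  · have hΦy : Φ (rngU y.val) = b y := by rw [← hincl, hΦφ, hφdef, rngFun_rngU hV b hy]
    have hterm : ∀ i, onBis (U i.1) (fun x => Φ x * χ i x) y.val = b y * χ i (rngU y.val) := by
      intro i
      by_cases hyU : y.val ∈ U i.1
      · rw [onBis_of_mem hyU, hΦy]
      · rw [onBis_of_notMem hyU, (hχ i).eq_zero, mul_zero]
        -- An arrow `u` of `U i` with the range of `y` has its range in `X` and lies in `H`, hence
        -- in `G|_X`; as it lies in `O` too, injectivity of the range on the bisection gives `u =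
        -- y`. So the other bisections contribute nothing over `rng y`.
        rintro ⟨u, hu, e⟩
        have huOH := hUO _ i.1.2 hu
        have hred := hH.mem_reductionSet_of_rng huOH.2 (e ▸ y.rngU_mem)
        have : Reduction.mk u hred.1 hred.2 = y :=
          hV.injOn_rng huOH.1 hy (Reduction.ext' (congrArg (fun z : UnitSpace G => z.1) e))
        exact hyU (by rw [← this]; exact hu)
    rw [Finset.sum_congr rfl fun i _ => hterm i, ← Finset.mul_sum]
    by_cases hby : b y = 0
    · rw [hby, zero_mul]
    · rw [hχ1, mul_one]
      refine ⟨rngU y, ?_, hincl y⟩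
      by_contra hc
      exact hby (by rw [← rngFun_rngU hV b hy, ← hφdef, hz _ hc])
  · rw [hb.eq_zero hy]
    exact Finset.sum_eq_zero fun i _ => onBis_of_notMem fun h => hy (hUO _ i.1.2 h).1

/-- Restriction maps `𝒞_c(H)` onto `𝒞_c(G|_X)`. -/
theorem IsLocalGroupoid.exists_restrict_eq (hH : IsLocalGroupoid X H) (b : Cc (Reduction X)) :
    ∃ a : Cc G, a.1 ∈ ccSpan H ∧ restrict X a = b := by
  obtain ⟨b, hb⟩ := b
  suffices h : ∃ a ∈ ccSpan H, a ∘ Reduction.val = b by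
    obtain ⟨a, ha, e⟩ := h
    exact ⟨⟨a, ccSpan_mono (Set.subset_univ _) ha⟩, ha, Subtype.ext e⟩
  induction hb using Submodule.span_induction with
  | mem b hb =>
    obtain ⟨V, hV, -, hbV⟩ := hb
    exact hH.exists_restrict_eq_of_memCc hV hbV
  | zero => exact ⟨0, Submodule.zero_mem _, rfl⟩
  | add b b' _ _ h h' =>
    obtain ⟨a, ha, rfl⟩ := h
    obtain ⟨a', ha', rfl⟩ := h'
    exact ⟨a + a', Submodule.add_mem _ ha ha', rfl⟩
  | smul c b _ h =>
    obtain ⟨a, ha, rfl⟩ := h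
    exact ⟨c • a, Submodule.smul_mem _ c ha, rfl⟩

/-! ### Compressing functions into an open set -/

/-- A function in `𝒞_c(G)` is supported in the open set `H ⊇ G|_X` after cutting it down by
`1 - w` on both sides, where `w` is `1` on a large compact set off `X`. -/
theorem exists_compact_cut_mem_ccSpan (hH : IsOpen H) (hXH : reductionSet X.carrier ⊆ H)
    {f : G → ℂ} (hf : f ∈ ccSpan (Set.univ : Set G)) :
    ∃ C : Set (UnitSpace G), IsCompact C ∧ C ⊆ X.carrierᶜ ∧ ∀ w : UnitSpace G → ℂ,
      Continuous w → (∀ x ∈ C, w x = 1) →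
        (fun g => (1 - w (rngU g)) * f g * (1 - w (srcU g))) ∈ ccSpan H := by
  induction hf using Submodule.span_induction with
  | mem f hf =>
    obtain ⟨U, hU, -, hfc, K, hK, hKU, hz⟩ := hf
    -- Removing an open set from a compact one keeps it compact without any separation axiom on `G`.
    -- `N C` consists of the arrows whose range or source is interior to `C`; these are killed by `1
    -- - w` on one of the two sides.
    have hL : IsCompact (K \ H) := hK.diff hH
    let N : Set (UnitSpace G) → Set G := fun C => rngU ⁻¹' interior C ∪ srcU ⁻¹' interior C
    have hN : ∀ C, IsOpen (N C) := fun C =>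
      (isOpen_interior.preimage continuous_rngU).union (isOpen_interior.preimage continuous_srcU)
    have hNmono : ∀ {C D}, C ⊆ D → N C ⊆ N D := fun h =>
      Set.union_subset_union (Set.preimage_mono (interior_mono h))
        (Set.preimage_mono (interior_mono h))
    obtain ⟨C, hC, hCX, hLC⟩ : ∃ C, IsCompact C ∧ C ⊆ X.carrierᶜ ∧ K \ H ⊆ N C := by
      refine hL.induction_on (p := fun S => ∃ C, IsCompact C ∧ C ⊆ X.carrierᶜ ∧ S ⊆ N C)
        ⟨∅, isCompact_empty, Set.empty_subset _, Set.empty_subset _⟩ ?_ ?_ ?_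
      · rintro s t hst ⟨C, hC, hCX, htC⟩
        exact ⟨C, hC, hCX, hst.trans htC⟩
      · rintro s t ⟨C, hC, hCX, hs⟩ ⟨D, hD, hDX, ht⟩
        exact ⟨C ∪ D, hC.union hD, Set.union_subset hCX hDX, Set.union_subset
          (hs.trans (hNmono Set.subset_union_left)) (ht.trans (hNmono Set.subset_union_right))⟩
      · intro g hg
        -- Only `G|_X ⊆ H` is needed: an arrow outside `H` cannot have both ends in `X`.
        have hred : rngU g ∉ X.carrier ∨ srcU g ∉ X.carrier := by
          by_contra! hc
          exact hg.2 (hXH hc)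
        obtain ⟨C, hC, hCX, hgC⟩ : ∃ C, IsCompact C ∧ C ⊆ X.carrierᶜ ∧ g ∈ N C := by
          rcases hred with h | h
          · obtain ⟨C, hC, hgC, hCX⟩ := exists_compact_subset X.isClosed.isOpen_compl h
            exact ⟨C, hC, hCX, Or.inl hgC⟩
          · obtain ⟨C, hC, hgC, hCX⟩ := exists_compact_subset X.isClosed.isOpen_compl h
            exact ⟨C, hC, hCX, Or.inr hgC⟩
        exact ⟨N C, mem_nhdsWithin_of_mem_nhds ((hN C).mem_nhds hgC), C, hC, hCX, subset_rfl⟩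
    refine ⟨C, hC, hCX, fun w hw hw1 => Submodule.subset_span
      ⟨U ∩ H, hU.mono (hU.isOpen.inter hH) Set.inter_subset_left, Set.inter_subset_right, ?_,
        K \ N C, hK.diff (hN C), fun g hg => ⟨hKU hg.1, ?_⟩, fun g hg => ?_⟩⟩
    · exact (((continuous_const.sub (hw.comp continuous_rngU)).continuousOn.mul
        (hfc.mono Set.inter_subset_left))).mul
          (continuous_const.sub (hw.comp continuous_srcU)).continuousOn
    · by_contra hc
      exact hg.2 (hLC ⟨hg.1, hc⟩)
    · by_cases hgK : g ∈ K
      · have : g ∈ N C := by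
          by_contra hc
          exact hg ⟨hgK, hc⟩
        rcases this with h | h
        · simp [hw1 _ (interior_subset h)]
        · simp [hw1 _ (interior_subset h)]
      · simp [hz g hgK]
  | zero =>
    exact ⟨∅, isCompact_empty, Set.empty_subset _, fun w _ _ =>
      (congrArg (· ∈ ccSpan H) (funext fun g => by simp)).mp (Submodule.zero_mem (ccSpan H))⟩
  | add f k _ _ h h' =>
    obtain ⟨C, hC, hCX, hf⟩ := h
    obtain ⟨D, hD, hDX, hk⟩ := h'
    refine ⟨C ∪ D, hC.union hD, Set.union_subset hCX hDX, fun w hw hw1 => ?_⟩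
    have := Submodule.add_mem _ (hf w hw fun x hx => hw1 x (Or.inl hx))
      (hk w hw fun x hx => hw1 x (Or.inr hx))
    refine (congrArg (· ∈ ccSpan H) (funext fun g => ?_)).mp this
    simp only [Pi.add_apply]
    ring
  | smul c f _ h =>
    obtain ⟨C, hC, hCX, hf⟩ := h
    refine ⟨C, hC, hCX, fun w hw hw1 => ?_⟩
    refine (congrArg (· ∈ ccSpan H) (funext fun g => ?_)).mp (Submodule.smul_mem _ c (hf w hw hw1))
    simp only [Pi.smul_apply, smul_eq_mul]
    ring

end EtaleGroupoid

end LocalGroupoids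

/-! ### Estimates for arbitrary C*-seminorms by means of square roots -/

noncomputable section NormEstimates

section CStar

variable {B : Type*} [NonUnitalCStarAlgebra B]

/-- This is `‖1 - w‖ ≤ 1` without a unit: `a⋆a - ((1-w)a)⋆((1-w)a) = a⋆(2w - w²)a = (ha)⋆(ha) ≥ 0`,
and the norm is monotone on positive elements. -/
theorem norm_sub_mul_le_of_star_mul_self_eq {w h : B} (hw : star w = w)
    (hh : star h * h = w + w - w * w) (a : B) : ‖a - w * a‖ ≤ ‖a‖ := by
  let _ := CStarAlgebra.spectralOrder B
  have := CStarAlgebra.spectralOrderedRing B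
  have key : star a * a - star (a - w * a) * (a - w * a) = star (h * a) * (h * a) := by
    have h1 : star (h * a) * (h * a) = star a * (w + w - w * w) * a := by
      rw [← hh, star_mul]
      simp only [mul_assoc]
    rw [h1, star_sub, star_mul, hw]
    noncomm_ring
  have hle : star (a - w * a) * (a - w * a) ≤ star a * a := by
    rw [← sub_nonneg, key]
    exact star_mul_self_nonneg _
  have h2 := CStarAlgebra.norm_le_norm_of_nonneg_of_le (star_mul_self_nonneg (a - w * a)) hle
  rw [CStarRing.norm_star_mul_self, CStarRing.norm_star_mul_self] at h2
  exact abs_le_of_sq_le_sq' (by nlinarith) (norm_nonneg a) |>.2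

theorem norm_sub_mul_le_of_star_mul_self_eq' {w h : B} (hw : star w = w)
    (hh : star h * h = w + w - w * w) (a : B) : ‖a - a * w‖ ≤ ‖a‖ := by
  have := norm_sub_mul_le_of_star_mul_self_eq hw hh (star a)
  rwa [← norm_star, star_sub, star_mul, star_star, hw, norm_star] at this

/-- The hypotheses express `w ≥ 0` and `w² ≤ w`, hence `‖w‖² ≤ ‖w‖`. -/
theorem norm_le_one_of_star_mul_self_eq {w k h : B} (hk : star k * k = w)
    (hh : star h * h = w - w * w) : ‖w‖ ≤ 1 := by
  let _ := CStarAlgebra.spectralOrder B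
  have := CStarAlgebra.spectralOrderedRing B
  have hw : star w = w := by rw [← hk, star_mul, star_star]
  have hle : star w * w ≤ w := by
    rw [← sub_nonneg, hw, ← hh]
    exact star_mul_self_nonneg _
  have h2 := CStarAlgebra.norm_le_norm_of_nonneg_of_le (star_mul_self_nonneg w) hle
  rw [CStarRing.norm_star_mul_self] at h2
  by_contra! hc
  nlinarith

end CStar

namespace CStarSeminorm

variable {A : Type*} [NonUnitalRing A] [StarRing A] [Module ℂ A] (ρ : CStarSeminorm A)

theorem seminorm_star (a : A) : ρ (star a) = ρ a :=
  norm_star (ρ.toAlg a)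

theorem star_mul_self (a : A) : ρ (star a * a) = ρ a ^ 2 := ρ.star_mul_self' a

theorem mul_star_self (a : A) : ρ (a * star a) = ρ a ^ 2 := by
  have := ρ.star_mul_self (star a)
  rwa [star_star, ρ.seminorm_star] at this

theorem seminorm_nonneg (a : A) : 0 ≤ ρ a := apply_nonneg ρ.toSeminorm a

theorem seminorm_add_le (a b : A) : ρ (a + b) ≤ ρ a + ρ b := ρ.add_le' a b

theorem seminorm_smul (z : ℂ) (a : A) : ρ (z • a) = ‖z‖ * ρ a := ρ.smul' z a

theorem seminorm_mul_le (a b : A) : ρ (a * b) ≤ ρ a * ρ b := ρ.mul_le_mul' a b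

theorem seminorm_zero : ρ 0 = 0 := map_zero ρ.toSeminorm

end CStarSeminorm

namespace EtaleGroupoid

variable {G : Type*} [TopologicalSpace G] [EtaleGroupoid G]

/-- Compactly supported functions on the unit space with values in `[0, 1]`. -/
structure IsCutoff (O : Set (UnitSpace G)) (w : UnitSpace G → ℝ) : Prop where
  nonneg : ∀ x, 0 ≤ w x
  le_one : ∀ x, w x ≤ 1
  ccOn : CcOn O (fun x => (w x : ℂ))

namespace IsCutoff

variable {O : Set (UnitSpace G)} {w : UnitSpace G → ℝ}

theorem continuous (hw : IsCutoff O w) : Continuous w := by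
  have := Complex.continuous_re.comp hw.ccOn.1
  simpa [Function.comp_def] using this

theorem ccOn_univ (hw : IsCutoff O w) : CcOn Set.univ (fun x => (w x : ℂ)) :=
  hw.ccOn.mono (Set.subset_univ _)

/-- The element of `𝒞_c(G)` given by a cutoff function. -/
def toCc (hw : IsCutoff O w) : Cc G := ccUnit _ hw.ccOn_univ

theorem star_toCc (hw : IsCutoff O w) : star hw.toCc = hw.toCc := star_ccUnit _

theorem toCc_mul_apply (hw : IsCutoff O w) (f : Cc G) (g : G) :
    (hw.toCc * f).1 g = w (rngU g) * f.1 g := ccUnit_mul_apply _ f g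

theorem mul_toCc_apply (hw : IsCutoff O w) (f : Cc G) (g : G) :
    (f * hw.toCc).1 g = f.1 g * w (srcU g) := mul_ccUnit_apply _ f g

theorem coe_toCc (hw : IsCutoff O w) : hw.toCc.1 = onBis (units G) fun x => (w x : ℂ) := rfl

theorem comp (hw : IsCutoff O w) {F : ℝ → ℝ} (hF : Continuous F) (h0 : F 0 = 0)
    (hF1 : ∀ t, 0 ≤ t → t ≤ 1 → 0 ≤ F t ∧ F t ≤ 1) : IsCutoff O (fun x => F (w x)) where
  nonneg x := (hF1 _ (hw.nonneg x) (hw.le_one x)).1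
  le_one x := (hF1 _ (hw.nonneg x) (hw.le_one x)).2
  ccOn := hw.ccOn.of_zero (Complex.continuous_ofReal.comp (hF.comp hw.continuous)) fun x hx => by
    have : w x = 0 := by exact_mod_cast hx
    simp [this, h0]

/-- The square root is taken pointwise, as `√(F ∘ w)`, so it stays in the uncompleted algebra and
off `X` when `w` is; no functional calculus is needed. -/
theorem exists_star_mul_self_eq (hw : IsCutoff O w) {F : ℝ → ℝ} (hF : Continuous F) (h0 : F 0 = 0)
    (hF1 : ∀ t, 0 ≤ t → t ≤ 1 → 0 ≤ F t ∧ F t ≤ 1) :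
    ∃ v, ∃ hv : IsCutoff O v, star hv.toCc * hv.toCc = (hw.comp hF h0 hF1).toCc := by
  refine ⟨_, hw.comp (F := fun t => √(F t)) hF.sqrt (by simp [h0]) fun t ht ht1 =>
    ⟨Real.sqrt_nonneg _, Real.sqrt_le_one.2 (hF1 t ht ht1).2⟩, ?_⟩
  rw [star_toCc]
  refine ccUnit_mul_ccUnit _ _ _ fun x => ?_
  rw [← Complex.ofReal_mul, Real.mul_self_sqrt (hF1 _ (hw.nonneg x) (hw.le_one x)).1]

theorem exists_star_mul_self_eq_toCc (hw : IsCutoff O w) :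
    ∃ v, ∃ hv : IsCutoff O v, star hv.toCc * hv.toCc = hw.toCc :=
  hw.exists_star_mul_self_eq continuous_id rfl fun _ h h' => ⟨h, h'⟩

theorem toCc_mul_self_apply (hw : IsCutoff O w) (g : G) :
    (hw.toCc * hw.toCc).1 g = onBis (units G) (fun x => ((w x * w x : ℝ) : ℂ)) g := by
  rw [toCc_mul_apply, coe_toCc]
  by_cases hg : g ∈ units G
  · simp only [onBis_of_mem hg, Complex.ofReal_mul]
  · simp only [onBis_of_notMem hg, mul_zero]

/-- On `[0, 1]` one has `0 ≤ 2t - t² = 1 - (1-t)² ≤ 1`. This supplies the `h` for the bound on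
multiplication by `1 - w`. -/
theorem exists_star_mul_self_eq_two (hw : IsCutoff O w) :
    ∃ h : Cc G, star h * h = hw.toCc + hw.toCc - hw.toCc * hw.toCc := by
  obtain ⟨v, hv, e⟩ := hw.exists_star_mul_self_eq (F := fun t => t + t - t * t) (by fun_prop)
    (by simp) fun t h h' => ⟨by nlinarith, by nlinarith⟩
  refine ⟨hv.toCc, e.trans (Subtype.ext (funext fun g => ?_))⟩
  change _ = hw.toCc.1 g + hw.toCc.1 g - (hw.toCc * hw.toCc).1 g
  rw [toCc_mul_self_apply, coe_toCc, coe_toCc]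
  by_cases hg : g ∈ units G
  · simp only [onBis_of_mem hg]
    push_cast
    rfl
  · simp only [onBis_of_notMem hg, add_zero, sub_zero]

/-- On `[0, 1]` one has `t - t² ≥ 0`; this supplies the `h` for the bound `ρ(w) ≤ 1`. -/
theorem exists_star_mul_self_eq_sub (hw : IsCutoff O w) :
    ∃ h : Cc G, star h * h = hw.toCc - hw.toCc * hw.toCc := by
  obtain ⟨v, hv, e⟩ := hw.exists_star_mul_self_eq (F := fun t => t - t * t) (by fun_prop)
    (by simp) fun t h h' => ⟨by nlinarith, by nlinarith⟩
  refine ⟨hv.toCc, e.trans (Subtype.ext (funext fun g => ?_))⟩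
  change _ = hw.toCc.1 g - (hw.toCc * hw.toCc).1 g
  rw [toCc_mul_self_apply, coe_toCc, coe_toCc]
  by_cases hg : g ∈ units G
  · simp only [onBis_of_mem hg]
    push_cast
    rfl
  · simp only [onBis_of_notMem hg, sub_zero]

variable (ρ : CStarSeminorm (Cc G))

theorem norm_sub_mul_le (hw : IsCutoff O w) (a : ρ.Completed) :
    ‖a - ρ.toCompleted hw.toCc * a‖ ≤ ‖a‖ := by
  obtain ⟨h, e⟩ := hw.exists_star_mul_self_eq_two
  refine norm_sub_mul_le_of_star_mul_self_eq (h := ρ.toCompleted h) ?_ ?_ a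
  · rw [← map_star, hw.star_toCc]
  · rw [← map_star, ← map_mul, e, map_sub, map_add, map_mul]

theorem norm_sub_mul_le' (hw : IsCutoff O w) (a : ρ.Completed) :
    ‖a - a * ρ.toCompleted hw.toCc‖ ≤ ‖a‖ := by
  obtain ⟨h, e⟩ := hw.exists_star_mul_self_eq_two
  refine norm_sub_mul_le_of_star_mul_self_eq' (h := ρ.toCompleted h) ?_ ?_ a
  · rw [← map_star, hw.star_toCc]
  · rw [← map_star, ← map_mul, e, map_sub, map_add, map_mul]

theorem seminorm_toCc_le_one (hw : IsCutoff O w) : ρ hw.toCc ≤ 1 := by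
  obtain ⟨h, e⟩ := hw.exists_star_mul_self_eq_sub
  obtain ⟨v, hv, e'⟩ := hw.exists_star_mul_self_eq_toCc
  rw [← ρ.norm_toCompleted]
  refine norm_le_one_of_star_mul_self_eq (k := ρ.toCompleted hv.toCc) (h := ρ.toCompleted h) ?_ ?_
  · rw [← map_star, ← map_mul, e']
  · rw [← map_star, ← map_mul, e, map_sub, map_mul]

theorem seminorm_sub_mul_le (hw : IsCutoff O w) (a : Cc G) : ρ (a - hw.toCc * a) ≤ ρ a := by
  have := hw.norm_sub_mul_le ρ (ρ.toCompleted a)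
  rwa [← map_mul, ← map_sub, ρ.norm_toCompleted, ρ.norm_toCompleted] at this

theorem seminorm_sub_mul_le' (hw : IsCutoff O w) (a : Cc G) : ρ (a - a * hw.toCc) ≤ ρ a := by
  have := hw.norm_sub_mul_le' ρ (ρ.toCompleted a)
  rwa [← map_mul, ← map_sub, ρ.norm_toCompleted, ρ.norm_toCompleted] at this

end IsCutoff

/-- On functions supported in a bisection, every C*-seminorm is bounded by the supremum norm. -/
theorem seminorm_le_of_onBis (ρ : CStarSeminorm (Cc G)) {U : Set G} (hU : IsOpenBisection U)
    {φ : UnitSpace G → ℂ} (hφ : CcOn (rngU '' U) φ) (f : Cc G) (hf : f.1 = onBis U φ)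
    {δ : ℝ} (hδ : 0 < δ) (hle : ∀ x, ‖φ x‖ ≤ δ) : ρ f ≤ δ := by
  -- With this cutoff `w`, the product `f * f⋆` is `δ² w`, so `ρ(f)² = ρ(f * f⋆) ≤ δ²`.
  have hw : IsCutoff (Set.univ : Set (UnitSpace G)) fun x => (‖φ x‖ / δ) ^ 2 :=
    ⟨fun x => by positivity, fun x => pow_le_one₀ (by positivity) ((div_le_one hδ).2 (hle x)),
      (hφ.mono (Set.subset_univ _)).of_zero (Complex.continuous_ofReal.comp
        ((hφ.1.norm.div_const δ).pow 2)) fun x hx => by simp [hx]⟩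
  have h2 : CcOn Set.univ fun x => ((‖φ x‖ ^ 2 : ℝ) : ℂ) :=
    (hφ.mono (Set.subset_univ _)).of_zero (Complex.continuous_ofReal.comp (hφ.1.norm.pow 2))
      fun x hx => by simp [hx]
  have e : ccUnit _ h2 = ((δ ^ 2 : ℝ) : ℂ) • hw.toCc := by
    refine Subtype.ext (funext fun g => ?_)
    change onBis (units G) _ g = ((δ ^ 2 : ℝ) : ℂ) * onBis (units G) _ g
    by_cases hg : g ∈ units G
    · simp only [onBis_of_mem hg]
      rw [← Complex.ofReal_mul, ← mul_pow, mul_div_cancel₀ _ hδ.ne']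
    · simp only [onBis_of_notMem hg, mul_zero]
  have h3 := ρ.mul_star_self f
  rw [onBis_mul_star hU hφ f hf h2, e, ρ.seminorm_smul, Complex.norm_real,
    Real.norm_of_nonneg (by positivity)] at h3
  have h4 := hw.seminorm_toCc_le_one ρ
  refine abs_le_of_sq_le_sq' ?_ hδ.le |>.2
  rw [← h3]
  exact mul_le_of_le_one_right (by positivity) h4

end EtaleGroupoid

end NormEstimates

noncomputable section RestrictionKernel

namespace EtaleGroupoid

variable {G : Type*} [TopologicalSpace G] [EtaleGroupoid G]

/-! ### Functions that are small on a closed set -/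

theorem onBis_ccSpan_univ {U : Set G} (hU : IsOpenBisection U) {φ : UnitSpace G → ℂ}
    (hφ : CcOn (rngU '' U) φ) : onBis U φ ∈ ccSpan (Set.univ : Set G) :=
  onBis_mem_ccSpan hU (Set.subset_univ _) hφ

theorem onBis_sum {ι : Type*} (s : Finset ι) (U : Set G) (φ : ι → UnitSpace G → ℂ) :
    onBis U (∑ i ∈ s, φ i) = ∑ i ∈ s, onBis U (φ i) := by
  funext g
  rw [Finset.sum_apply]
  by_cases hg : g ∈ U
  · simp only [onBis_of_mem hg, Finset.sum_apply]
  · simp only [onBis_of_notMem hg, Finset.sum_const_zero]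

/-- If a sum of `n` functions supported on bisections in `H` is bounded by `δ` on a closed set `Y`,
then it is within a multiple of `δ` of a function in `𝒞_c(H ∖ Y)`. -/
theorem exists_mem_ccSpan_diff_seminorm_le (ρ : CStarSeminorm (Cc G)) {H Y : Set G}
    (hY : IsClosed Y) (n : ℕ) :
    ∀ (δ : ℝ), 0 < δ → ∀ (U : Fin n → Set G) (φ : Fin n → UnitSpace G → ℂ),
      (∀ i, IsOpenBisection (U i)) → (∀ i, U i ⊆ H) → (∀ i, CcOn (rngU '' U i) (φ i)) →
      (∀ g ∈ Y, ‖∑ i, onBis (U i) (φ i) g‖ ≤ δ) →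
      ∃ a : Cc G, a.1 ∈ ccSpan (H \ Y) ∧ ∃ e : Cc G, ρ e ≤ (3 ^ n - 1) * δ ∧
        ∑ i, onBis (U i) (φ i) = a.1 + e.1 := by
  induction n with
  | zero =>
    intro δ _ U φ _ _ _ _
    exact ⟨0, Submodule.zero_mem _, 0, by simp [ρ.seminorm_zero], by simp⟩
  | succ n ih =>
    intro δ hδ U φ hU hUH hφ hle
    set V := U (Fin.last n) with hV
    set ψ := φ (Fin.last n) with hψ
    have hVb : IsOpenBisection V := hU _
    have hψV : CcOn (rngU '' V) ψ := hφ _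
    have h2δ : 0 < 2 * δ := by positivity
    -- The threshold `2δ` exceeds the bound `δ` of the sum on `Y`, so at a point of `Y` where `‖ψ‖ ≥
    -- 2δ` the last summand must be cancelled by another one. Hence `T`, the large part of `ψ`, can
    -- be moved away, and `ψ - T` is at most `2δ`.
    set T : UnitSpace G → ℂ := fun x => softThreshold (2 * δ) (ψ x) with hT
    have hTc : CcOn (rngU '' V) T := hψV.of_zero ((continuous_softThreshold h2δ).comp hψV.1)
      fun x hx => softThreshold_eq_zero h2δ (by rw [hx, norm_zero]; exact h2δ.le)
    -- The index `none` stands for the part of `V` off `Y`, and `some i` for the overlap of `V` with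
    -- the `i`-th earlier bisection.
    let W : Option (Fin n) → Set G := fun j => V ∩ j.elim Yᶜ (fun i => U i.castSucc)
    have hWo : ∀ j, IsOpen (W j) := by
      rintro (_ | i)
      · exact hVb.isOpen.inter hY.isOpen_compl
      · exact hVb.isOpen.inter (hU i.castSucc).isOpen
    obtain ⟨hψc, K, hK, hKV, hz⟩ := id hψV
    have hL : IsCompact (K ∩ {x | 2 * δ ≤ ‖ψ x‖}) :=
      hK.inter_right (isClosed_le continuous_const hψc.norm)
    have hcov : K ∩ {x | 2 * δ ≤ ‖ψ x‖} ⊆ ⋃ j, rngU '' W j := by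
      rintro _ ⟨hxK, hx⟩
      obtain ⟨g, hg, rfl⟩ := hKV hxK
      by_cases hgY : g ∈ Y
      -- If no earlier bisection contained `g`, the sum at `g` would be `ψ(rng g)`, of modulus at
      -- least `2δ > δ`.
      · obtain ⟨i, hi⟩ : ∃ i : Fin n, g ∈ U i.castSucc := by
          by_contra! hc
          have h1 := hle g hgY
          rw [Fin.sum_univ_castSucc, Finset.sum_eq_zero fun i _ => onBis_of_notMem (hc i),
            zero_add, onBis_of_mem hg] at h1
          have hx' : 2 * δ ≤ ‖ψ (rngU g)‖ := hx
          linarith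
        exact Set.mem_iUnion.2 ⟨some i, g, ⟨hg, hi⟩, rfl⟩
      · exact Set.mem_iUnion.2 ⟨none, g, ⟨hg, hgY⟩, rfl⟩
    obtain ⟨χ, hχ, hχ1⟩ := exists_ccOn_sum_one hL (fun j => isOpen_image_rngU (hWo j)) hcov
    have hχT : ∀ j, CcOn (rngU '' W j) (χ j * T) := fun j =>
      (hχ j).of_zero ((hχ j).1.mul hTc.1) fun x hx => by simp [hx]
    have hTsum : T = ∑ j, χ j * T := by
      funext x
      rw [Finset.sum_apply]
      simp only [Pi.mul_apply]
      rw [← Finset.sum_mul]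
      by_cases hx : x ∈ K ∩ {x | 2 * δ ≤ ‖ψ x‖}
      · rw [hχ1 x hx, one_mul]
      · have : T x = 0 := by
          refine softThreshold_eq_zero h2δ ?_
          by_contra! hc
          have hxK : x ∉ K := fun h => hx ⟨h, hc.le⟩
          rw [hz x hxK, norm_zero] at hc
          linarith
        rw [this, mul_zero]
    have hR : CcOn (rngU '' V) (ψ - T) := hψV.of_zero (hψc.sub hTc.1) fun x hx => by
      have : T x = 0 := softThreshold_eq_zero h2δ (by rw [hx, norm_zero]; exact h2δ.le)
      simp [hx, this]
    -- A function supported over an overlap `V ∩ U i` is the same function on `G` whether it is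
    -- viewed on `V` or on `U i`; so the last bisection is absorbed by the others.
    have hsplit : onBis V ψ = onBis V (ψ - T) + onBis (W none) (χ none * T) +
        ∑ i : Fin n, onBis (U i.castSucc) (χ (some i) * T) := by
      have h1 : ψ = (ψ - T) + ∑ j, χ j * T := by rw [← hTsum, sub_add_cancel]
      have h2 : ∀ i : Fin n, onBis V (χ (some i) * T) = onBis (U i.castSucc) (χ (some i) * T) :=
        fun i => (onBis_eq_of_subset hVb Set.inter_subset_left (hχT (some i))).trans
          (onBis_eq_of_subset (hU i.castSucc) Set.inter_subset_right (hχT (some i))).symm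
      conv_lhs => rw [h1]
      rw [onBis_add, onBis_sum, Fintype.sum_option,
        onBis_eq_of_subset hVb Set.inter_subset_left (hχT none),
        Finset.sum_congr rfl fun i _ => h2 i, add_assoc]
    have hWb : IsOpenBisection (W none) := hVb.mono (hWo none) Set.inter_subset_left
    have hφ' : ∀ i : Fin n, CcOn (rngU '' U i.castSucc) (φ i.castSucc + χ (some i) * T) :=
      fun i => (hφ _).add ((hχT (some i)).mono (Set.image_mono Set.inter_subset_right))
    have htotal : ∑ i, onBis (U i) (φ i) =
        ∑ i : Fin n, onBis (U i.castSucc) (φ i.castSucc + χ (some i) * T) +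
          onBis (W none) (χ none * T) + onBis V (ψ - T) := by
      rw [Fin.sum_univ_castSucc, ← hV, ← hψ, hsplit]
      simp only [onBis_add, Finset.sum_add_distrib]
      abel
    have hRle : ∀ x, ‖(ψ - T) x‖ ≤ 2 * δ := fun x => norm_sub_softThreshold_le h2δ _
    -- On `Y` the modified earlier summands add up to the old sum minus `ψ - T`, since the piece on
    -- `W none` vanishes there. Their bound is `δ + 2δ`.
    obtain ⟨a, ha, e, he, hae⟩ := ih (3 * δ) (by positivity) (fun i => U i.castSucc)
      (fun i => φ i.castSucc + χ (some i) * T) (fun i => hU _) (fun i => hUH _) hφ' (by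
        intro g hg
        have h1 := congrFun htotal g
        have h2 : onBis (W none) (χ none * T) g = 0 := onBis_of_notMem fun h => h.2 hg
        have h3 : ‖onBis V (ψ - T) g‖ ≤ 2 * δ := by
          by_cases hgV : g ∈ V
          · rw [onBis_of_mem hgV]
            exact hRle _
          · rw [onBis_of_notMem hgV, norm_zero]
            exact h2δ.le
        simp only [Pi.add_apply, Finset.sum_apply, h2, add_zero] at h1
        rw [← sub_eq_iff_eq_add] at h1
        rw [← h1]
        have h4 := hle g hg
        have := norm_sub_le (∑ i, onBis (U i) (φ i) g) (onBis V (ψ - T) g)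
        linarith)
    refine ⟨a + (⟨_, onBis_ccSpan_univ hWb (hχT none)⟩ : Cc G), Submodule.add_mem _ ha
      (onBis_mem_ccSpan (H := H \ Y) hWb (fun g hg => ⟨hUH _ hg.1, hg.2⟩) (hχT none)),
      e + (⟨_, onBis_ccSpan_univ hVb hR⟩ : Cc G), ?_, ?_⟩
    -- The errors add up to `(3 ^ n - 1) * 3δ + 2δ = (3 ^ (n + 1) - 1) * δ`.
    · have h5 := seminorm_le_of_onBis ρ hVb hR ⟨_, onBis_ccSpan_univ hVb hR⟩ rfl h2δ hRle
      refine (ρ.seminorm_add_le _ _).trans ?_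
      rw [pow_succ]
      linarith
    · rw [htotal, hae]
      change a.1 + e.1 + onBis (W none) _ + onBis V _ = a.1 + onBis (W none) _ + (e.1 + onBis V _)
      abel

theorem exists_eq_sum_onBis {H : Set G} {f : G → ℂ} (hf : f ∈ ccSpan H) :
    ∃ (n : ℕ) (U : Fin n → Set G) (φ : Fin n → UnitSpace G → ℂ),
      (∀ i, IsOpenBisection (U i)) ∧ (∀ i, U i ⊆ H) ∧ (∀ i, CcOn (rngU '' U i) (φ i)) ∧
      f = ∑ i, onBis (U i) (φ i) := by
  induction hf using Submodule.span_induction with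
  | mem f hf =>
    obtain ⟨U, hU, hUH, hfU⟩ := hf
    obtain ⟨φ, hφ, e⟩ := hfU.exists_onBis hU
    exact ⟨1, fun _ => U, fun _ => φ, fun _ => hU, fun _ => hUH, fun _ => hφ, by simpa using e⟩
  | zero => exact ⟨0, fun _ => ∅, fun _ => 0, fun i => i.elim0, fun i => i.elim0,
      fun i => i.elim0, by simp⟩
  | add f k _ _ hf hk =>
    obtain ⟨n, U, φ, hU, hUH, hφ, rfl⟩ := hf
    obtain ⟨m, V, ψ, hV, hVH, hψ, rfl⟩ := hk
    refine ⟨n + m, Fin.append U V, Fin.append φ ψ, fun i => ?_, fun i => ?_, fun i => ?_, ?_⟩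
    · refine Fin.addCases (fun i => ?_) (fun i => ?_) i
      · rw [Fin.append_left]; exact hU i
      · rw [Fin.append_right]; exact hV i
    · refine Fin.addCases (fun i => ?_) (fun i => ?_) i
      · rw [Fin.append_left]; exact hUH i
      · rw [Fin.append_right]; exact hVH i
    · refine Fin.addCases (fun i => ?_) (fun i => ?_) i
      · rw [Fin.append_left, Fin.append_left]; exact hφ i
      · rw [Fin.append_right, Fin.append_right]; exact hψ i
    · simp [Fin.sum_univ_add]
  | smul c f _ hf =>
    obtain ⟨n, U, φ, hU, hUH, hφ, rfl⟩ := hf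
    refine ⟨n, U, fun i => c • φ i, hU, hUH, fun i => (hφ i).of_zero ((hφ i).1.const_smul c)
      fun x hx => by simp [hx], ?_⟩
    rw [Finset.smul_sum]
    exact Finset.sum_congr rfl fun i _ => (Set.indicator_const_smul (U i) c (φ i ∘ rngU)).symm

/-- Functions in `𝒞_c(H)` vanishing on a closed set `Y` are limits of functions in
`𝒞_c(H ∖ Y)`. -/
theorem exists_mem_ccSpan_diff_seminorm_sub_le (ρ : CStarSeminorm (Cc G)) {H Y : Set G}
    (hY : IsClosed Y) {f : Cc G} (hf : f.1 ∈ ccSpan H) (h0 : ∀ g ∈ Y, f.1 g = 0)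
    {ε : ℝ} (hε : 0 < ε) : ∃ a : Cc G, a.1 ∈ ccSpan (H \ Y) ∧ ρ (f - a) ≤ ε := by
  obtain ⟨n, U, φ, hU, hUH, hφ, e⟩ := exists_eq_sum_onBis hf
  have h3 : (0 : ℝ) < 3 ^ n := by positivity
  -- As `f` vanishes on `Y`, any positive bound is available there; since `n` is fixed first, the
  -- factor `3 ^ n` is harmless.
  obtain ⟨a, ha, d, hd, hs⟩ := exists_mem_ccSpan_diff_seminorm_le ρ hY n (ε / 3 ^ n)
    (by positivity) U φ hU hUH hφ fun g hg => by
      rw [← Finset.sum_apply, ← e, h0 g hg, norm_zero]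
      positivity
  refine ⟨a, ha, ?_⟩
  have : f - a = d := Subtype.ext (by
    change f.1 - a.1 = d.1
    rw [e, hs, add_sub_cancel_left])
  rw [this]
  refine hd.trans ?_
  rw [sub_mul, one_mul, mul_div_cancel₀ _ h3.ne']
  have : 0 ≤ ε / 3 ^ n := by positivity
  linarith

/-! ### Cutoff functions as units on the kernel of the restriction -/

variable {X : ClosedLocInv G} {H : Set G}

/-- By invariance, an arrow of `H` with one end in `X` belongs to `G|_X`. So the compact supports in
`H ∖ G|_X` have both their ranges and their sources off `X`. -/
theorem IsLocalGroupoid.exists_compact_support (hH : IsLocalGroupoid X H) {f : G → ℂ}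
    (hf : f ∈ ccSpan (H \ reductionSet X.carrier)) :
    ∃ C : Set (UnitSpace G), IsCompact C ∧ C ⊆ X.carrierᶜ ∧
      ∀ g, f g ≠ 0 → rngU g ∈ C ∧ srcU g ∈ C := by
  induction hf using Submodule.span_induction with
  | mem f hf =>
    obtain ⟨U, hU, hUH, -, K, hK, hKU, hz⟩ := hf
    refine ⟨rngU '' K ∪ srcU '' K, (hK.image continuous_rngU).union (hK.image continuous_srcU),
      ?_, fun g hg => ?_⟩
    · rintro _ (⟨g, hg, rfl⟩ | ⟨g, hg, rfl⟩) hX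
      · exact (hUH (hKU hg)).2 (hH.mem_reductionSet_of_rng (hUH (hKU hg)).1 hX)
      · exact (hUH (hKU hg)).2 (hH.mem_reductionSet_of_src (hUH (hKU hg)).1 hX)
    · have hgK : g ∈ K := by
        by_contra hc
        exact hg (hz g hc)
      exact ⟨Or.inl ⟨g, hgK, rfl⟩, Or.inr ⟨g, hgK, rfl⟩⟩
  | zero => exact ⟨∅, isCompact_empty, Set.empty_subset _, fun g hg => (hg rfl).elim⟩
  | add f k _ _ hf hk =>
    obtain ⟨C, hC, hCX, hf⟩ := hf
    obtain ⟨D, hD, hDX, hk⟩ := hk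
    refine ⟨C ∪ D, hC.union hD, Set.union_subset hCX hDX, fun g hg => ?_⟩
    by_cases h : f g = 0
    · have := hk g fun h' => hg (by simp [h, h'])
      exact ⟨Or.inr this.1, Or.inr this.2⟩
    · have := hf g h
      exact ⟨Or.inl this.1, Or.inl this.2⟩
  | smul c f _ hf =>
    obtain ⟨C, hC, hCX, hf⟩ := hf
    exact ⟨C, hC, hCX, fun g hg => hf g fun h => hg (by simp [h])⟩

theorem exists_isCutoff {C : Set (UnitSpace G)} (hC : IsCompact C) (hCX : C ⊆ X.carrierᶜ) :
    ∃ w, IsCutoff X.carrierᶜ w ∧ ∀ x ∈ C, w x = 1 := by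
  obtain ⟨w, h1, h2, h3⟩ := exists_ccOn_one hC X.isClosed.isOpen_compl hCX
  exact ⟨w, ⟨fun x => (h1 x).1, fun x => (h1 x).2, h2⟩, h3⟩

theorem IsLocalGroupoid.exists_isCutoff_mul_eq (hH : IsLocalGroupoid X H) {a : Cc G}
    (ha : a.1 ∈ ccSpan (H \ reductionSet X.carrier)) :
    ∃ w, ∃ hw : IsCutoff X.carrierᶜ w, hw.toCc * a = a ∧ a * hw.toCc = a := by
  obtain ⟨C, hC, hCX, hsupp⟩ := hH.exists_compact_support ha
  obtain ⟨w, hw, hw1⟩ := exists_isCutoff hC hCX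
  refine ⟨w, hw, Subtype.ext (funext fun g => ?_), Subtype.ext (funext fun g => ?_)⟩
  · rw [hw.toCc_mul_apply]
    by_cases h : a.1 g = 0
    · rw [h, mul_zero]
    · rw [hw1 _ (hsupp g h).1, Complex.ofReal_one, one_mul]
  · rw [hw.mul_toCc_apply]
    by_cases h : a.1 g = 0
    · rw [h, zero_mul]
    · rw [hw1 _ (hsupp g h).2, Complex.ofReal_one, mul_one]

/-- Every element of the kernel of the restriction on `𝒞_c(H)` is approximated by elements on
which some cutoff function acts as a unit. -/
theorem IsLocalGroupoid.exists_approx_of_restrict_eq_zero (hH : IsLocalGroupoid X H)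
    (ρ : CStarSeminorm (Cc G)) {f : Cc G} (hf : f.1 ∈ ccSpan H) (h0 : restrict X f = 0)
    {ε : ℝ} (hε : 0 < ε) :
    ∃ a : Cc G, ρ (f - a) ≤ ε ∧
      ∃ w, ∃ hw : IsCutoff X.carrierᶜ w, hw.toCc * a = a ∧ a * hw.toCc = a := by
  obtain ⟨a, ha, hfa⟩ := exists_mem_ccSpan_diff_seminorm_sub_le ρ
    (Reduction.isClosed_reductionSet (X := X)) hf (restrict_eq_zero_iff.1 h0) hε
  exact ⟨a, hfa, hH.exists_isCutoff_mul_eq ha⟩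

end EtaleGroupoid

end RestrictionKernel

noncomputable section QuotientSeminorm

/-! ### A criterion for compressibility -/

/-- The compressing element is `φ = 1 - w`, which `η` maps to `1` because `η w = 0`. Since `w` is
self-adjoint, `φ⋆ a φ` expands inside `A` to the displayed element. -/
theorem isCompressibleTo_of_cutoff {A B : Type*} [NonUnitalNormedRing A] [StarRing A]
    [CStarRing A] [NormedSpace ℂ A] [IsScalarTower ℂ A A] [SMulCommClass ℂ A A] [StarModule ℂ A]
    [NonUnitalRing B] [StarRing B] [Module ℂ B] {η : A →ₗ[ℂ] B}
    {C : NonUnitalStarSubalgebra ℂ A} (hmul : ∀ c ∈ C, ∀ d ∈ C, η (c * d) = η c * η d)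
    (hstar : ∀ c ∈ C, η (star c) = star (η c))
    (h : ∀ a : A, ∀ ε : ℝ, 0 < ε → ∃ w ∈ C, star w = w ∧ (∀ x, ‖x - w * x‖ ≤ ‖x‖) ∧ η w = 0 ∧
      ∃ c ∈ C, η a = η c ∧ ‖(a - w * a) - (a - w * a) * w - c‖ ≤ ε) :
    IsCompressibleTo η C := by
  refine ⟨hmul, hstar, fun a ε hε => ?_⟩
  obtain ⟨w, hwC, hws, hw1, hηw, c, hcC, hac, hle⟩ := h a ε hε
  have hφs : star (1 + ((-w : A) : Unitization ℂ A)) = 1 + ((-w : A) : Unitization ℂ A) :=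
    Unitization.ext (by simp) (by simp [hws])
  refine ⟨1 + ((-w : A) : Unitization ℂ A), by simpa using hwC, c, hcC, ?_, ?_, hac, ?_⟩
  -- The norm of the unitization is the maximum of the modulus of the scalar part, here `1`, and the
  -- operator norm of left multiplication; the latter is at most `1` by the assumption on `x - w *
  -- x`.
  · rw [Unitization.norm_eq_sup]
    refine sup_le (by simp) (ContinuousLinearMap.opNorm_le_bound _ zero_le_one fun x => ?_)
    have : (algebraMap ℂ (A →L[ℂ] A) (1 + ((-w : A) : Unitization ℂ A)).fst +
        ContinuousLinearMap.mul ℂ A (1 + ((-w : A) : Unitization ℂ A)).snd) x = x - w * x := by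
      simp [sub_eq_add_neg]
    rw [this, one_mul]
    exact hw1 x
  · simp [hηw]
  · have : star (1 + ((-w : A) : Unitization ℂ A)) * (a : Unitization ℂ A) *
        (1 + ((-w : A) : Unitization ℂ A)) - (c : Unitization ℂ A) =
        (((a - w * a) - (a - w * a) * w - c : A) : Unitization ℂ A) := by
      rw [hφs, add_mul, one_mul, mul_add, mul_one]
      simp only [← Unitization.inr_mul, ← Unitization.inr_add, ← Unitization.inr_sub]
      congr 1
      noncomm_ring
    rw [this, Unitization.norm_inr]
    exact hle

theorem le_of_forall_gt_le_of_continuous {F : ℝ → ℝ} (hF : Continuous F) {x y : ℝ}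
    (h : ∀ t, y < t → x ≤ F t) : x ≤ F y :=
  ge_of_tendsto ((hF.tendsto y).mono_left nhdsWithin_le_nhds)
    (eventually_nhdsWithin_of_forall (s := Set.Ioi y) h)

namespace EtaleGroupoid

variable {G : Type*} [TopologicalSpace G] [EtaleGroupoid G] {X : ClosedLocInv G} {H : Set G}

/-! ### Cutting down by cutoff functions off `X` -/

theorem IsCutoff.eq_zero_of_mem {w : UnitSpace G → ℝ} (hw : IsCutoff X.carrierᶜ w)
    {x : UnitSpace G} (hx : x ∈ X.carrier) : w x = 0 := by
  exact_mod_cast hw.ccOn.eq_zero (fun h => h hx)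

theorem IsCutoff.restrict_toCc {w : UnitSpace G → ℝ} (hw : IsCutoff X.carrierᶜ w) :
    restrict X hw.toCc = 0 := by
  rw [restrict_eq_zero_iff]
  intro g hg
  rw [hw.coe_toCc]
  by_cases hu : g ∈ units G
  · rw [onBis_of_mem hu, hw.eq_zero_of_mem hg.1, Complex.ofReal_zero]
  · exact onBis_of_notMem hu

theorem IsCutoff.restrict_sub_mul {w : UnitSpace G → ℝ} (hw : IsCutoff X.carrierᶜ w) (a : Cc G) :
    restrict X (a - hw.toCc * a) = restrict X a := by
  rw [map_sub, sub_eq_self, restrict_eq_zero_iff]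
  intro g hg
  rw [hw.toCc_mul_apply, hw.eq_zero_of_mem hg.1, Complex.ofReal_zero, zero_mul]

theorem IsCutoff.restrict_sub_mul' {w : UnitSpace G → ℝ} (hw : IsCutoff X.carrierᶜ w) (a : Cc G) :
    restrict X (a - a * hw.toCc) = restrict X a := by
  rw [map_sub, sub_eq_self, restrict_eq_zero_iff]
  intro g hg
  rw [hw.mul_toCc_apply, hw.eq_zero_of_mem hg.2, Complex.ofReal_zero, mul_zero]

theorem IsCutoff.toCc_mem_ccSpan {O : Set (UnitSpace G)} {w : UnitSpace G → ℝ}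
    (hw : IsCutoff O w) (hH : units G ⊆ H) : hw.toCc.1 ∈ ccSpan H :=
  onBis_mem_ccSpan isOpenBisection_units hH (by rw [image_rngU_units]; exact hw.ccOn_univ)

theorem exists_isCutoff_cut_mem_ccSpan (hH : IsOpen H) (hXH : reductionSet X.carrier ⊆ H)
    (a : Cc G) : ∃ w, ∃ hw : IsCutoff X.carrierᶜ w,
      ((a - hw.toCc * a) - (a - hw.toCc * a) * hw.toCc).1 ∈ ccSpan H := by
  obtain ⟨C, hC, hCX, h⟩ := exists_compact_cut_mem_ccSpan hH hXH a.2
  obtain ⟨w, hw, hw1⟩ := exists_isCutoff hC hCX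
  refine ⟨w, hw, (congrArg (· ∈ ccSpan H) (funext fun g => ?_)).mp
    (h (fun x => w x) hw.ccOn.1 fun x hx => by rw [hw1 x hx, Complex.ofReal_one])⟩
  change _ = (a - hw.toCc * a).1 g - ((a - hw.toCc * a) * hw.toCc).1 g
  rw [hw.mul_toCc_apply]
  have : (a - hw.toCc * a).1 g = a.1 g - (hw.toCc * a).1 g := rfl
  rw [this, hw.toCc_mul_apply]
  ring

/-! ### The quotient seminorm -/

variable (X) in
/-- The quotient seminorm on `𝒞_c(G|_X)` induced by a seminorm on `𝒞_c(G)`. -/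
def restrictNorm (ρ : CStarSeminorm (Cc G)) (b : Cc (Reduction X)) : ℝ :=
  sInf {t : ℝ | ∃ a : Cc G, restrict X a = b ∧ ρ a = t}

theorem isGLB_restrictNorm (ρ : CStarSeminorm (Cc G)) (b : Cc (Reduction X)) :
    IsGLB {t : ℝ | ∃ a : Cc G, restrict X a = b ∧ ρ a = t} (restrictNorm X ρ b) := by
  refine isGLB_csInf ?_ ⟨0, ?_⟩
  · obtain ⟨a, -, ha⟩ := (isLocalGroupoid_localGroupoid X).exists_restrict_eq b
    exact ⟨ρ a, a, ha, rfl⟩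
  · rintro _ ⟨a, -, rfl⟩
    exact ρ.seminorm_nonneg a

theorem restrictNorm_restrict_le (ρ : CStarSeminorm (Cc G)) (a : Cc G) :
    restrictNorm X ρ (restrict X a) ≤ ρ a :=
  (isGLB_restrictNorm ρ _).1 ⟨a, rfl, rfl⟩

/-- The witness is `(1-w)a(1-w)`. Consequently infima over lifts in `𝒞_c(G)` and over lifts in
`𝒞_c(H)` agree, for every local groupoid `H`. -/
theorem IsLocalGroupoid.exists_seminorm_le (hH : IsLocalGroupoid X H) (ρ : CStarSeminorm (Cc G))
    (a : Cc G) : ∃ c : Cc G, c.1 ∈ ccSpan H ∧ restrict X c = restrict X a ∧ ρ c ≤ ρ a := by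
  obtain ⟨w, hw, h⟩ := exists_isCutoff_cut_mem_ccSpan hH.isOpen hH.reduction_subset a
  exact ⟨_, h, by rw [hw.restrict_sub_mul', hw.restrict_sub_mul],
    (hw.seminorm_sub_mul_le' ρ _).trans (hw.seminorm_sub_mul_le ρ a)⟩

theorem IsLocalGroupoid.exists_restrict_eq_lt (hH : IsLocalGroupoid X H)
    (ρ : CStarSeminorm (Cc G)) {b : Cc (Reduction X)} {t : ℝ} (ht : restrictNorm X ρ b < t) :
    ∃ a : Cc G, a.1 ∈ ccSpan H ∧ restrict X a = b ∧ ρ a < t := by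
  obtain ⟨_, ⟨a, rfl, rfl⟩, -, hat⟩ := (isGLB_restrictNorm ρ b).exists_between ht
  obtain ⟨c, hc, hca, hle⟩ := hH.exists_seminorm_le ρ a
  exact ⟨c, hc, hca, hle.trans_lt hat⟩

theorem IsLocalGroupoid.isGLB_restrictNorm (hH : IsLocalGroupoid X H) (ρ : CStarSeminorm (Cc G))
    (b : Cc (Reduction X)) :
    IsGLB {t : ℝ | ∃ a ∈ ccSub H hH.toIsOpenSubgroupoid, restrict X a = b ∧ ρ a = t}
      (restrictNorm X ρ b) := by
  constructor
  · rintro _ ⟨a, -, rfl, rfl⟩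
    exact restrictNorm_restrict_le ρ a
  · intro t ht
    by_contra! hc
    obtain ⟨a, ha, hab, hlt⟩ := hH.exists_restrict_eq_lt ρ hc
    exact absurd (ht ⟨a, ha, hab, rfl⟩) (not_le.2 hlt)

theorem restrictNorm_add_le (ρ : CStarSeminorm (Cc G)) (b c : Cc (Reduction X)) :
    restrictNorm X ρ (b + c) ≤ restrictNorm X ρ b + restrictNorm X ρ c := by
  refine le_of_forall_gt_le_of_continuous (F := fun s => s + restrictNorm X ρ c) (by fun_prop)
    fun s hs => le_of_forall_gt_le_of_continuous (F := fun t => s + t) (by fun_prop) fun t ht => ?_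
  obtain ⟨a, -, rfl, ha⟩ := (isLocalGroupoid_localGroupoid X).exists_restrict_eq_lt ρ hs
  obtain ⟨d, -, rfl, hd⟩ := (isLocalGroupoid_localGroupoid X).exists_restrict_eq_lt ρ ht
  rw [← map_add]
  exact (restrictNorm_restrict_le ρ _).trans ((ρ.seminorm_add_le a d).trans (add_le_add ha.le hd.le))

theorem restrictNorm_smul_le (ρ : CStarSeminorm (Cc G)) (z : ℂ) (b : Cc (Reduction X)) :
    restrictNorm X ρ (z • b) ≤ ‖z‖ * restrictNorm X ρ b := by
  refine le_of_forall_gt_le_of_continuous (F := fun s => ‖z‖ * s) (by fun_prop) fun s hs => ?_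
  obtain ⟨a, -, rfl, ha⟩ := (isLocalGroupoid_localGroupoid X).exists_restrict_eq_lt ρ hs
  rw [← map_smul]
  refine (restrictNorm_restrict_le ρ _).trans ?_
  rw [ρ.seminorm_smul]
  exact mul_le_mul_of_nonneg_left ha.le (norm_nonneg z)

theorem restrictNorm_nonneg (ρ : CStarSeminorm (Cc G)) (b : Cc (Reduction X)) :
    0 ≤ restrictNorm X ρ b :=
  (isGLB_restrictNorm ρ b).2 fun _ ⟨a, _, e⟩ => e ▸ ρ.seminorm_nonneg a

theorem restrictNorm_mul_le (ρ : CStarSeminorm (Cc G)) (b c : Cc (Reduction X)) :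
    restrictNorm X ρ (b * c) ≤ restrictNorm X ρ b * restrictNorm X ρ c := by
  have hH := isLocalGroupoid_localGroupoid X
  refine le_of_forall_gt_le_of_continuous (F := fun s => s * restrictNorm X ρ c) (by fun_prop)
    fun s hs => le_of_forall_gt_le_of_continuous (F := fun t => s * t) (by fun_prop) fun t ht => ?_
  obtain ⟨a, -, rfl, ha⟩ := hH.exists_restrict_eq_lt ρ hs
  -- The lift of the right factor is taken in `𝒞_c(H)`; for arbitrary lifts restriction need not be
  -- multiplicative.
  obtain ⟨d, hdH, rfl, hd⟩ := hH.exists_restrict_eq_lt ρ ht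
  rw [← hH.restrict_mul a hdH]
  exact (restrictNorm_restrict_le ρ _).trans ((ρ.seminorm_mul_le a d).trans
    (mul_le_mul ha.le hd.le (ρ.seminorm_nonneg d) ((ρ.seminorm_nonneg a).trans ha.le)))

theorem restrictNorm_star_le (ρ : CStarSeminorm (Cc G)) (b : Cc (Reduction X)) :
    restrictNorm X ρ (star b) ≤ restrictNorm X ρ b := by
  refine le_of_forall_gt_le_of_continuous (F := fun s => s) continuous_id fun s hs => ?_
  obtain ⟨a, -, rfl, ha⟩ := (isLocalGroupoid_localGroupoid X).exists_restrict_eq_lt ρ hs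
  rw [← restrict_star]
  exact (restrictNorm_restrict_le ρ _).trans (by rw [ρ.seminorm_star]; exact ha.le)

/-- Let `a` lift `b`, let `c` be a nearly optimal lift of `b⋆b`, and put `p = a⋆a`. Then `p - c` is
in the kernel, so a suitable `1 - w` nearly kills it. As `a(1-w)` still lifts `b`, the square of the
quotient norm of `b` is at most `ρ((1-w)p(1-w)) ≤ ρ(p(1-w))`, which is at most `ρ(c)` up to `ε`. -/
theorem restrictNorm_sq_le (ρ : CStarSeminorm (Cc G)) (b : Cc (Reduction X)) :
    restrictNorm X ρ b ^ 2 ≤ restrictNorm X ρ (star b * b) := by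
  have hH := isLocalGroupoid_localGroupoid X
  refine le_of_forall_gt_le_of_continuous (F := fun t => t) continuous_id fun t ht => ?_
  obtain ⟨a, haH, rfl⟩ := hH.exists_restrict_eq b
  obtain ⟨c, hcH, hc, hct⟩ := hH.exists_restrict_eq_lt ρ ht
  have hfH : (star a * a - c).1 ∈ ccSpan (localGroupoid X) :=
    Submodule.sub_mem _ (conv_mem hH.mul_mem (involution_mem hH.inv_mem haH) haH) hcH
  have hf0 : restrict X (star a * a - c) = 0 := by
    rw [map_sub, hH.restrict_mul _ haH, hc, restrict_star, sub_self]
  refine le_of_forall_pos_le_add fun ε hε => ?_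
  obtain ⟨d, hd, w, hw, -, hdw⟩ := hH.exists_approx_of_restrict_eq_zero ρ hfH hf0 hε
  set p := star a * a with hp
  -- Here `d` approximates `p - c` and satisfies `d(1-w) = 0`, so it may be subtracted before the
  -- contraction `1 - w` is applied.
  have h1 : ρ ((p - c) - (p - c) * hw.toCc) ≤ ε := by
    have : (p - c) - (p - c) * hw.toCc = (p - c - d) - (p - c - d) * hw.toCc := by
      rw [sub_mul (p - c) d, hdw]
      abel
    rw [this]
    exact (hw.seminorm_sub_mul_le' ρ _).trans hd
  have h2 : ρ (p - p * hw.toCc) ≤ t + ε := by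
    have : p - p * hw.toCc = (c - c * hw.toCc) + ((p - c) - (p - c) * hw.toCc) := by
      rw [sub_mul]
      abel
    rw [this]
    exact (ρ.seminorm_add_le _ _).trans
      (add_le_add ((hw.seminorm_sub_mul_le' ρ c).trans hct.le) h1)
  have h3 : star (a - a * hw.toCc) * (a - a * hw.toCc) =
      (p - p * hw.toCc) - hw.toCc * (p - p * hw.toCc) := by
    rw [star_sub, star_mul, hw.star_toCc, hp]
    simp only [sub_mul, mul_sub, mul_assoc]
    abel
  have h4 : restrictNorm X ρ (restrict X a) ≤ ρ (a - a * hw.toCc) := by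
    have := restrictNorm_restrict_le (X := X) ρ (a - a * hw.toCc)
    rwa [hw.restrict_sub_mul'] at this
  calc restrictNorm X ρ (restrict X a) ^ 2 ≤ ρ (a - a * hw.toCc) ^ 2 :=
        pow_le_pow_left₀ (restrictNorm_nonneg ρ _) h4 2
    _ = ρ ((p - p * hw.toCc) - hw.toCc * (p - p * hw.toCc)) := by rw [← ρ.star_mul_self, h3]
    _ ≤ ρ (p - p * hw.toCc) := hw.seminorm_sub_mul_le ρ _
    _ ≤ t + ε := h2

variable (X) in
/-- The C*-seminorm `ρ(X)` on `𝒞_c(G|_X)`. -/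
def restrictSeminorm (ρ : CStarSeminorm (Cc G)) : CStarSeminorm (Cc (Reduction X)) where
  toSeminorm := Seminorm.ofSMulLE (restrictNorm X ρ)
    (le_antisymm (by
      have := restrictNorm_restrict_le (X := X) ρ 0
      rwa [map_zero, ρ.seminorm_zero] at this) (restrictNorm_nonneg ρ 0))
    (restrictNorm_add_le ρ) (restrictNorm_smul_le ρ)
  mul_le_mul' := restrictNorm_mul_le ρ
  star_mul_self' b := by
    refine le_antisymm ((restrictNorm_mul_le ρ _ _).trans ?_) (restrictNorm_sq_le ρ b)
    rw [sq]
    exact mul_le_mul_of_nonneg_right (restrictNorm_star_le ρ b) (restrictNorm_nonneg ρ b)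

theorem restrictSeminorm_apply (ρ : CStarSeminorm (Cc G)) (b : Cc (Reduction X)) :
    restrictSeminorm X ρ b = restrictNorm X ρ b := rfl

theorem isNorm_restrictSeminorm (ρ : CStarSeminorm (Cc G))
    (h : ∀ g ∈ reductionSet X.carrier, ∃ M : ℝ, ∀ f : Cc G, ‖f.1 g‖ ≤ M * ρ f) :
    (restrictSeminorm X ρ).IsNorm where
  eq_zero b hb := by
    rw [restrictSeminorm_apply] at hb
    refine Subtype.ext (funext fun g => ?_)
    obtain ⟨M, hM⟩ := h g.val ⟨g.rngU_mem, g.srcU_mem⟩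
    -- Every lift of `b` has the value `b(g)` at `g`, and there are lifts of arbitrarily small norm.
    -- The absolute value is there because `M` is not assumed to be nonnegative.
    have hle : ‖b.1 g‖ ≤ |M| * 0 := by
      refine le_of_forall_gt_le_of_continuous (F := fun t => |M| * t) (by fun_prop) fun t ht => ?_
      obtain ⟨a, -, rfl, ha⟩ :=
        (isLocalGroupoid_localGroupoid X).exists_restrict_eq_lt ρ (hb.trans_lt ht)
      exact (hM a).trans (mul_le_mul (le_abs_self M) ha.le (ρ.seminorm_nonneg a) (abs_nonneg M))
    rw [mul_zero] at hle
    exact norm_le_zero_iff.1 hle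

/-! ### Approximate units -/

theorem IsCutoff.toCc_mem_ccOff {w : UnitSpace G → ℝ} (hw : IsCutoff X.carrierᶜ w) :
    hw.toCc ∈ ccOff X := by
  have hsub : {x : G | x ∈ units G ∧ rngU x ∉ X.carrier} ⊆ units G := fun x hx => hx.1
  have hbis : IsOpenBisection {x : G | x ∈ units G ∧ rngU x ∉ X.carrier} :=
    isOpenBisection_units.mono
      (isOpen_units.inter (X.isClosed.isOpen_compl.preimage continuous_rngU)) hsub
  have hcc : CcOn (rngU '' {x : G | x ∈ units G ∧ rngU x ∉ X.carrier}) fun x => (w x : ℂ) :=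
    hw.ccOn.mono fun x hx => ⟨x, ⟨x.2, by rwa [rngU_unit]⟩, rngU_unit x⟩
  change MemCc _ hw.toCc.1
  rw [hw.coe_toCc, onBis_eq_of_subset isOpenBisection_units hsub hcc]
  exact memCc_onBis hbis hcc

/-- This makes the members of an approximate unit of `C_c(G⁰ ∖ X)` cutoff functions, so that the
contraction estimates for `1 - w` apply to them. -/
theorem exists_eq_toCc {u : Cc G} (hu : u ∈ ccOff X)
    (h01 : ∀ x : UnitSpace G, ∃ t : ℝ, 0 ≤ t ∧ t ≤ 1 ∧ u.1 x = t) :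
    ∃ w, ∃ hw : IsCutoff X.carrierᶜ w, u = hw.toCc := by
  have hsub : {x : G | x ∈ units G ∧ rngU x ∉ X.carrier} ⊆ units G := fun x hx => hx.1
  have hbis : IsOpenBisection {x : G | x ∈ units G ∧ rngU x ∉ X.carrier} :=
    isOpenBisection_units.mono
      (isOpen_units.inter (X.isClosed.isOpen_compl.preimage continuous_rngU)) hsub
  obtain ⟨φ, hφ, e⟩ := MemCc.exists_onBis hbis hu
  rw [← onBis_eq_of_subset isOpenBisection_units hsub hφ] at e
  have hval : ∀ x : UnitSpace G, u.1 x = φ x := fun x => by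
    rw [e, onBis_of_mem (U := units G) x.2, rngU_unit]
  choose w hw0 hw1 hwe using h01
  have hwφ : (fun x => (w x : ℂ)) = φ := funext fun x => by rw [← hwe, hval]
  refine ⟨w, ⟨hw0, hw1, ?_⟩, Subtype.ext ?_⟩
  · rw [hwφ]
    refine hφ.mono ?_
    rintro _ ⟨x, hx, rfl⟩
    exact hx.2
  · exact e.trans (congrArg _ hwφ.symm)

variable {I : Type*} [Preorder I] {u : I → Cc G}

theorem IsApproxUnitOff.exists_isCutoff (hu : IsApproxUnitOff X u) (i : I) :
    ∃ w, ∃ hw : IsCutoff X.carrierᶜ w, u i = hw.toCc :=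
  exists_eq_toCc (hu.mem i) (hu.nonneg_le_one i)

theorem IsApproxUnitOff.star_eq (hu : IsApproxUnitOff X u) (i : I) : star (u i) = u i := by
  obtain ⟨w, hw, e⟩ := hu.exists_isCutoff i
  rw [e, hw.star_toCc]

/-- Uniform convergence on the unit space implies convergence for `ρ`, because the units form an
open bisection. -/
theorem IsApproxUnitOff.eventually_toCc (hu : IsApproxUnitOff X u) (ρ : CStarSeminorm (Cc G))
    {w : UnitSpace G → ℝ} (hw : IsCutoff X.carrierᶜ w) {ε : ℝ} (hε : 0 < ε) :
    ∀ᶠ i in atTop, ρ (hw.toCc - u i * hw.toCc) ≤ ε := by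
  filter_upwards [hu.tendsto _ hw.toCc_mem_ccOff ε hε] with i hi
  obtain ⟨v, hv, e⟩ := hu.exists_isCutoff i
  have hc : CcOn Set.univ fun x => ((w x : ℂ) - v x * w x) :=
    hw.ccOn_univ.of_zero (hw.ccOn.1.sub (hv.ccOn.1.mul hw.ccOn.1)) fun x hx => by
      rw [hx, mul_zero, sub_zero]
  refine seminorm_le_of_onBis ρ isOpenBisection_units (φ := fun x => ((w x : ℂ) - v x * w x))
    (by rwa [image_rngU_units]) _ (funext fun g => ?_) hε fun x => ?_
  · change hw.toCc.1 g - (u i * hw.toCc).1 g = _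
    rw [e, hv.toCc_mul_apply, hw.coe_toCc]
    by_cases hg : g ∈ units G
    · simp only [onBis_of_mem hg]
    · simp only [onBis_of_notMem hg, mul_zero, sub_zero]
  · have := hi x
    rw [e] at this
    have h1 : hv.toCc.1 x = v x := ccUnit_apply_unit _ x
    have h2 : hw.toCc.1 x = w x := ccUnit_apply_unit _ x
    rwa [h1, h2, norm_sub_rev] at this

/-- Approximate `f` by some `a = w * a`. Then `(1 - u i)f = (1 - u i)(f - a) + (w - u i * w)a`: the
first term is small because `1 - u i` is a contraction, the second because `u i * w → w`. -/
theorem IsApproxUnitOff.eventually_sub_mul_le (hu : IsApproxUnitOff X u)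
    (hH : IsLocalGroupoid X H) (ρ : CStarSeminorm (Cc G)) {f : Cc G} (hf : f.1 ∈ ccSpan H)
    (h0 : restrict X f = 0) {ε : ℝ} (hε : 0 < ε) :
    ∀ᶠ i in atTop, ρ (f - u i * f) ≤ ε := by
  obtain ⟨a, ha, w, hw, hwa, -⟩ := hH.exists_approx_of_restrict_eq_zero ρ hf h0 (half_pos hε)
  -- The added `1` keeps the divisor positive when `ρ a = 0`.
  have ha1 : 0 < ρ a + 1 := by have := ρ.seminorm_nonneg a; linarith
  filter_upwards [hu.eventually_toCc ρ hw (div_pos (half_pos hε) ha1)] with i hi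
  obtain ⟨v, hv, e⟩ := hu.exists_isCutoff i
  have h1 : f - u i * f = ((f - a) - u i * (f - a)) + (hw.toCc - u i * hw.toCc) * a := by
    rw [sub_mul, mul_assoc, hwa, mul_sub]
    abel
  have h2 : ρ ((f - a) - u i * (f - a)) ≤ ε / 2 := by
    rw [e]
    exact (hv.seminorm_sub_mul_le ρ _).trans ha
  have h3 : ρ ((hw.toCc - u i * hw.toCc) * a) ≤ ε / 2 := by
    refine (ρ.seminorm_mul_le _ _).trans ?_
    calc ρ (hw.toCc - u i * hw.toCc) * ρ a ≤ ε / 2 / (ρ a + 1) * (ρ a + 1) :=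
          mul_le_mul hi (by linarith) (ρ.seminorm_nonneg a) (by positivity)
      _ = ε / 2 := div_mul_cancel₀ _ ha1.ne'
  rw [h1]
  exact (ρ.seminorm_add_le _ _).trans (by linarith)

end EtaleGroupoid

end QuotientSeminorm

/-! ### Compressibility and approximate units, before and after completion -/

noncomputable section Completions

/-- For self-adjoint nets and `*`-closed sets, a left approximate unit is two-sided. -/
theorem isApproxUnitFor_of_star_eq {A : Type*} [NonUnitalNormedRing A] [StarRing A]
    [ContinuousStar A] {J : Set A} {I : Type*} [Preorder I] {u : I → A}
    (hJ : ∀ a ∈ J, star a ∈ J) (hu : ∀ i, star (u i) = u i) (mem : ∀ i, u i ∈ J)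
    (pos : ∀ i, ∃ v ∈ J, u i = star v * v) (norm_le : ∀ i, ‖u i‖ ≤ 1)
    (mul_left : ∀ a ∈ J, ∀ ε : ℝ, 0 < ε → ∀ᶠ i in atTop, ‖a - u i * a‖ ≤ ε) :
    IsApproxUnitFor J u := by
  have hleft : ∀ a ∈ J, Tendsto (fun i => u i * a) atTop (𝓝 a) := by
    intro a ha
    rw [Metric.tendsto_nhds]
    intro ε hε
    filter_upwards [mul_left a ha (ε / 2) (half_pos hε)] with i hi
    rw [dist_comm, dist_eq_norm]
    linarith
  refine ⟨mem, pos, norm_le, hleft, fun a ha => ?_⟩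
  have := (continuous_star.tendsto _).comp (hleft (star a) (hJ a ha))
  rw [star_star] at this
  refine this.congr fun i => ?_
  rw [Function.comp_apply, star_mul, star_star, hu]

namespace EtaleGroupoid

variable {G : Type*} [TopologicalSpace G] [EtaleGroupoid G] {X : ClosedLocInv G} {H : Set G}

theorem IsApproxUnitOff.exists_star_mul_self_eq {I : Type*} [Preorder I] {u : I → Cc G}
    (hu : IsApproxUnitOff X u) (i : I) :
    ∃ v, ∃ hv : IsCutoff X.carrierᶜ v, u i = star hv.toCc * hv.toCc := by
  obtain ⟨w, hw, e⟩ := hu.exists_isCutoff i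
  obtain ⟨v, hv, e'⟩ := hw.exists_star_mul_self_eq_toCc
  exact ⟨v, hv, by rw [e, e']⟩

/-! ### Before completion -/

section PreCompletion

variable (ρ : CStarSeminorm (Cc G)) [ρ.IsNorm]

theorem IsLocalGroupoid.isCompressibleTo_restrict (hH : IsLocalGroupoid X H)
    (hunits : units G ⊆ H) : IsCompressibleTo (restrict X ∘ₗ ρ.ofAlg)
      ((ccSub H hH.toIsOpenSubgroupoid).map ρ.toAlg) := by
  refine isCompressibleTo_of_cutoff ?_ ?_ ?_
  · rintro _ ⟨c, -, rfl⟩ _ ⟨d, hd, rfl⟩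
    exact hH.restrict_mul c hd
  · rintro _ ⟨c, -, rfl⟩
    exact restrict_star c
  · intro a ε hε
    obtain ⟨w, hw, hc⟩ := exists_isCutoff_cut_mem_ccSpan hH.isOpen hH.reduction_subset (ρ.ofAlg a)
    set c : Cc G := (ρ.ofAlg a - hw.toCc * ρ.ofAlg a) -
      (ρ.ofAlg a - hw.toCc * ρ.ofAlg a) * hw.toCc with hcdef
    refine ⟨ρ.toAlg hw.toCc, ⟨hw.toCc, hw.toCc_mem_ccSpan hunits, rfl⟩, hw.star_toCc,
      fun x => hw.seminorm_sub_mul_le ρ (ρ.ofAlg x), hw.restrict_toCc, ρ.toAlg c,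
      ⟨c, hc, rfl⟩, ?_, ?_⟩
    · change restrict X (ρ.ofAlg a) = restrict X c
      rw [hcdef, hw.restrict_sub_mul', hw.restrict_sub_mul]
    -- Before completion `c` is exactly `φ⋆ a φ`, so the error is zero.
    · change ρ (c - c) ≤ ε
      rw [sub_self, ρ.seminorm_zero]
      exact hε.le

theorem IsLocalGroupoid.isApproxUnitFor_ker_restrict (hH : IsLocalGroupoid X H)
    (hunits : units G ⊆ H) {I : Type*} [Preorder I] {u : I → Cc G} (hu : IsApproxUnitOff X u) :
    IsApproxUnitFor {a : ρ.Alg | a ∈ (ccSub H hH.toIsOpenSubgroupoid).map ρ.toAlg ∧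
      restrict X (ρ.ofAlg a) = 0} (fun i => ρ.toAlg (u i)) := by
  have hmem : ∀ {w} (hw : IsCutoff X.carrierᶜ w), ρ.toAlg hw.toCc ∈
      {a : ρ.Alg | a ∈ (ccSub H hH.toIsOpenSubgroupoid).map ρ.toAlg ∧
        restrict X (ρ.ofAlg a) = 0} := fun hw =>
    ⟨⟨hw.toCc, hw.toCc_mem_ccSpan hunits, rfl⟩, hw.restrict_toCc⟩
  refine isApproxUnitFor_of_star_eq ?_ (fun i => hu.star_eq i) (fun i => ?_) (fun i => ?_)
    (fun i => ?_) ?_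
  · rintro a ⟨ha, h0⟩
    refine ⟨star_mem ha, ?_⟩
    change star (restrict X (ρ.ofAlg a)) = 0
    rw [h0, star_zero]
  · obtain ⟨w, hw, e⟩ := hu.exists_isCutoff i
    rw [e]
    exact hmem hw
  · obtain ⟨v, hv, e⟩ := hu.exists_star_mul_self_eq i
    exact ⟨_, hmem hv, by rw [e]; rfl⟩
  · obtain ⟨w, hw, e⟩ := hu.exists_isCutoff i
    rw [e]
    exact hw.seminorm_toCc_le_one ρ
  · rintro _ ⟨⟨f, hf, rfl⟩, h0⟩ ε hε
    exact hu.eventually_sub_mul_le hH ρ hf h0 hε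

end PreCompletion

/-! ### The extension to the completions -/

variable (ρ : CStarSeminorm (Cc G))

variable (X) in
/-- The restriction map as a contraction into the completion. -/
def restrictL : ρ.Alg →L[ℂ] (restrictSeminorm X ρ).Completed :=
  LinearMap.mkContinuous
    ({ toFun := fun a => (restrictSeminorm X ρ).toCompleted (restrict X (ρ.ofAlg a))
       map_add' := fun a b => by rw [map_add, map_add, map_add]
       map_smul' := fun z a => by rw [map_smul, map_smul, map_smul, RingHom.id_apply] } :
      ρ.Alg →ₗ[ℂ] (restrictSeminorm X ρ).Completed) 1 fun a => by
    rw [one_mul]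
    change ‖(restrictSeminorm X ρ).toCompleted (restrict X (ρ.ofAlg a))‖ ≤ ρ (ρ.ofAlg a)
    rw [CStarSeminorm.norm_toCompleted]
    exact restrictNorm_restrict_le ρ _

variable (X) in
/-- The continuous extension `η_X` of the restriction map to the completions. -/
def restrictCompleted : ρ.Completed →L[ℂ] (restrictSeminorm X ρ).Completed :=
  (restrictL X ρ).extend ρ.coeL.toContinuousLinearMap

theorem restrictCompleted_toCompleted (a : Cc G) :
    restrictCompleted X ρ (ρ.toCompleted a) =
      (restrictSeminorm X ρ).toCompleted (restrict X a) :=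
  ContinuousLinearMap.extend_eq (restrictL X ρ) ρ.denseRange_coeL
    ρ.coeL.isometry.isUniformInducing (ρ.toAlg a)

theorem norm_restrictCompleted_apply_le (a : ρ.Completed) : ‖restrictCompleted X ρ a‖ ≤ ‖a‖ := by
  refine ρ.ind₁ (p := fun a => ‖restrictCompleted X ρ a‖ ≤ ‖a‖)
    (isClosed_le (by fun_prop) (by fun_prop)) (fun a => ?_) a
  change ‖restrictCompleted X ρ (ρ.toCompleted (ρ.ofAlg a))‖ ≤ ‖ρ.toCompleted (ρ.ofAlg a)‖
  rw [restrictCompleted_toCompleted, CStarSeminorm.norm_toCompleted, ρ.norm_toCompleted]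
  exact restrictNorm_restrict_le ρ _

theorem norm_restrictCompleted_le : ‖restrictCompleted X ρ‖ ≤ 1 :=
  ContinuousLinearMap.opNorm_le_bound _ zero_le_one fun a => by
    rw [one_mul]
    exact norm_restrictCompleted_apply_le ρ a

/-- The closure of `𝒞_c(H)` in the completion of `𝒞_c(G)`. -/
abbrev ccClosure (hH : IsOpenSubgroupoid H) : NonUnitalStarSubalgebra ℂ ρ.Completed :=
  ((ccSub H hH).map ρ.toCompleted).topologicalClosure

theorem toCompleted_mem_ccClosure (hH : IsOpenSubgroupoid H) {a : Cc G} (ha : a.1 ∈ ccSpan H) :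
    ρ.toCompleted a ∈ ccClosure ρ hH :=
  NonUnitalStarSubalgebra.le_topologicalClosure _ ⟨a, ha, rfl⟩

theorem exists_norm_sub_lt_of_mem_ccClosure (hH : IsOpenSubgroupoid H) {a : ρ.Completed}
    (ha : a ∈ ccClosure ρ hH) {ε : ℝ} (hε : 0 < ε) :
    ∃ b : Cc G, b.1 ∈ ccSpan H ∧ ‖a - ρ.toCompleted b‖ < ε := by
  obtain ⟨_, ⟨b, hb, rfl⟩, h⟩ := Metric.mem_closure_iff.1 ha ε hε
  exact ⟨b, hb, by rwa [dist_eq_norm] at h⟩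

theorem ccClosure_induction (hH : IsOpenSubgroupoid H) {p : ρ.Completed → Prop}
    (hp : IsClosed {a | p a}) (h : ∀ a : Cc G, a.1 ∈ ccSpan H → p (ρ.toCompleted a))
    {a : ρ.Completed} (ha : a ∈ ccClosure ρ hH) : p a := by
  refine closure_minimal (t := {a | p a}) ?_ hp ha
  rintro _ ⟨b, hb, rfl⟩
  exact h b hb

/-- By density, first of `𝒞_c(H)` in its closure for `d`, then of `𝒞_c(G)` for `c`; as before
completion, only the right factor has to come from `H`. -/
theorem IsLocalGroupoid.restrictCompleted_mul (hH : IsLocalGroupoid X H) {c d : ρ.Completed}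
    (hd : d ∈ ccClosure ρ hH.toIsOpenSubgroupoid) :
    restrictCompleted X ρ (c * d) = restrictCompleted X ρ c * restrictCompleted X ρ d := by
  refine ccClosure_induction ρ hH.toIsOpenSubgroupoid
    (p := fun d => restrictCompleted X ρ (c * d) =
      restrictCompleted X ρ c * restrictCompleted X ρ d)
    (isClosed_eq (by fun_prop) (by fun_prop)) (fun d hd => ?_) hd
  refine ρ.ind₁ (p := fun c => restrictCompleted X ρ (c * ρ.toCompleted d) =
      restrictCompleted X ρ c * restrictCompleted X ρ (ρ.toCompleted d))
    (isClosed_eq (by fun_prop) (by fun_prop)) (fun c => ?_) c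
  change restrictCompleted X ρ (ρ.toCompleted (ρ.ofAlg c) * ρ.toCompleted d) =
    restrictCompleted X ρ (ρ.toCompleted (ρ.ofAlg c)) * restrictCompleted X ρ (ρ.toCompleted d)
  rw [← map_mul, restrictCompleted_toCompleted, restrictCompleted_toCompleted,
    restrictCompleted_toCompleted, hH.restrict_mul _ hd, map_mul]

theorem restrictCompleted_star (c : ρ.Completed) :
    restrictCompleted X ρ (star c) = star (restrictCompleted X ρ c) := by
  refine ρ.ind₁ (p := fun c => restrictCompleted X ρ (star c) = star (restrictCompleted X ρ c))
    (isClosed_eq (by fun_prop) (by fun_prop)) (fun c => ?_) c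
  change restrictCompleted X ρ (star (ρ.toCompleted (ρ.ofAlg c))) =
    star (restrictCompleted X ρ (ρ.toCompleted (ρ.ofAlg c)))
  rw [← map_star, restrictCompleted_toCompleted, restrictCompleted_toCompleted, restrict_star,
    map_star]

/-- The restriction map on the closure of `𝒞_c(H)` is onto, with control of norms. -/
theorem IsLocalGroupoid.exists_mem_ccClosure_norm_le (hH : IsLocalGroupoid X H)
    (y : (restrictSeminorm X ρ).Completed) :
    ∃ d ∈ ccClosure ρ hH.toIsOpenSubgroupoid, restrictCompleted X ρ d = y ∧ ‖d‖ ≤ 3 * ‖y‖ := by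
  let D := (ccClosure ρ hH.toIsOpenSubgroupoid).toNonUnitalSubalgebra.toSubmodule
  have hD : IsClosed (D : Set ρ.Completed) :=
    NonUnitalStarSubalgebra.isClosed_topologicalClosure _
  have : CompleteSpace D := hD.completeSpace_coe
  let f : NormedAddGroupHom D (restrictSeminorm X ρ).Completed :=
    { toFun := fun d => restrictCompleted X ρ d
      map_add' := fun a b => map_add (restrictCompleted X ρ) (a : ρ.Completed) b
      bound' := ⟨1, fun d => by
        rw [one_mul]
        exact norm_restrictCompleted_apply_le ρ (d : ρ.Completed)⟩ }
  let K : AddSubgroup (restrictSeminorm X ρ).Completed :=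
    (AddMonoidHom.mk' (fun b => (restrictSeminorm X ρ).toCompleted b) (map_add _)).range
  -- The infimum in the quotient norm need not be attained, so the lifts of elements of the dense
  -- subalgebra are controlled with the constant `2`.
  have hK : f.SurjectiveOnWith K 2 := by
    rintro _ ⟨b, rfl⟩
    change ∃ g, f g = (restrictSeminorm X ρ).toCompleted b ∧
      ‖g‖ ≤ 2 * ‖(restrictSeminorm X ρ).toCompleted b‖
    rcases (norm_nonneg ((restrictSeminorm X ρ).toCompleted b)).eq_or_lt with h0 | h0
    -- If the norm is zero there may be no lift of norm zero in `𝒞_c(H)`, but the image of `b` in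
    -- the completion is already `0`.
    · exact ⟨0, by rw [map_zero, norm_eq_zero.1 h0.symm], by rw [norm_zero]; positivity⟩
    · have hlt : restrictNorm X ρ b < 2 * restrictNorm X ρ b := by
        rw [CStarSeminorm.norm_toCompleted, restrictSeminorm_apply] at h0
        linarith
      obtain ⟨a, ha, hab, hle⟩ := hH.exists_restrict_eq_lt ρ hlt
      refine ⟨⟨ρ.toCompleted a, toCompleted_mem_ccClosure ρ _ ha⟩, ?_, ?_⟩
      · change restrictCompleted X ρ (ρ.toCompleted a) = _
        rw [restrictCompleted_toCompleted, hab]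
      · change ‖ρ.toCompleted a‖ ≤ _
        rw [ρ.norm_toCompleted, CStarSeminorm.norm_toCompleted]
        exact hle.le
  have hy : y ∈ K.topologicalClosure := (restrictSeminorm X ρ).denseRange_toCompleted y
  -- Successive approximation in the complete space `D` passes from the dense range to its closure,
  -- at the cost of enlarging the constant from `2` to `2 + 1`.
  obtain ⟨d, hd, hle⟩ := controlled_closure_of_complete two_pos one_pos hK y hy
  exact ⟨d, d.2, hd, hle.trans (by norm_num)⟩

/-- Compress a nearby `a₀` in `𝒞_c(G)` exactly, then add a small `d` in the closure of `𝒞_c(H)` that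
lifts `η_X(a - a₀)`. This makes the equality `η_X(a) = η_X(c)` exact and costs only a small error in
norm. -/
theorem IsLocalGroupoid.isCompressibleTo_restrictCompleted (hH : IsLocalGroupoid X H)
    (hunits : units G ⊆ H) : IsCompressibleTo (restrictCompleted X ρ).toLinearMap
      (ccClosure ρ hH.toIsOpenSubgroupoid) := by
  refine isCompressibleTo_of_cutoff (fun c _ d hd => hH.restrictCompleted_mul ρ hd)
    (fun c _ => restrictCompleted_star ρ c) fun a ε hε => ?_
  -- The error is at most `ε / 4` from compressing `a - a₀` plus `3 * (ε / 4)` from `d`.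
  obtain ⟨a₀, ha₀⟩ := ρ.denseRange_toCompleted.exists_dist_lt a (ε := ε / 4) (by positivity)
  rw [dist_eq_norm] at ha₀
  obtain ⟨w, hw, hc⟩ := exists_isCutoff_cut_mem_ccSpan hH.isOpen hH.reduction_subset a₀
  obtain ⟨d, hdD, hd, hdle⟩ := hH.exists_mem_ccClosure_norm_le ρ
    (restrictCompleted X ρ (a - ρ.toCompleted a₀))
  have hdle' : ‖d‖ ≤ 3 * (ε / 4) := hdle.trans (mul_le_mul_of_nonneg_left
    ((norm_restrictCompleted_apply_le ρ _).trans ha₀.le) (by norm_num))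
  refine ⟨ρ.toCompleted hw.toCc,
    toCompleted_mem_ccClosure ρ _ (hw.toCc_mem_ccSpan hunits), ?_, hw.norm_sub_mul_le ρ, ?_,
    _, add_mem (toCompleted_mem_ccClosure ρ _ hc) hdD, ?_, ?_⟩
  · rw [← map_star, hw.star_toCc]
  · change restrictCompleted X ρ _ = 0
    rw [restrictCompleted_toCompleted, hw.restrict_toCc, map_zero]
  · change restrictCompleted X ρ a = restrictCompleted X ρ (_ + d)
    rw [map_add, hd, restrictCompleted_toCompleted, hw.restrict_sub_mul', hw.restrict_sub_mul,
      map_sub, restrictCompleted_toCompleted, add_sub_cancel]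
  · set x := a - ρ.toCompleted a₀ with hx
    set W := ρ.toCompleted hw.toCc with hW
    have e : (a - W * a) - (a - W * a) * W - (ρ.toCompleted ((a₀ - hw.toCc * a₀) -
        (a₀ - hw.toCc * a₀) * hw.toCc) + d) = ((x - W * x) - (x - W * x) * W) - d := by
      simp only [map_sub, map_mul, ← hW, hx, mul_sub, sub_mul]
      abel
    rw [e]
    have h1 := (hw.norm_sub_mul_le' ρ (x - W * x)).trans (hw.norm_sub_mul_le ρ x)
    have h2 := norm_sub_le ((x - W * x) - (x - W * x) * W) d
    linarith

/-- The kernel of `𝒞_c(H) → 𝒞_c(G|_X)` is dense in the kernel of the extension. -/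
theorem IsLocalGroupoid.exists_restrict_eq_zero_norm_sub_lt (hH : IsLocalGroupoid X H)
    {a : ρ.Completed} (ha : a ∈ ccClosure ρ hH.toIsOpenSubgroupoid)
    (h0 : restrictCompleted X ρ a = 0) {ε : ℝ} (hε : 0 < ε) :
    ∃ f : Cc G, f.1 ∈ ccSpan H ∧ restrict X f = 0 ∧ ‖a - ρ.toCompleted f‖ < ε := by
  obtain ⟨b, hb, hab⟩ := exists_norm_sub_lt_of_mem_ccClosure ρ hH.toIsOpenSubgroupoid ha
    (half_pos hε)
  -- As `η_X(a) = 0` and `η_X` is a contraction, `r_X(b)` is small in the quotient norm. So it has a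
  -- small lift `c` in `𝒞_c(H)`, and `b - c` is in the algebraic kernel.
  have hlt : restrictNorm X ρ (restrict X b) < ε / 2 := by
    have h1 := norm_restrictCompleted_apply_le (X := X) ρ (a - ρ.toCompleted b)
    rw [map_sub, h0, zero_sub, norm_neg, restrictCompleted_toCompleted,
      CStarSeminorm.norm_toCompleted, restrictSeminorm_apply] at h1
    exact h1.trans_lt hab
  obtain ⟨c, hc, hcb, hlt'⟩ := hH.exists_restrict_eq_lt ρ hlt
  refine ⟨b - c, Submodule.sub_mem _ hb hc, by rw [map_sub, hcb, sub_self], ?_⟩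
  have e : a - ρ.toCompleted (b - c) = (a - ρ.toCompleted b) + ρ.toCompleted c := by
    rw [map_sub]
    abel
  rw [e]
  have := norm_add_le (a - ρ.toCompleted b) (ρ.toCompleted c)
  rw [ρ.norm_toCompleted c] at this
  linarith

theorem IsLocalGroupoid.isApproxUnitFor_ker_restrictCompleted (hH : IsLocalGroupoid X H)
    (hunits : units G ⊆ H) {I : Type*} [Preorder I] {u : I → Cc G} (hu : IsApproxUnitOff X u) :
    IsApproxUnitFor {a : ρ.Completed | a ∈ ccClosure ρ hH.toIsOpenSubgroupoid ∧
      restrictCompleted X ρ a = 0} (fun i => ρ.toCompleted (u i)) := by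
  have hmem : ∀ {w} (hw : IsCutoff X.carrierᶜ w), ρ.toCompleted hw.toCc ∈
      {a : ρ.Completed | a ∈ ccClosure ρ hH.toIsOpenSubgroupoid ∧
        restrictCompleted X ρ a = 0} := fun hw =>
    ⟨toCompleted_mem_ccClosure ρ _ (hw.toCc_mem_ccSpan hunits), by
      rw [restrictCompleted_toCompleted, hw.restrict_toCc, map_zero]⟩
  refine isApproxUnitFor_of_star_eq ?_ (fun i => ?_) (fun i => ?_) (fun i => ?_) (fun i => ?_) ?_
  · rintro a ⟨ha, h0⟩
    exact ⟨star_mem ha, by rw [restrictCompleted_star, h0, star_zero]⟩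
  · rw [← map_star, hu.star_eq]
  · obtain ⟨w, hw, e⟩ := hu.exists_isCutoff i
    rw [e]
    exact hmem hw
  · obtain ⟨v, hv, e⟩ := hu.exists_star_mul_self_eq i
    exact ⟨_, hmem hv, by rw [e, map_mul, map_star]⟩
  · obtain ⟨w, hw, e⟩ := hu.exists_isCutoff i
    rw [e, ρ.norm_toCompleted]
    exact hw.seminorm_toCc_le_one ρ
  · rintro a ⟨ha, h0⟩ ε hε
    obtain ⟨f, hf, hf0, haf⟩ := hH.exists_restrict_eq_zero_norm_sub_lt ρ ha h0 (half_pos hε)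
    filter_upwards [hu.eventually_sub_mul_le hH ρ hf hf0 (half_pos hε)] with i hi
    obtain ⟨w, hw, e⟩ := hu.exists_isCutoff i
    -- The first term is controlled by the contraction `1 - u i`, uniformly in `i`; the second by
    -- the approximate unit property on the algebraic kernel.
    have h1 : a - ρ.toCompleted (u i) * a =
        ((a - ρ.toCompleted f) - ρ.toCompleted (u i) * (a - ρ.toCompleted f)) +
          ρ.toCompleted (f - u i * f) := by
      rw [map_sub, map_mul, mul_sub]
      abel
    have h2 : ‖(a - ρ.toCompleted f) - ρ.toCompleted (u i) * (a - ρ.toCompleted f)‖ ≤ ε / 2 := by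
      rw [e]
      exact (hw.norm_sub_mul_le ρ _).trans haf.le
    rw [h1]
    refine (norm_add_le _ _).trans ?_
    rw [ρ.norm_toCompleted]
    linarith

end EtaleGroupoid

end Completions

/-! ### Assembly of the theorem -/

theorem theoremE {G : Type*} [TopologicalSpace G] [EtaleGroupoid G]
    (X : ClosedLocInv G)
    (ρ : CStarSeminorm (Cc G)) [ρ.IsNorm] :
    -- local groupoids with the full unit space exist
    (∃ H : Set G, IsLocalGroupoid X H ∧ units G ⊆ H) ∧
    -- restriction maps `𝒞_c(H)` onto `𝒞_c(G|_X)`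
    (∀ (H : Set G) (hH : IsLocalGroupoid X H) (b : Cc (Reduction X)),
      ∃ a ∈ ccSub H hH.toIsOpenSubgroupoid, restrict X a = b) ∧
    -- compressibility and approximate units before completion
    (∀ (H : Set G) (hH : IsLocalGroupoid X H), units G ⊆ H →
      IsCompressibleTo (restrict X ∘ₗ ρ.ofAlg)
        ((ccSub H hH.toIsOpenSubgroupoid).map ρ.toAlg) ∧
      ∀ (I : Type*) [Preorder I] [IsDirectedOrder I] [Nonempty I] (u : I → Cc G),
        IsApproxUnitOff X u →
        IsApproxUnitFor
          {a : ρ.Alg | a ∈ (ccSub H hH.toIsOpenSubgroupoid).map ρ.toAlg ∧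
            restrict X (ρ.ofAlg a) = 0}
          (fun i => ρ.toAlg (u i))) ∧
    -- the C*-seminorm `σ = ρ(X)`
    ∃ σ : CStarSeminorm (Cc (Reduction X)),
      -- it is the quotient norm from `𝒞_c(H)`, for every local groupoid `H`
      (∀ (H : Set G) (hH : IsLocalGroupoid X H) (b : Cc (Reduction X)),
        IsGLB {t : ℝ | ∃ a ∈ ccSub H hH.toIsOpenSubgroupoid,
          restrict X a = b ∧ ρ a = t} (σ b)) ∧
      -- and the quotient norm from `𝒞_c(G)`
      (∀ b : Cc (Reduction X),
        IsGLB {t : ℝ | ∃ a : Cc G, restrict X a = b ∧ ρ a = t} (σ b)) ∧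
      -- it is a norm if the evaluations at the points of `G|_X` are continuous for `ρ`
      ((∀ g ∈ reductionSet X.carrier, ∃ M : ℝ, ∀ f : Cc G, ‖f.1 g‖ ≤ M * ρ f) →
        σ.IsNorm) ∧
      -- the restriction map extends to the completions
      ∃ η : ρ.Completed →L[ℂ] σ.Completed, ‖η‖ ≤ 1 ∧
        (∀ a : Cc G, η (ρ.toCompleted a) = σ.toCompleted (restrict X a)) ∧
        ∀ (H : Set G) (hH : IsLocalGroupoid X H), units G ⊆ H →
          IsCompressibleTo η.toLinearMap
            ((ccSub H hH.toIsOpenSubgroupoid).map ρ.toCompleted).topologicalClosure ∧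
          ∀ (I : Type*) [Preorder I] [IsDirectedOrder I] [Nonempty I] (u : I → Cc G),
            IsApproxUnitOff X u →
            IsApproxUnitFor
              {a : ρ.Completed |
                a ∈ ((ccSub H hH.toIsOpenSubgroupoid).map ρ.toCompleted).topologicalClosure ∧
                η a = 0}
              (fun i => ρ.toCompleted (u i)) := by

  refine ⟨⟨_, isLocalGroupoid_localGroupoid X, units_subset_localGroupoid X⟩,
    fun H hH b => hH.exists_restrict_eq b,
    fun H hH hunits => ⟨hH.isCompressibleTo_restrict ρ hunits,
      fun I _ _ _ u hu => hH.isApproxUnitFor_ker_restrict ρ hunits hu⟩,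
    restrictSeminorm X ρ, fun H hH b => hH.isGLB_restrictNorm ρ b, isGLB_restrictNorm ρ,
    isNorm_restrictSeminorm ρ, restrictCompleted X ρ, norm_restrictCompleted_le ρ,
    restrictCompleted_toCompleted ρ,
    fun H hH hunits => ⟨hH.isCompressibleTo_restrictCompleted ρ hunits,
      fun I _ _ _ u hu => hH.isApproxUnitFor_ker_restrictCompleted ρ hunits hu⟩⟩
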